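/- Let $H$ be a real Hilbert space, and let $A$ be a nonnegative self-adjoint (in general unbounded) linear operator on $H$ with dense domain $D(A)$, where nonnegative means $\langle Ax,x\rangle\ge 0$ for all $x\in D(A)$. Let $A^{1/2}$ be its nonnegative self-adjoint square root, with domain $D(A^{1/2})$; $D(A)$ and $D(A^{1/2})$ carry their graph norms. Let $m:[0,+\infty)\to[0,+\infty)$ and $b:[0,+\infty)\to(0,+\infty)$ be locally Lipschitz continuous, let $(u_0,u_1)\in D(A)\times D(A^{1/2})$ satisfy $m(|A^{1/2}u_0|^2)\neq 0$, and let $T>0$. Then there exists $\varepsilon_0>0$ such that for every $\varepsilon\in(0,\varepsilon_0)$ the Cauchy problem $$\varepsilon u''(t)+b(t)u'(t)+m\bigl(|A^{1/2}u(t)|^2\bigr)Au(t)=0\quad (t\in[0,T]),\qquad u(0)=u_0,\quad u'(0)=u_1,$$ has a unique solution $$u\in C^2([0,T];H)\cap C^1([0,T];D(A^{1/2}))\cap C^0([0,T];D(A)).$$ -/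

import Mathlib

open scoped RealInnerProductSpace

namespace Kirchhoff

section SqrtBounded

variable {H : Type*} [NormedAddCommGroup H] [InnerProductSpace ℝ H]

theorem sum_catalan_le (n : ℕ) :
    ∑ k ∈ Finset.range n, (catalan k : ℝ) * (1 / 4) ^ k ≤ 2 := by
  induction n with
  | zero => simp
  | succ n ih =>
    have key : ∑ k ∈ Finset.range n, (catalan (k + 1) : ℝ) * (1 / 4) ^ k
        ≤ (∑ k ∈ Finset.range n, (catalan k : ℝ) * (1 / 4) ^ k) ^ 2 := by
      have h1 : ∀ k, (catalan (k + 1) : ℝ) * (1 / 4) ^ k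
          = ∑ ij ∈ Finset.HasAntidiagonal.antidiagonal k,
            ((catalan ij.1 : ℝ) * (1 / 4) ^ ij.1) * ((catalan ij.2 : ℝ) * (1 / 4) ^ ij.2) := by
        intro k
        rw [catalan_succ']
        push_cast
        rw [Finset.sum_mul]
        refine Finset.sum_congr rfl fun ij hij => ?_
        rw [← Finset.HasAntidiagonal.mem_antidiagonal.1 hij, pow_add]
        ring
      simp_rw [h1]
      rw [sq, Finset.sum_mul_sum, ← Finset.sum_product', Finset.sum_sigma']
      have hinj : Set.InjOn (fun x : (_ : ℕ) × (ℕ × ℕ) => x.2)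
          ((Finset.range n).sigma fun k => Finset.HasAntidiagonal.antidiagonal k) := by
        rintro ⟨k, a⟩ hx ⟨l, c⟩ hy hxy
        simp only [Finset.coe_sigma, Set.mem_sigma_iff, Finset.mem_coe,
          Finset.HasAntidiagonal.mem_antidiagonal] at hx hy
        simp only at hxy
        subst hxy
        obtain rfl : k = l := hx.2.symm.trans hy.2
        rfl
      rw [← Finset.sum_image (f := fun ij : ℕ × ℕ =>
        ((catalan ij.1 : ℝ) * (1 / 4) ^ ij.1) * ((catalan ij.2 : ℝ) * (1 / 4) ^ ij.2)) hinj]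
      refine Finset.sum_le_sum_of_subset_of_nonneg ?_ fun _ _ _ => by positivity
      intro ij hij
      simp only [Finset.mem_image, Finset.mem_sigma, Finset.mem_range,
        Finset.HasAntidiagonal.mem_antidiagonal] at hij
      obtain ⟨⟨k, c⟩, ⟨hk, hc⟩, rfl⟩ := hij
      simp only [Finset.mem_product, Finset.mem_range]
      simp only at hk hc
      omega
    rw [Finset.sum_range_succ']
    have e : ∑ k ∈ Finset.range n, (catalan (k + 1) : ℝ) * (1 / 4) ^ (k + 1)
        = (1 / 4) * ∑ k ∈ Finset.range n, (catalan (k + 1) : ℝ) * (1 / 4) ^ k := by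
      rw [Finset.mul_sum]
      exact Finset.sum_congr rfl fun k _ => by ring
    have h0 : 0 ≤ ∑ k ∈ Finset.range n, (catalan k : ℝ) * (1 / 4) ^ k := by positivity
    rw [e]
    simp only [catalan_zero]
    norm_num
    norm_num at key ih h0
    nlinarith

theorem summable_catalan : Summable fun k : ℕ => (catalan k : ℝ) * (1 / 4) ^ k :=
  summable_of_sum_range_le (fun _ => by positivity) sum_catalan_le

theorem tsum_catalan_le : ∑' k : ℕ, (catalan k : ℝ) * (1 / 4) ^ k ≤ 2 :=
  summable_catalan.tsum_le_of_sum_range_le sum_catalan_le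

theorem norm_pow_le_one {S : H →L[ℝ] H} (hS : ‖S‖ ≤ 1) (n : ℕ) : ‖S ^ n‖ ≤ 1 := by
  induction n with
  | zero => rw [pow_zero]; exact ContinuousLinearMap.norm_id_le (𝕜 := ℝ) (E := H)
  | succ n ih =>
    rw [pow_succ]
    exact (norm_mul_le _ _).trans (mul_le_one₀ ih (norm_nonneg _) hS)

theorem nonneg_of_norm_one_sub_le {Q : H →L[ℝ] H} (hQ : ‖1 - Q‖ ≤ 1) (x : H) : 0 ≤ ⟪Q x, x⟫ := by
  have h1 : ⟪(1 - Q) x, x⟫ ≤ ‖x‖ * ‖x‖ :=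
    (real_inner_le_norm _ _).trans (mul_le_mul_of_nonneg_right
      (((1 - Q).le_opNorm x).trans (mul_le_of_le_one_left (norm_nonneg _) hQ)) (norm_nonneg _))
  have h2 : (1 - Q) x = x - Q x := rfl
  rw [h2, inner_sub_left, real_inner_self_eq_norm_mul_norm] at h1
  linarith

theorem eq_zero_of_inner_eq_zero {X : H →L[ℝ] H} (hs : ∀ x y, ⟪X x, y⟫ = ⟪x, X y⟫)
    (hp : ∀ x, 0 ≤ ⟪X x, x⟫) {y : H} (hy : ⟪X y, y⟫ = 0) : X y = 0 := by
  set a := ‖X y‖ ^ 2 with ha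
  set c := ⟪X (X y), X y⟫ with hc
  have hc0 : 0 ≤ c := hp _
  have ha0 : 0 ≤ a := sq_nonneg _
  have h : ∀ t : ℝ, 0 ≤ 2 * t * a + t ^ 2 * c := by
    intro t
    have := hp (y + t • X y)
    simp only [map_add, map_smul, inner_add_left, inner_add_right, real_inner_smul_left,
      real_inner_smul_right, hy] at this
    rw [hs (X y) y, real_inner_self_eq_norm_sq, ← ha, ← hc] at this
    linarith
  have h1 := h (-(a / (c + 1)))
  have h2 : a / (c + 1) * (c + 1) = a := div_mul_cancel₀ _ (by positivity)
  set d := a / (c + 1) with hd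
  have hd0 : 0 ≤ d := by positivity
  have h3 : d = 0 := by
    have : d ^ 2 * (c + 2) ≤ 0 := by rw [← h2] at h1; nlinarith
    have : d ^ 2 ≤ 0 := by nlinarith [sq_nonneg d, mul_nonneg (sq_nonneg d) hc0]
    nlinarith
  rw [h3, zero_mul] at h2
  have h4 : ‖X y‖ ^ 2 = 0 := h2.symm
  simpa using h4

/-- Commuting nonnegative symmetric bounded operators with the same square agree. -/
theorem eq_of_mul_self_eq {X Y : H →L[ℝ] H} (hX : ∀ x y, ⟪X x, y⟫ = ⟪x, X y⟫)
    (hX0 : ∀ x, 0 ≤ ⟪X x, x⟫) (hY : ∀ x y, ⟪Y x, y⟫ = ⟪x, Y y⟫) (hY0 : ∀ x, 0 ≤ ⟪Y x, x⟫)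
    (hc : ∀ x, X (Y x) = Y (X x)) (h : ∀ x, X (X x) = Y (Y x)) : X = Y := by
  ext z
  have h1 : X (X z - Y z) + Y (X z - Y z) = 0 := by
    rw [map_sub, map_sub, hc, h]; abel
  have h2 : ⟪X (X z - Y z), X z - Y z⟫ + ⟪Y (X z - Y z), X z - Y z⟫ = 0 := by
    rw [← inner_add_left, h1, inner_zero_left]
  have h3 := eq_zero_of_inner_eq_zero hX hX0
    (le_antisymm (by linarith [hY0 (X z - Y z)]) (hX0 (X z - Y z)))
  have h4 := eq_zero_of_inner_eq_zero hY hY0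
    (le_antisymm (by linarith [hX0 (X z - Y z)]) (hY0 (X z - Y z)))
  have h5 : ‖X z - Y z‖ ^ 2 = 0 := by
    rw [← real_inner_self_eq_norm_sq, inner_sub_left, hX, hY, h3, h4]
    simp
  simpa [sub_eq_zero] using h5

/-- Square root of `1 - S` for a bounded self-adjoint contraction `S`, by the binomial series. -/
theorem exists_sqrt_one_sub [CompleteSpace H] (S : H →L[ℝ] H) (hs : IsSelfAdjoint S) (hS : ‖S‖ ≤ 1) :
    ∃ Q : H →L[ℝ] H, IsSelfAdjoint Q ∧ Q * Q = 1 - S ∧ ‖1 - Q‖ ≤ 1 ∧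
      ∀ C : H →L[ℝ] H, Commute C S → Commute C Q := by
  set f : ℕ → (H →L[ℝ] H) := fun k => ((catalan k : ℝ) * (1 / 4) ^ k) • S ^ k with hf
  have hle : ∀ k, ‖f k‖ ≤ (catalan k : ℝ) * (1 / 4) ^ k := by
    intro k
    rw [hf]
    simp only
    rw [norm_smul, Real.norm_of_nonneg (by positivity)]
    exact mul_le_of_le_one_right (by positivity) (norm_pow_le_one hS k)
  have hn : Summable fun k => ‖f k‖ :=
    Summable.of_nonneg_of_le (fun _ => norm_nonneg _) hle summable_catalan
  have hsum : Summable f := hn.of_norm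
  set G := ∑' k, f k with hG
  have hGn : ‖G‖ ≤ 2 :=
    (norm_tsum_le_tsum_norm hn).trans ((hn.tsum_le_tsum hle summable_catalan).trans tsum_catalan_le)
  have hGsa : IsSelfAdjoint G := by
    have : ∀ k, star (f k) = f k := fun k => by
      simp [hf, star_smul, star_pow, hs.star_eq]
    rw [isSelfAdjoint_iff, hG, tsum_star]
    simp_rw [this]
  have hcomm : ∀ C : H →L[ℝ] H, Commute C S → Commute C G := by
    intro C hC
    have : ∀ k, C * f k = f k * C := fun k => ((hC.pow_right k).smul_right _).eq
    change C * G = G * C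
    rw [hG, ← hsum.tsum_mul_left, ← hsum.tsum_mul_right]
    simp_rw [this]
  have hGG : G = 1 + (1 / 4 : ℝ) • (S * (G * G)) := by
    have h1 : G * G = ∑' k, ((catalan (k + 1) : ℝ) * (1 / 4) ^ k) • S ^ k := by
      rw [hG, tsum_mul_tsum_eq_tsum_sum_antidiagonal_of_summable_norm hn hn]
      refine tsum_congr fun k => ?_
      rw [catalan_succ']
      push_cast
      rw [Finset.sum_mul, Finset.sum_smul]
      refine Finset.sum_congr rfl fun ij hij => ?_
      rw [← Finset.HasAntidiagonal.mem_antidiagonal.1 hij]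
      simp only [hf, smul_mul_smul_comm, ← pow_add]
      congr 1
      rw [pow_add]
      ring
    have h2 : Summable fun k => ((catalan (k + 1) : ℝ) * (1 / 4) ^ k) • S ^ k := by
      refine Summable.of_norm_bounded (g := fun k => 4 * ((catalan (k + 1) : ℝ) * (1 / 4) ^ (k + 1)))
        (((summable_nat_add_iff 1).2 summable_catalan).mul_left 4) fun k => ?_
      rw [norm_smul, Real.norm_of_nonneg (by positivity)]
      refine (mul_le_of_le_one_right (by positivity) (norm_pow_le_one hS k)).trans (le_of_eq ?_)
      ring
    rw [h1, ← h2.tsum_mul_left, ← (h2.mul_left S).tsum_const_smul, hG, hsum.tsum_eq_zero_add]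
    congr 1
    · simp [hf]
    · refine tsum_congr fun k => ?_
      simp only [hf, mul_smul_comm, smul_smul, pow_succ' S]
      congr 1
      ring
  have hSG : Commute S G := hcomm S (Commute.refl S)
  refine ⟨1 - (1 / 2 : ℝ) • (S * G), ?_, ?_, ?_, ?_⟩
  · refine (IsSelfAdjoint.one _).sub (IsSelfAdjoint.smul (by simp [isSelfAdjoint_iff]) ?_)
    exact (hs.commute_iff hGsa).1 hSG
  · have h3 : S * G * (S * G) = S * (S * (G * G)) := by
      rw [mul_assoc, ← mul_assoc G S G, ← hSG.eq, mul_assoc]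
    have h4 : (1 / 4 : ℝ) • (S * (S * (G * G))) = S * G - S := by
      have : (1 / 4 : ℝ) • (S * (G * G)) = G - 1 := by
        rw [eq_sub_iff_add_eq, add_comm]; exact hGG.symm
      rw [← mul_smul_comm, this, mul_sub, mul_one]
    have h5 : (1 / 2 : ℝ) • (S * G) * (1 / 2 : ℝ) • (S * G) = S * G - S := by
      rw [smul_mul_smul_comm, h3, ← h4]
      norm_num
    have h6 : (1 / 2 : ℝ) • (S * G) + (1 / 2 : ℝ) • (S * G) = S * G := by
      rw [← add_smul]; norm_num
    have h7 : ∀ X : H →L[ℝ] H, (1 - X) * (1 - X) = 1 - (X + X) + X * X := fun X => by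
      noncomm_ring
    rw [h7, h5, h6]
    abel
  · rw [sub_sub_cancel, norm_smul]
    have : ‖S * G‖ ≤ 1 * 2 := (norm_mul_le _ _).trans (mul_le_mul hS hGn (norm_nonneg _) zero_le_one)
    norm_num
    linarith
  · intro C hC
    exact (Commute.one_right C).sub_right ((hC.mul_right (hcomm C hC)).smul_right _)

end SqrtBounded

section SqrtUnbounded

variable {H : Type*} [NormedAddCommGroup H] [InnerProductSpace ℝ H] [CompleteSpace H]

/-- `A` is a nonnegative self-adjoint (in general unbounded) operator. Self-adjointness
`A† = A` entails that the domain is dense (`IsSelfAdjoint.dense_domain`). -/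
def IsNonnegSelfAdjoint (A : H →ₗ.[ℝ] H) : Prop :=
  IsSelfAdjoint A ∧ ∀ x : A.domain, 0 ≤ ⟪A x, (x : H)⟫

/-- `B` is a nonnegative self-adjoint square root of `A`: the composition of `B` with itself, on its
natural domain `{x ∈ D(B) | B x ∈ D(B)}`, is `A` (with equality of domains). -/
def IsSqrt (A B : H →ₗ.[ℝ] H) : Prop :=
  IsNonnegSelfAdjoint B ∧
    ∀ x y : H, (x, y) ∈ A.graph ↔ ∃ z : H, (x, z) ∈ B.graph ∧ (z, y) ∈ B.graph

theorem inner_symm_of_isSelfAdjoint {A : H →ₗ.[ℝ] H} (hA : IsSelfAdjoint A)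
    {x y x' y' : H} (h : (x, y) ∈ A.graph) (h' : (x', y') ∈ A.graph) : ⟪y, x'⟫ = ⟪x, y'⟫ := by
  obtain ⟨a, rfl, rfl⟩ := (LinearPMap.mem_graph_iff A).1 h
  obtain ⟨a', rfl, rfl⟩ := (LinearPMap.mem_graph_iff A).1 h'
  have := LinearPMap.adjoint_isFormalAdjoint hA.dense_domain
  rw [LinearPMap.isSelfAdjoint_def.1 hA] at this
  exact this a a'

theorem mem_graph_of_forall_inner {A : H →ₗ.[ℝ] H} (hA : IsSelfAdjoint A)
    {z w : H} (h : ∀ x y : H, (x, y) ∈ A.graph → ⟪w, x⟫ = ⟪z, y⟫) : (z, w) ∈ A.graph := by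
  have hz : z ∈ A.adjoint.domain :=
    LinearPMap.mem_adjoint_domain_of_exists z ⟨w, fun x => h x (A x) (A.mem_graph x)⟩
  have h2 : A.adjoint ⟨z, hz⟩ = w :=
    LinearPMap.adjoint_apply_eq hA.dense_domain _ fun x => h x (A x) (A.mem_graph x)
  have h3 : (z, w) ∈ A.adjoint.graph := h2 ▸ A.adjoint.mem_graph ⟨z, hz⟩
  rwa [LinearPMap.isSelfAdjoint_def.1 hA] at h3

theorem isSelfAdjoint_of_forall {B : H →ₗ.[ℝ] H} (hd : Dense (B.domain : Set H))
    (hs : ∀ x y : B.domain, ⟪B x, (y : H)⟫ = ⟪(x : H), B y⟫)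
    (hm : ∀ z w : H, (∀ x : B.domain, ⟪w, (x : H)⟫ = ⟪z, B x⟫) → z ∈ B.domain) :
    IsSelfAdjoint B := by
  rw [LinearPMap.isSelfAdjoint_def]
  have hle : B.domain ≤ B.adjoint.domain := (LinearPMap.IsFormalAdjoint.le_adjoint hd hs).1
  refine LinearPMap.ext (le_antisymm (fun z hz => ?_) hle) fun x hx hy => ?_
  · exact hm z (B.adjoint ⟨z, hz⟩) fun x => LinearPMap.adjoint_isFormalAdjoint hd ⟨z, hz⟩ x
  · exact LinearPMap.adjoint_apply_eq hd _ fun v => hs ⟨x, hy⟩ v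

/-- The resolvent at `-1`: `R` is bounded, and the graph of `A` is `{(R y, y - R y)}`. -/
theorem exists_resolvent {A : H →ₗ.[ℝ] H} (hA : IsNonnegSelfAdjoint A) :
    ∃ R : H →L[ℝ] H, IsSelfAdjoint R ∧ ‖R‖ ≤ 1 ∧ ‖1 - R‖ ≤ 1 ∧
      ∀ x z : H, (x, z) ∈ A.graph ↔ ∃ y, x = R y ∧ z = y - R y := by
  have hnn : ∀ p : A.graph, 0 ≤ ⟪p.1.2, p.1.1⟫ := by
    rintro ⟨⟨x, z⟩, hp⟩
    obtain ⟨a, rfl, rfl⟩ := (LinearPMap.mem_graph_iff A).1 hp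
    exact hA.2 a
  let T : A.graph →ₗ[ℝ] H :=
    (LinearMap.fst ℝ H H + LinearMap.snd ℝ H H).comp A.graph.subtype
  have hT : ∀ p : A.graph, T p = p.1.1 + p.1.2 := fun p => rfl
  have hsq : ∀ p : A.graph, ‖p.1.1‖ ^ 2 + ‖p.1.2‖ ^ 2 ≤ ‖T p‖ ^ 2 := by
    intro p
    rw [hT, norm_add_sq_real, real_inner_comm]
    linarith [hnn p]
  have hn1 : ∀ p : A.graph, ‖p.1.1‖ ≤ ‖T p‖ := fun p =>
    le_of_sq_le_sq (by nlinarith [hsq p, sq_nonneg ‖p.1.2‖]) (norm_nonneg _)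
  have hn2 : ∀ p : A.graph, ‖p.1.2‖ ≤ ‖T p‖ := fun p =>
    le_of_sq_le_sq (by nlinarith [hsq p, sq_nonneg ‖p.1.1‖]) (norm_nonneg _)
  have hinj : Function.Injective T := by
    refine (injective_iff_map_eq_zero T).2 fun p hp => ?_
    have h1 := hn1 p
    have h2 := hn2 p
    rw [hp, norm_zero, norm_le_zero_iff] at h1 h2
    exact Subtype.ext (Prod.ext h1 h2)
  have hclosed : IsClosed (A.graph : Set (H × H)) := hA.1.isClosed
  have : CompleteSpace A.graph := hclosed.completeSpace_coe
  have hanti : AntilipschitzWith 1 T := AddMonoidHomClass.antilipschitz_of_bound T fun p => by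
    rw [NNReal.coe_one, one_mul]
    exact max_le (hn1 p) (hn2 p)
  have hcont : Continuous T := by
    change Continuous fun p : A.graph => p.1.1 + p.1.2
    fun_prop
  have hrc : IsClosed (LinearMap.range T : Set H) := by
    have h := hanti.isClosed_range (T.toAddMonoidHom.uniformContinuous_of_continuousAt_zero hcont.continuousAt)
    rwa [LinearMap.coe_range]
  have hsurj : Function.Surjective T := by
    rw [← LinearMap.range_eq_top]
    have : CompleteSpace (LinearMap.range T) := hrc.completeSpace_coe
    rw [← Submodule.orthogonal_eq_bot_iff, Submodule.eq_bot_iff]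
    intro z hz
    have h0 : ∀ p : A.graph, ⟪p.1.1 + p.1.2, z⟫ = 0 := fun p =>
      (Submodule.mem_orthogonal _ _).1 hz _ ⟨p, rfl⟩
    have h1 : (z, -z) ∈ A.graph := mem_graph_of_forall_inner hA.1 fun x y hxy => by
      have := h0 ⟨(x, y), hxy⟩
      simp only [inner_add_left] at this
      rw [inner_neg_left, real_inner_comm, real_inner_comm y z]
      linarith
    have h2 := hnn ⟨_, h1⟩
    simp only [inner_neg_left, real_inner_self_eq_norm_sq] at h2
    have h3 : ‖z‖ ^ 2 = 0 := le_antisymm (by linarith) (sq_nonneg _)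
    simpa using h3
  let e := LinearEquiv.ofBijective T ⟨hinj, hsurj⟩
  have he : ∀ y, (e.symm y).1.1 + (e.symm y).1.2 = y := fun y => e.apply_symm_apply y
  have hTe : ∀ y, T (e.symm y) = y := fun y => e.apply_symm_apply y
  let R : H →L[ℝ] H := LinearMap.mkContinuous
    ((LinearMap.fst ℝ H H).comp (A.graph.subtype.comp e.symm.toLinearMap)) 1 fun y => by
      rw [one_mul]
      have := hn1 (e.symm y)
      rwa [hTe] at this
  have hR : ∀ y, R y = (e.symm y).1.1 := fun y => rfl
  have hR' : ∀ y, y - R y = (e.symm y).1.2 := fun y => by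
    rw [hR, sub_eq_iff_eq_add', he]
  have hmem : ∀ y, (R y, y - R y) ∈ A.graph := fun y => by
    rw [hR', hR]; exact (e.symm y).2
  refine ⟨R, ?_, LinearMap.mkContinuous_norm_le _ zero_le_one _, ?_, fun x z => ⟨fun h => ?_, ?_⟩⟩
  · rw [ContinuousLinearMap.isSelfAdjoint_iff_isSymmetric]
    intro x y
    have := inner_symm_of_isSelfAdjoint hA.1 (hmem x) (hmem y)
    rw [inner_sub_left, inner_sub_right] at this
    change ⟪R x, y⟫ = ⟪x, R y⟫
    linarith
  · refine ContinuousLinearMap.opNorm_le_bound _ zero_le_one fun y => ?_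
    change ‖y - R y‖ ≤ 1 * ‖y‖
    rw [one_mul, hR']
    have := hn2 (e.symm y)
    rwa [hTe] at this
  · have h1 : e.symm (x + z) = ⟨(x, z), h⟩ := e.symm_apply_eq.2 rfl
    refine ⟨x + z, ?_, ?_⟩
    · rw [hR, h1]
    · rw [hR', h1]
  · rintro ⟨y, rfl, rfl⟩
    exact hmem y

theorem exists_isSqrt {A : H →ₗ.[ℝ] H} (hA : IsNonnegSelfAdjoint A) : ∃ B, IsSqrt A B := by
  obtain ⟨R, hRs, hR1, hR2, hgr⟩ := exists_resolvent hA
  obtain ⟨Q, hQs, hQQ, hQ1, hQc⟩ := exists_sqrt_one_sub (1 - R) ((IsSelfAdjoint.one _).sub hRs) hR2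
  obtain ⟨P, hPs, hPP, hP1, hPc⟩ := exists_sqrt_one_sub R hRs hR1
  obtain ⟨W, hWs, hWW, -, hWc⟩ := exists_sqrt_one_sub (1 - Q) ((IsSelfAdjoint.one _).sub hQs) hQ1
  rw [sub_sub_cancel] at hQQ hWW
  have hPR : Commute P R := (hPc R (Commute.refl R)).symm
  have hPQ : Commute P Q := hQc P ((Commute.one_right P).sub_right hPR)
  have hPW : Commute P W := hWc P ((Commute.one_right P).sub_right hPQ)
  have aP : ∀ x y : H, ⟪P x, y⟫ = ⟪x, P y⟫ := hPs.isSymmetric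
  have aQ : ∀ x y : H, ⟪Q x, y⟫ = ⟪x, Q y⟫ := hQs.isSymmetric
  have aW : ∀ x y : H, ⟪W x, y⟫ = ⟪x, W y⟫ := hWs.isSymmetric
  have ePQ : ∀ x, P (Q x) = Q (P x) := fun x => DFunLike.congr_fun hPQ.eq x
  have ePW : ∀ x, P (W x) = W (P x) := fun x => DFunLike.congr_fun hPW.eq x
  have eQQ : ∀ x, Q (Q x) = R x := fun x => DFunLike.congr_fun hQQ x
  have eWW : ∀ x, W (W x) = Q x := fun x => DFunLike.congr_fun hWW x
  have ePP : ∀ x, P (P x) = x - R x := fun x => DFunLike.congr_fun hPP x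
  have hRinj : ∀ x, R x = 0 → x = 0 := by
    intro x hx
    have := (hgr (R x) (x - R x)).2 ⟨x, rfl, rfl⟩
    rw [hx] at this
    simpa using LinearPMap.graph_fst_eq_zero_snd A this rfl
  have hQinj : ∀ x, Q x = 0 → x = 0 := fun x hx => hRinj x (by rw [← eQQ, hx, map_zero])
  let g : Submodule ℝ (H × H) := LinearMap.range ((Q : H →ₗ[ℝ] H).prod (P : H →ₗ[ℝ] H))
  have hg : ∀ x z, (x, z) ∈ g ↔ ∃ y, x = Q y ∧ z = P y := by
    intro x z
    refine exists_congr fun y => ?_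
    change (Q y, P y) = (x, z) ↔ _
    rw [Prod.mk.injEq]
    exact and_congr eq_comm eq_comm
  have hBg : g.toLinearPMap.graph = g := by
    refine Submodule.toLinearPMap_graph_eq g fun x hx hx1 => ?_
    obtain ⟨y, h1, h2⟩ := (hg x.1 x.2).1 hx
    rw [h2, hQinj y (by rw [← h1, hx1]), map_zero]
  set B := g.toLinearPMap with hB
  have hB' : ∀ x z, (x, z) ∈ B.graph ↔ ∃ y, x = Q y ∧ z = P y := by rw [hBg]; exact hg
  have hBx : ∀ x : B.domain, ∃ y, (x : H) = Q y ∧ B x = P y := fun x =>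
    (hB' _ _).1 (B.mem_graph x)
  have hdom : ∀ y, ∃ h : Q y ∈ B.domain, B ⟨Q y, h⟩ = P y := by
    intro y
    obtain ⟨a, ha1, ha2⟩ := (LinearPMap.mem_graph_iff B).1 ((hB' (Q y) (P y)).2 ⟨y, rfl, rfl⟩)
    have ha1' : (a : H) = Q y := ha1
    have h : Q y ∈ B.domain := ha1' ▸ a.2
    have h' : a = ⟨Q y, h⟩ := Subtype.ext ha1'
    exact ⟨h, h' ▸ ha2⟩
  refine ⟨B, ⟨isSelfAdjoint_of_forall ?_ ?_ ?_, ?_⟩, ?_⟩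
  · refine hA.1.dense_domain.mono fun x hx => ?_
    obtain ⟨y, h1, -⟩ := (hgr _ _).1 (A.mem_graph ⟨x, hx⟩)
    have h1' : x = R y := h1
    rw [h1', ← eQQ]
    exact (hdom _).1
  · intro x y
    obtain ⟨a, h1, h2⟩ := hBx x
    obtain ⟨c, h3, h4⟩ := hBx y
    rw [h1, h2, h3, h4, aP, ePQ, ← aQ]
  · intro z w h
    have h1 : P z = Q w := by
      refine ext_inner_right ℝ fun y => ?_
      obtain ⟨hy, hy2⟩ := hdom y
      have := h ⟨Q y, hy⟩
      rw [hy2] at this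
      rw [aP, ← this, aQ]
    have h2 : z = Q (P w + Q z) := by
      rw [map_add, ← ePQ, ← h1, ePP, eQQ]; abel
    rw [h2]
    exact (hdom _).1
  · intro x
    obtain ⟨a, h1, h2⟩ := hBx x
    rw [h1, h2, ← eWW, ← aW, ← ePW]
    exact nonneg_of_norm_one_sub_le hP1 (W a)
  · intro x y
    rw [hgr]
    constructor
    · rintro ⟨a, rfl, rfl⟩
      refine ⟨P (Q a), (hB' _ _).2 ⟨Q a, (eQQ a).symm, rfl⟩, (hB' _ _).2 ⟨P a, ePQ a, (ePP a).symm⟩⟩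
    · rintro ⟨z, h1, h2⟩
      obtain ⟨a, rfl, rfl⟩ := (hB' _ _).1 h1
      obtain ⟨c, h3, rfl⟩ := (hB' _ _).1 h2
      have h4 : a = Q (P c + Q a) := by
        rw [map_add, ← ePQ, ← h3, ePP, eQQ]; abel
      refine ⟨P c + Q a, ?_, ?_⟩
      · rw [← eQQ, ← h4]
      · rw [← eQQ, ← h4, add_sub_cancel_right]

/-- A nonnegative self-adjoint square root `B` of `A` is determined by the resolvent of `A`. -/
theorem IsSqrt.graph_iff {A B : H →ₗ.[ℝ] H} (hB : IsSqrt A B) {R Y : H →L[ℝ] H}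
    (hR1 : ‖R‖ ≤ 1) (hgr : ∀ x z : H, (x, z) ∈ A.graph ↔ ∃ y, x = R y ∧ z = y - R y)
    (hY : ∀ x y, ⟪Y x, y⟫ = ⟪x, Y y⟫) (hY0 : ∀ x, 0 ≤ ⟪Y x, x⟫)
    (hYc : ∀ C : H →L[ℝ] H, Commute C R → Commute C Y) (hYY : Y * Y = R * (1 - R))
    (x z : H) : (x, z) ∈ B.graph ↔ Y x = R z := by
  have hBs : ∀ {x y x' y' : H}, (x, y) ∈ B.graph → (x', y') ∈ B.graph → ⟪y, x'⟫ = ⟪x, y'⟫ :=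
    fun h h' => inner_symm_of_isSelfAdjoint hB.1.1 h h'
  have hB0 : ∀ {x y : H}, (x, y) ∈ B.graph → 0 ≤ ⟪y, x⟫ := by
    intro x y h
    obtain ⟨a, rfl, rfl⟩ := (LinearPMap.mem_graph_iff B).1 h
    exact hB.1.2 a
  have hun : ∀ {x y y' : H}, (x, y) ∈ B.graph → (x, y') ∈ B.graph → y = y' := fun h h' =>
    LinearPMap.mem_graph_snd_inj B h h' rfl
  have hadd : ∀ {x y x' y' : H}, (x, y) ∈ B.graph → (x', y') ∈ B.graph →
      (x + x', y + y') ∈ B.graph := fun h h' => B.graph.add_mem h h'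
  have hsub : ∀ {x y x' y' : H}, (x, y) ∈ B.graph → (x', y') ∈ B.graph →
      (x - x', y - y') ∈ B.graph := fun h h' => B.graph.sub_mem h h'
  have hex : ∀ y, ∃ w, (R y, w) ∈ B.graph ∧ (w, y - R y) ∈ B.graph := fun y =>
    (hB.2 _ _).1 ((hgr _ _).2 ⟨y, rfl, rfl⟩)
  choose f hf1 hf2 using hex
  have hRn : ∀ y, ‖R y‖ ≤ ‖y‖ := fun y =>
    (R.le_opNorm y).trans (mul_le_of_le_one_left (norm_nonneg _) hR1)
  let X : H →L[ℝ] H := LinearMap.mkContinuous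
    { toFun := f
      map_add' := fun x y => hun (hf1 (x + y)) (by rw [map_add]; exact hadd (hf1 x) (hf1 y))
      map_smul' := fun c x => hun (hf1 (c • x))
        (by rw [map_smul]; exact B.graph.smul_mem c (hf1 x)) } 2 fun y => by
      change ‖f y‖ ≤ 2 * ‖y‖
      have h1 : ‖f y‖ ^ 2 = ⟪R y, y - R y⟫ := by
        rw [← real_inner_self_eq_norm_sq]; exact hBs (hf1 y) (hf2 y)
      have h2 : ‖f y‖ ^ 2 ≤ ‖y‖ * (‖y‖ + ‖y‖) := by
        rw [h1]
        exact (real_inner_le_norm _ _).trans (mul_le_mul (hRn y)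
          ((norm_sub_le _ _).trans (by linarith [hRn y])) (norm_nonneg _) (norm_nonneg _))
      nlinarith [norm_nonneg (f y), norm_nonneg y]
  have hX1 : ∀ y, (R y, X y) ∈ B.graph := hf1
  have hX2 : ∀ y, (X y, y - R y) ∈ B.graph := hf2
  -- `B` commutes with the resolvent
  have hcomm : ∀ {x z : H}, (x, z) ∈ B.graph → X x = R z := by
    intro x z h
    have h1 : (x - R x, z - X x) ∈ B.graph := hsub h (hX1 x)
    have h2 : (X x, z - X x) ∈ A.graph := (hB.2 _ _).2 ⟨_, hX2 x, h1⟩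
    obtain ⟨y, h3, h4⟩ := (hgr _ _).1 h2
    have : z = y := by rw [h3] at h4; exact sub_left_injective h4
    rw [this, h3]
  have hXsymm : ∀ x y, ⟪X x, y⟫ = ⟪x, X y⟫ := by
    intro x y
    have h1 := hBs (hX1 x) (hX1 y)
    have h2 := hBs (hX2 x) (hX2 y)
    rw [inner_sub_left, inner_sub_right] at h2
    linarith
  have hXpos : ∀ x, 0 ≤ ⟪X x, x⟫ := by
    intro x
    have h1 := hB0 (hX1 x)
    have h2 := hB0 (hX2 x)
    rw [inner_sub_left] at h2
    linarith [real_inner_comm (R x) (X x), real_inner_comm x (X x)]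
  have hXX : ∀ x, X (X x) = R (x - R x) := fun x => hcomm (hX2 x)
  have hXR : ∀ x, X (R x) = R (X x) := fun x => hcomm (hX1 x)
  have hXY : ∀ x, X (Y x) = Y (X x) := by
    have : Commute X R := ContinuousLinearMap.ext hXR
    exact fun x => DFunLike.congr_fun (hYc X this).eq x
  have hYY' : ∀ x, Y (Y x) = R (x - R x) := fun x => DFunLike.congr_fun hYY x
  have hXeq : X = Y := eq_of_mul_self_eq hXsymm hXpos hY hY0 hXY fun x => by rw [hXX, hYY']
  rw [← hXeq]
  refine ⟨hcomm, fun h => ?_⟩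
  have h1 : (x - R x, z - R z) ∈ B.graph := by
    have h2 : x - R x = X z := hun (hX2 x) (by rw [h]; exact hX1 z)
    rw [h2]; exact hX2 z
  have h3 := hadd h1 (hX1 x)
  rwa [h, sub_add_cancel, sub_add_cancel] at h3

theorem IsSqrt.unique {A B C : H →ₗ.[ℝ] H} (hA : IsNonnegSelfAdjoint A)
    (hB : IsSqrt A B) (hC : IsSqrt A C) : B = C := by
  obtain ⟨R, hRs, hR1, hR2, hgr⟩ := exists_resolvent hA
  obtain ⟨Q, hQs, hQQ, hQ1, hQc⟩ := exists_sqrt_one_sub (1 - R) ((IsSelfAdjoint.one _).sub hRs) hR2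
  obtain ⟨P, hPs, hPP, hP1, hPc⟩ := exists_sqrt_one_sub R hRs hR1
  obtain ⟨W, hWs, hWW, -, hWc⟩ := exists_sqrt_one_sub (1 - Q) ((IsSelfAdjoint.one _).sub hQs) hQ1
  rw [sub_sub_cancel] at hQQ hWW
  have hQc' : ∀ D : H →L[ℝ] H, Commute D R → Commute D Q := fun D hD =>
    hQc D ((Commute.one_right D).sub_right hD)
  have hPQ : Commute P Q := hQc' P (hPc R (Commute.refl R)).symm
  have hPW : Commute P W := hWc P ((Commute.one_right P).sub_right hPQ)
  have aW : ∀ x y : H, ⟪W x, y⟫ = ⟪x, W y⟫ := hWs.isSymmetric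
  have hYs : IsSelfAdjoint (P * Q) := (hPs.commute_iff hQs).1 hPQ
  have hYY : P * Q * (P * Q) = R * (1 - R) := by
    rw [mul_assoc, ← mul_assoc Q P Q, ← hPQ.eq, mul_assoc P Q Q, ← mul_assoc, hPP, hQQ]
    noncomm_ring
  have hYp : ∀ x, 0 ≤ ⟪(P * Q) x, x⟫ := by
    intro x
    have h1 : (P * Q) x = W (P (W x)) := by
      rw [← hWW, ← mul_assoc, hPW.eq]; rfl
    rw [h1, aW]
    exact nonneg_of_norm_one_sub_le hP1 (W x)
  have hYc' : ∀ D : H →L[ℝ] H, Commute D R → Commute D (P * Q) := fun D hD =>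
    (hPc D hD).mul_right (hQc' D hD)
  refine LinearPMap.eq_of_eq_graph (Submodule.ext fun p => ?_)
  rw [← Prod.mk.eta (p := p), hB.graph_iff hR1 hgr hYs.isSymmetric hYp hYc' hYY,
    hC.graph_iff hR1 hgr hYs.isSymmetric hYp hYc' hYY]

open Classical in
/-- `A^{1/2}`: the nonnegative self-adjoint square root of `A`, which exists (`exists_isSqrt`) and
is unique (`IsSqrt.unique`) for every nonnegative self-adjoint `A`. -/
noncomputable def sqrtOp (A : H →ₗ.[ℝ] H) : H →ₗ.[ℝ] H :=
  if h : ∃ B, IsSqrt A B then h.choose else A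

theorem sqrtOp_spec {A : H →ₗ.[ℝ] H} (hA : IsNonnegSelfAdjoint A) : IsSqrt A (sqrtOp A) := by
  rw [sqrtOp, dif_pos (exists_isSqrt hA)]
  exact (exists_isSqrt hA).choose_spec

end SqrtUnbounded

section Equation

variable {H : Type*} [NormedAddCommGroup H] [InnerProductSpace ℝ H]

open Classical in
/-- The value `B x` for `x ∈ D(B)` (and `0` outside `D(B)`). -/
noncomputable def opApply (B : H →ₗ.[ℝ] H) (x : H) : H :=
  if h : x ∈ B.domain then B ⟨x, h⟩ else 0

/-- `u ∈ C^n(s; D(B))`, where `D(B)` carries the graph norm. The domain with its graph norm is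
represented by the graph of `B`, a subspace of `H × H`, through `x ↦ (x, B x)`. In particular
`u t ∈ D(B)` for all `t ∈ s`. -/
def ContDiffOnIntoDomain (B : H →ₗ.[ℝ] H) (n : ℕ) (u : ℝ → H) (s : Set ℝ) : Prop :=
  ∃ v : ℝ → B.graph, ContDiffOn ℝ n v s ∧ ∀ t ∈ s, (v t : H × H).1 = u t

/-- `u` is a solution on `[0, T]` of
`ε u'' + b(t) u' + m(|A^{1/2} u|²) A u = 0`, `u(0) = u₀`, `u'(0) = u₁`, in the class
`C²([0,T]; H) ∩ C¹([0,T]; D(A^{1/2})) ∩ C⁰([0,T]; D(A))`. Derivatives are taken within `[0, T]`,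
hence they are one-sided at the endpoints; the values of `u` outside `[0, T]` are irrelevant. -/
structure IsKirchhoffSolution [CompleteSpace H] (A : H →ₗ.[ℝ] H) (m b : ℝ → ℝ) (ε T : ℝ)
    (u₀ u₁ : H) (u : ℝ → H) : Prop where
  contDiffOn_two : ContDiffOn ℝ 2 u (Set.Icc 0 T)
  contDiffOn_one : ContDiffOnIntoDomain (sqrtOp A) 1 u (Set.Icc 0 T)
  contDiffOn_zero : ContDiffOnIntoDomain A 0 u (Set.Icc 0 T)
  equation : ∀ t ∈ Set.Icc 0 T,
    ε • derivWithin (derivWithin u (Set.Icc 0 T)) (Set.Icc 0 T) t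
      + b t • derivWithin u (Set.Icc 0 T) t
      + m (‖opApply (sqrtOp A) (u t)‖ ^ 2) • opApply A (u t) = 0
  initial : u 0 = u₀
  initial_deriv : derivWithin u (Set.Icc 0 T) 0 = u₁

end Equation

end Kirchhoff

namespace Kirchhoff

open Set Filter Topology

/-! ### Real analysis on a compact interval -/

/-! The danger is degeneration: the coefficient c(t) = m(|A^{1/2}u|²) could reach zero. For small ε
this is excluded on [0,T]. Formally c' = 2 m'(|A^{1/2}u|²)⟨Au, u'⟩, so bounds |u'| ≤ K c and |Au| ≤
K₁ give |c'| ≤ κ c. Then c decays at most exponentially, and ε|c'|/c ≤ β/2 with β the minimum of b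
on [0,T]. Friction now dominates the variation of c: the energies ε|A^{1/2}u'|²/c + |Au|² and
ε|u'|²/c + |A^{1/2}u|² do not increase, and |u'|²/c² stays below a level fixed by K₁/β and its
initial value. With K and K₁ chosen with room to spare, these conclusions are strictly better than
the assumed bounds, and continuous induction closes the loop (`IsBoundedSolution.energies_le`,
`IsBoundedSolution.norm_deriv_lt`).

The argument is run on regularized problems: A becomes its Yosida approximation Y = A J, J = (1 +
lA)⁻¹, and m is truncated and averaged over a window of length l. This is a globally Lipschitz
ordinary differential equation in H with a C¹ coefficient, and all bounds are uniform in l. The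
difference of two approximations obeys an energy estimate with error of order √l + √l' beyond the
initial discrepancy (`IsBoundedSolution.difference_le`), so u' and A^{1/2}J u converge uniformly
(`exists_isWeakSolution_of_bounds`).

The limit solves the equation only after a resolvent is applied. But its coefficient is now a given
Lipschitz function of time, bounded below, so the equation may be treated as linear. The energy
estimate half a power of A higher, applied to differences of the regularizations J²u, gives
continuity of A^{1/2}u' and Au (`IsWeakSolution.exists_isStrongSolution`). Uniqueness is again
`energy_le`, for the difference of two solutions; only the constructed one has to be nondegenerate
(`IsStrongSolution.eqOn`). -/

theorem le_mul_exp_of_deriv_le {f f' : ℝ → ℝ} {k T : ℝ}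
    (hf : ∀ t ∈ Icc 0 T, HasDerivWithinAt f (f' t) (Icc 0 T) t)
    (h : ∀ t ∈ Ioo 0 T, f' t ≤ k * f t) :
    ∀ t ∈ Icc 0 T, f t ≤ f 0 * Real.exp (k * t) := by
  have he : ∀ t : ℝ, HasDerivAt (fun t => Real.exp (-(k * t))) (-k * Real.exp (-(k * t))) t :=
    fun t => by
      have := ((hasDerivAt_id t).const_mul k).neg.exp
      simpa [mul_comm] using this
  have hd : ∀ t ∈ Icc 0 T, HasDerivWithinAt (fun t => f t * Real.exp (-(k * t)))
      (f' t * Real.exp (-(k * t)) + f t * (-k * Real.exp (-(k * t)))) (Icc 0 T) t :=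
    fun t ht => (hf t ht).mul (he t).hasDerivWithinAt
  -- Monotonicity needs the differential inequality only in the interior. This matters in the
  -- bootstrap, where the bounds are known only before the final time.
  have hanti : AntitoneOn (fun t => f t * Real.exp (-(k * t))) (Icc 0 T) := by
    refine antitoneOn_of_hasDerivWithinAt_nonpos (convex_Icc 0 T)
      (fun t ht => (hd t ht).continuousWithinAt)
      (fun t ht => (hd t (interior_subset ht)).mono interior_subset) fun t ht => ?_
    rw [interior_Icc] at ht
    nlinarith [h t ht, Real.exp_pos (-(k * t))]
  intro t ht
  have h0 := hanti (left_mem_Icc.2 (ht.1.trans ht.2)) ht ht.1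
  simp only [mul_zero, neg_zero, Real.exp_zero, mul_one] at h0
  rw [Real.exp_neg, ← div_eq_mul_inv, div_le_iff₀ (Real.exp_pos _)] at h0
  exact h0

/-- Continuous induction on a compact interval. -/
theorem forall_mem_Icc_of_isOpen {T : ℝ} {p : ℝ → Prop}
    (hclosed : IsClosed {t | t ∈ Icc 0 T ∧ ¬ p t})
    (hstep : ∀ t ∈ Icc 0 T, (∀ s ∈ Ico 0 t, p s) → p t) : ∀ t ∈ Icc 0 T, p t := by
  by_contra! h
  obtain ⟨t, ht, hp⟩ := h
  have hne : {t | t ∈ Icc 0 T ∧ ¬ p t}.Nonempty := ⟨t, ht, hp⟩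
  have hbdd : BddBelow {t | t ∈ Icc 0 T ∧ ¬ p t} := ⟨0, fun s hs => hs.1.1⟩
  -- The infimum is itself a failure, the first one, which contradicts `hstep`. The case t = 0 of
  -- `hstep` has a vacuous premise and serves as the base case.
  have hmem := hclosed.csInf_mem hne hbdd
  refine hmem.2 (hstep _ hmem.1 fun s hs => ?_)
  by_contra hps
  exact absurd (csInf_le hbdd ⟨⟨hs.1, hs.2.le.trans hmem.1.2⟩, hps⟩) (not_le.2 hs.2)

/-- The average of `f` over `[x, x + h]`. -/
noncomputable def forwardAverage (f : ℝ → ℝ) (h x : ℝ) : ℝ := h⁻¹ * ∫ s in x..x + h, f s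

/-- Averaging makes a Lipschitz function C¹ while keeping its bounds and its Lipschitz constant L,
with error at most L h. The window lies to the right of x, so that a function constant on a
half-line to the right stays exactly constant there. -/
theorem hasDerivAt_forwardAverage {f : ℝ → ℝ} (hf : Continuous f) (h x : ℝ) :
    HasDerivAt (forwardAverage f h) (h⁻¹ * (f (x + h) - f x)) x := by
  have hF : ∀ y, HasDerivAt (fun y => ∫ s in (0 : ℝ)..y, f s) (f y) y := fun y =>
    hf.integral_hasStrictDerivAt 0 y |>.hasDerivAt
  have h1 := (((hF (x + h)).comp_add_const x h).sub (hF x)).const_mul h⁻¹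
  refine h1.congr_of_eventuallyEq (Eventually.of_forall fun y => ?_)
  simp only [forwardAverage, Pi.sub_apply]
  rw [intervalIntegral.integral_interval_sub_left (hf.intervalIntegrable _ _)
    (hf.intervalIntegrable _ _)]

theorem continuous_forwardAverage {f : ℝ → ℝ} (hf : Continuous f) (h : ℝ) :
    Continuous (forwardAverage f h) :=
  continuous_iff_continuousAt.2 fun x => (hasDerivAt_forwardAverage hf h x).continuousAt

theorem le_forwardAverage {f : ℝ → ℝ} (hf : Continuous f) {h x a : ℝ} (hh : 0 < h)
    (ha : ∀ s ∈ Icc x (x + h), a ≤ f s) : a ≤ forwardAverage f h x := by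
  have h1 : ∫ _ in x..x + h, a ≤ ∫ s in x..x + h, f s :=
    intervalIntegral.integral_mono_on (by linarith) (by simp) (hf.intervalIntegrable _ _) ha
  rw [intervalIntegral.integral_const, smul_eq_mul, add_sub_cancel_left] at h1
  rw [forwardAverage, inv_mul_eq_div, le_div_iff₀ hh, mul_comm]
  exact h1

theorem forwardAverage_le {f : ℝ → ℝ} (hf : Continuous f) {h x a : ℝ} (hh : 0 < h)
    (ha : ∀ s ∈ Icc x (x + h), f s ≤ a) : forwardAverage f h x ≤ a := by
  have h1 : ∫ s in x..x + h, f s ≤ ∫ _ in x..x + h, a :=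
    intervalIntegral.integral_mono_on (by linarith) (hf.intervalIntegrable _ _) (by simp) ha
  rw [intervalIntegral.integral_const, smul_eq_mul, add_sub_cancel_left] at h1
  rw [forwardAverage, inv_mul_eq_div, div_le_iff₀ hh, mul_comm]
  exact h1

theorem abs_forwardAverage_sub_le {f : ℝ → ℝ} {L : ℝ} (hL : ∀ x y, |f x - f y| ≤ L * |x - y|)
    (hf : Continuous f) {h : ℝ} (hh : 0 < h) (x : ℝ) : |forwardAverage f h x - f x| ≤ L * h := by
  have hL0 : 0 ≤ L := by have := (abs_nonneg _).trans (hL 1 0); simpa using this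
  have h1 : ∀ s ∈ Icc x (x + h), |f s - f x| ≤ L * h := fun s hs =>
    (hL s x).trans (mul_le_mul_of_nonneg_left
      (by rw [abs_of_nonneg (by linarith [hs.1])]; linarith [hs.2]) hL0)
  rw [abs_le]
  constructor
  · have := le_forwardAverage hf hh fun s hs => (by linarith [(abs_le.1 (h1 s hs)).1] :
      f x - L * h ≤ f s)
    linarith
  · have := forwardAverage_le hf hh fun s hs => (by linarith [(abs_le.1 (h1 s hs)).2] :
      f s ≤ f x + L * h)
    linarith

theorem abs_deriv_forwardAverage_le {f : ℝ → ℝ} {L : ℝ}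
    (hL : ∀ x y, |f x - f y| ≤ L * |x - y|) {h : ℝ} (hh : 0 < h) (x : ℝ) :
    |h⁻¹ * (f (x + h) - f x)| ≤ L := by
  have h1 := hL (x + h) x
  rw [add_sub_cancel_left, abs_of_pos hh] at h1
  rw [abs_mul, abs_of_pos (inv_pos.2 hh), inv_mul_eq_div, div_le_iff₀ hh]
  exact h1

theorem continuous_of_abs_sub_le {f : ℝ → ℝ} {L : ℝ} (hL : ∀ x y, |f x - f y| ≤ L * |x - y|) :
    Continuous f :=
  (LipschitzWith.of_dist_le' (K := L) fun x y => hL x y).continuous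

/-! ### Antiderivatives and limits of functions on [0,T] -/

section Ode

/-- Extension of a function on `[0, T]` by its boundary values. -/
def clampExtend {E : Type*} (T : ℝ) (f : ℝ → E) (t : ℝ) : E := f (max 0 (min t T))

theorem clampExtend_eq {E : Type*} {T : ℝ} {f : ℝ → E} {t : ℝ} (ht : t ∈ Icc 0 T) :
    clampExtend T f t = f t := by
  rw [clampExtend, min_eq_left ht.2, max_eq_right ht.1]

theorem clamp_mem {T : ℝ} (hT : 0 ≤ T) (t : ℝ) : max 0 (min t T) ∈ Icc 0 T :=
  ⟨le_max_left _ _, max_le hT (min_le_right _ _)⟩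

theorem continuous_clampExtend {E : Type*} [TopologicalSpace E] {T : ℝ} (hT : 0 ≤ T)
    {f : ℝ → E} (hf : ContinuousOn f (Icc 0 T)) :
    Continuous (clampExtend T f) :=
  hf.comp_continuous (by fun_prop) (clamp_mem hT)

theorem abs_clamp_sub_le (T x y : ℝ) : |max 0 (min x T) - max 0 (min y T)| ≤ |x - y| :=
  by
  rw [max_comm 0, max_comm 0]
  refine (abs_max_sub_max_le_abs _ _ _).trans ?_
  simpa using abs_min_sub_min_le_max x T y T

variable {E : Type*} [NormedAddCommGroup E] [NormedSpace ℝ E] [CompleteSpace E]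

/-- The function with initial value `x₀` and derivative `g` on `[0, T]`. -/
theorem exists_antiderivative {T : ℝ} (hT : 0 ≤ T) {g : ℝ → E} (hg : ContinuousOn g (Icc 0 T))
    (x₀ : E) : ∃ f : ℝ → E, f 0 = x₀ ∧ Continuous f ∧
      (∀ t ∈ Icc 0 T, HasDerivWithinAt f (g t) (Icc 0 T) t) := by
  have hc := continuous_clampExtend hT hg
  have hd : ∀ t, HasDerivAt (fun t => x₀ + ∫ s in (0 : ℝ)..t, clampExtend T g s)
      (clampExtend T g t) t := fun t =>
    (hc.integral_hasStrictDerivAt 0 t).hasDerivAt.const_add x₀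
  refine ⟨_, by simp, continuous_iff_continuousAt.2 fun t => (hd t).continuousAt, fun t ht => ?_⟩
  have := (hd t).hasDerivWithinAt (s := Icc 0 T)
  rwa [clampExtend_eq ht] at this

theorem eq_add_integral {T : ℝ} {f g : ℝ → E}
    (hf : ∀ t ∈ Icc 0 T, HasDerivWithinAt f (g t) (Icc 0 T) t) (hg : ContinuousOn g (Icc 0 T))
    {t : ℝ} (ht : t ∈ Icc 0 T) : f t = f 0 + ∫ s in (0 : ℝ)..t, g s := by
  have hsub : Icc 0 t ⊆ Icc 0 T := Icc_subset_Icc_right ht.2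
  rw [intervalIntegral.integral_eq_sub_of_hasDerivAt_of_le ht.1
    (fun s hs => (hf s (hsub hs)).continuousWithinAt.mono hsub)
    (fun s hs => (hf s (hsub (Ioo_subset_Icc_self hs))).hasDerivAt
      (Icc_mem_nhds hs.1 (hs.2.trans_le ht.2)))
    ((hg.mono hsub).intervalIntegrable_of_Icc ht.1)]
  abel

theorem tendsto_of_deriv_tendsto {T C : ℝ} {f g : ℕ → ℝ → E} {F G : ℝ → E} {x₀ : E}
    (hf : ∀ n, ∀ t ∈ Icc 0 T, HasDerivWithinAt (f n) (g n t) (Icc 0 T) t)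
    (hgc : ∀ n, ContinuousOn (g n) (Icc 0 T))
    (hF : ∀ t ∈ Icc 0 T, HasDerivWithinAt F (G t) (Icc 0 T) t) (hGc : ContinuousOn G (Icc 0 T))
    (h0 : Tendsto (fun n => f n 0) atTop (𝓝 x₀)) (hF0 : F 0 = x₀)
    (hg : ∀ t ∈ Icc 0 T, Tendsto (fun n => g n t) atTop (𝓝 (G t)))
    (hb : ∀ᶠ n in atTop, ∀ t ∈ Icc 0 T, ‖g n t‖ ≤ C) :
    ∀ t ∈ Icc 0 T, Tendsto (fun n => f n t) atTop (𝓝 (F t)) := by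
  intro t ht
  have hsub : uIoc 0 t ⊆ Icc 0 T := by
    rw [uIoc_of_le ht.1]
    exact Ioc_subset_Icc_self.trans (Icc_subset_Icc_right ht.2)
  rw [eq_add_integral hF hGc ht, hF0]
  have : (fun n => f n t) = fun n => f n 0 + ∫ s in (0 : ℝ)..t, g n s :=
    funext fun n => eq_add_integral (hf n) (hgc n) ht
  rw [this]
  refine h0.add (intervalIntegral.tendsto_integral_filter_of_dominated_convergence (fun _ => C)
    (Eventually.of_forall fun n => ?_) ?_ (by simp) ?_)
  · exact ((hgc n).mono hsub).aestronglyMeasurable measurableSet_uIoc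
  · filter_upwards [hb] with n hn
    exact Eventually.of_forall fun s hs => hn s (hsub hs)
  · exact Eventually.of_forall fun s hs => hg s (hsub hs)

/-- Pointwise convergence and a uniform bound on the derivatives are enough: by dominated
convergence the functions also converge to the antiderivative of G, which must then be F. -/
theorem hasDerivWithinAt_of_tendsto {T C : ℝ} (hT : 0 ≤ T) {f g : ℕ → ℝ → E} {F G : ℝ → E}
    (hf : ∀ n, ∀ t ∈ Icc 0 T, HasDerivWithinAt (f n) (g n t) (Icc 0 T) t)
    (hgc : ∀ n, ContinuousOn (g n) (Icc 0 T)) (hGc : ContinuousOn G (Icc 0 T))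
    (hF : ∀ t ∈ Icc 0 T, Tendsto (fun n => f n t) atTop (𝓝 (F t)))
    (hg : ∀ t ∈ Icc 0 T, Tendsto (fun n => g n t) atTop (𝓝 (G t)))
    (hb : ∀ᶠ n in atTop, ∀ t ∈ Icc 0 T, ‖g n t‖ ≤ C) :
    ∀ t ∈ Icc 0 T, HasDerivWithinAt F (G t) (Icc 0 T) t := by
  obtain ⟨F₂, h0, -, hF₂⟩ := exists_antiderivative hT hGc (F 0)
  have h1 := tendsto_of_deriv_tendsto hf hgc hF₂ hGc (hF 0 (left_mem_Icc.2 hT)) h0 hg hb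
  intro t ht
  exact (hF₂ t ht).congr (fun s hs => tendsto_nhds_unique (hF s hs) (h1 s hs))
    (tendsto_nhds_unique (hF t ht) (h1 t ht))

/-- A uniformly Cauchy sequence of continuous functions on `[0, T]`. -/
theorem exists_limit_of_uniformCauchy {E : Type*} [NormedAddCommGroup E] [CompleteSpace E]
    {T : ℝ} {f : ℕ → ℝ → E} {φ : ℕ × ℕ → ℝ}
    (hfc : ∀ n, ContinuousOn (f n) (Icc 0 T)) (hφ : Tendsto φ atTop (𝓝 0))
    (h : ∀ n k, ∀ t ∈ Icc 0 T, ‖f n t - f k t‖ ^ 2 ≤ φ (n, k)) :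
    ∃ F : ℝ → E, ContinuousOn F (Icc 0 T) ∧
      (∀ t ∈ Icc 0 T, Tendsto (fun n => f n t) atTop (𝓝 (F t))) ∧
      ∃ C, (∀ᶠ n in atTop, ∀ t ∈ Icc 0 T, ‖f n t‖ ≤ C) ∧ ∀ t ∈ Icc 0 T, ‖F t‖ ≤ C := by
  have hu : UniformCauchySeqOn f atTop (Icc 0 T) := by
    rw [Metric.uniformCauchySeqOn_iff]
    intro δ hδ
    have h1 := hφ.eventually (gt_mem_nhds (show (0 : ℝ) < δ ^ 2 by positivity))
    rw [eventually_atTop_prod_self'] at h1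
    obtain ⟨N, hN⟩ := h1
    refine ⟨N, fun n hn k hk t ht => ?_⟩
    rw [dist_eq_norm]
    exact lt_of_pow_lt_pow_left₀ 2 hδ.le ((h n k t ht).trans_lt (hN n hn k hk))
  -- Outside [0,T] the limit function takes the irrelevant value 0.
  have hex : ∀ t, ∃ x, t ∈ Icc 0 T → Tendsto (fun n => f n t) atTop (𝓝 x) := by
    intro t
    by_cases ht : t ∈ Icc 0 T
    · obtain ⟨x, hx⟩ := cauchySeq_tendsto_of_complete (hu.cauchySeq ht)
      exact ⟨x, fun _ => hx⟩
    · exact ⟨0, fun h => absurd h ht⟩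
  choose F hF using hex
  have hunif := hu.tendstoUniformlyOn_of_tendsto hF
  have hFc : ContinuousOn F (Icc 0 T) := hunif.continuousOn (Frequently.of_forall hfc)
  obtain ⟨C, hC⟩ := isCompact_Icc.exists_bound_of_continuousOn hFc
  refine ⟨F, hFc, hF, C + 1, ?_, fun t ht => (hC t ht).trans (by linarith)⟩
  filter_upwards [Metric.tendstoUniformlyOn_iff.1 hunif 1 one_pos] with n hn t ht
  have h1 := hn t ht
  rw [dist_eq_norm, norm_sub_rev] at h1
  linarith [norm_le_norm_add_norm_sub' (f n t) (F t), hC t ht]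

end Ode

/-! ### Global solutions of Lipschitz differential equations -/

section GlobalOde

variable {E : Type*} [NormedAddCommGroup E] [NormedSpace ℝ E] [CompleteSpace E]

theorem integral_exp_mul {k : ℝ} (hk : k ≠ 0) (t : ℝ) :
    ∫ s in (0 : ℝ)..t, Real.exp (k * s) = (Real.exp (k * t) - 1) / k := by
  have hd : ∀ s : ℝ, HasDerivAt (fun s => Real.exp (k * s) / k) (Real.exp (k * s)) s := fun s => by
    have := (((hasDerivAt_id s).const_mul k).exp).div_const k
    simpa [hk] using this
  rw [intervalIntegral.integral_eq_sub_of_hasDerivAt (fun s _ => hd s)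
    ((by fun_prop : Continuous fun s => Real.exp (k * s)).intervalIntegrable _ _)]
  simp [sub_div]

/-- Global existence for ordinary differential equations with a globally Lipschitz right-hand
side. -/
theorem exists_forall_hasDerivWithinAt_of_lipschitz {f : ℝ → E → E} {K T : ℝ} (hK0 : 0 ≤ K)
    (hT : 0 ≤ T) (hf : Continuous (Function.uncurry f))
    (hK : ∀ t x y, ‖f t x - f t y‖ ≤ K * ‖x - y‖) (x₀ : E) :
    ∃ x : ℝ → E, x 0 = x₀ ∧ ∀ t ∈ Icc 0 T, HasDerivWithinAt x (f t (x t)) (Icc 0 T) t := by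
  -- The unknown of the fixed-point problem is y = exp(-k t) x. In this weighted form the Picard map
  -- contracts by K / k ≤ 1/2, whatever the length T, so no continuation of local solutions is
  -- needed.
  set k := 2 * K + 1 with hk
  have hk0 : 0 < k := by positivity
  let F : C(Icc 0 T, E) → ℝ → E := fun y s => f s (Real.exp (k * s) • IccExtend hT y s)
  have hF : ∀ y, Continuous (F y) := fun y => by
    have h1 : Continuous (IccExtend hT y) := y.continuous.Icc_extend'
    exact hf.comp (by fun_prop : Continuous fun s => (s, Real.exp (k * s) • IccExtend hT y s))
  let X : C(Icc 0 T, E) → ℝ → E := fun y t => x₀ + ∫ s in (0 : ℝ)..t, F y s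
  have hX : ∀ y t, HasDerivAt (X y) (F y t) t := fun y t =>
    ((hF y).integral_hasStrictDerivAt 0 t).hasDerivAt.const_add x₀
  have hXc : ∀ y, Continuous (X y) := fun y =>
    continuous_iff_continuousAt.2 fun t => (hX y t).continuousAt
  let Φ : C(Icc 0 T, E) → C(Icc 0 T, E) := fun y =>
    ⟨fun t => Real.exp (-(k * t)) • X y t, by have := hXc y; fun_prop⟩
  have hΦ : ContractingWith (1 / 2) Φ := by
    refine ⟨by norm_num, LipschitzWith.of_dist_le_mul fun y z => ?_⟩
    rw [ContinuousMap.dist_le (by positivity)]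
    rintro ⟨t, ht⟩
    have h1 : ‖X y t - X z t‖ ≤ ∫ s in (0 : ℝ)..t, K * dist y z * Real.exp (k * s) := by
      have h2 : X y t - X z t = ∫ s in (0 : ℝ)..t, (F y s - F z s) := by
        rw [intervalIntegral.integral_sub ((hF y).intervalIntegrable _ _)
          ((hF z).intervalIntegrable _ _)]
        simp [X]
      rw [h2]
      refine intervalIntegral.norm_integral_le_of_norm_le ht.1 (Eventually.of_forall fun s hs => ?_)
        ((by fun_prop : Continuous fun s => K * dist y z * Real.exp (k * s)).intervalIntegrable _ _)
      refine (hK s _ _).trans ?_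
      rw [mul_assoc]
      refine mul_le_mul_of_nonneg_left ?_ hK0
      rw [← smul_sub, norm_smul, Real.norm_of_nonneg (Real.exp_pos _).le, mul_comm]
      refine mul_le_mul_of_nonneg_right ?_ (Real.exp_pos _).le
      rw [← dist_eq_norm]
      exact ContinuousMap.dist_apply_le_dist _
    rw [intervalIntegral.integral_const_mul, integral_exp_mul hk0.ne'] at h1
    have h3 : K * dist y z * ((Real.exp (k * t) - 1) / k) ≤ 1 / 2 * dist y z * Real.exp (k * t) := by
      rw [← mul_div_assoc, div_le_iff₀ hk0]
      have h4 : 0 ≤ dist y z := dist_nonneg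
      have h5 := Real.exp_pos (k * t)
      have h6 : 0 ≤ dist y z * Real.exp (k * t) := by positivity
      have h7 : 0 ≤ K * dist y z := by positivity
      rw [hk]
      nlinarith
    change dist (Real.exp (-(k * t)) • X y t) (Real.exp (-(k * t)) • X z t) ≤ _
    rw [dist_eq_norm, ← smul_sub, norm_smul, Real.norm_of_nonneg (Real.exp_pos _).le, Real.exp_neg,
      inv_mul_le_iff₀ (Real.exp_pos _)]
    refine h1.trans (h3.trans (le_of_eq ?_))
    push_cast
    ring
  have hfix : Φ (hΦ.fixedPoint Φ) = hΦ.fixedPoint Φ := hΦ.fixedPoint_isFixedPt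
  set y := hΦ.fixedPoint Φ
  refine ⟨X y, by simp [X], fun t ht => ?_⟩
  have h1 : X y t = Real.exp (k * t) • IccExtend hT y t := by
    rw [IccExtend_of_mem hT _ ht]
    conv_rhs => rw [← hfix]
    change _ = Real.exp (k * t) • Real.exp (-(k * t)) • X y t
    rw [smul_smul, ← Real.exp_add, add_neg_cancel, Real.exp_zero, one_smul]
  rw [h1]
  exact (hX y t).hasDerivWithinAt

end GlobalOde

/-! ### Energy estimates with a time-dependent coefficient -/

section Energy

variable {H : Type*} [NormedAddCommGroup H] [InnerProductSpace ℝ H]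

/-- Energy estimate for `ε w'' + b w' + c g = r`, with `w' = w₁` and `G' ≤ 2 ⟪g, w'⟫ + δ`. -/
theorem energy_le_of_hasDerivWithinAt {T ε c₀ M C δ : ℝ} (hε : 0 < ε) (hc₀ : 0 < c₀)
    (hM : 0 ≤ M) (hC : 0 ≤ C) (hδ : 0 ≤ δ) {w₁ w₂ g r : ℝ → H} {G G₁ c c₁ b : ℝ → ℝ}
    (hw : ∀ t ∈ Icc 0 T, HasDerivWithinAt w₁ (w₂ t) (Icc 0 T) t)
    (hG : ∀ t ∈ Icc 0 T, HasDerivWithinAt G (G₁ t) (Icc 0 T) t)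
    (hc : ∀ t ∈ Icc 0 T, HasDerivWithinAt c (c₁ t) (Icc 0 T) t)
    (heq : ∀ t ∈ Icc 0 T, ε • w₂ t + b t • w₁ t + c t • g t = r t)
    (hb : ∀ t ∈ Icc 0 T, 0 ≤ b t) (hcc : ∀ t ∈ Icc 0 T, c₀ ≤ c t)
    (hc₁ : ∀ t ∈ Icc 0 T, |c₁ t| ≤ M) (hG0 : ∀ t ∈ Icc 0 T, 0 ≤ G t)
    (hGd : ∀ t ∈ Icc 0 T, G₁ t ≤ 2 * ⟪g t, w₁ t⟫ + δ)
    (hr : ∀ t ∈ Icc 0 T, ‖r t‖ ^ 2 ≤ C * G t + δ) :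
    ∀ t ∈ Icc 0 T, ε * (‖w₁ t‖ ^ 2 / c t) + G t ≤
      (ε * (‖w₁ 0‖ ^ 2 / c 0) + G 0 + ε * (1 + 1 / c₀) * δ) *
        Real.exp ((1 / ε + M / c₀ + C / c₀) * t) := by
  have hcp : ∀ t ∈ Icc 0 T, 0 < c t := fun t ht => hc₀.trans_le (hcc t ht)
  -- The rate contains 1/ε, so the added constant contributes at least δ + δ/c₀ and absorbs the
  -- inhomogeneous terms. The summands 1/ε, M/c₀ and C/c₀ of the rate pay respectively for the |w₁|²
  -- half of 2⟪w₁, r⟫/c, for the variation of c, and for the part C G of ‖r‖².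
  have hd : ∀ t ∈ Icc 0 T, HasDerivWithinAt
      (fun t => ε * (‖w₁ t‖ ^ 2 / c t) + G t + ε * (1 + 1 / c₀) * δ)
      (ε * ((2 * ⟪w₁ t, w₂ t⟫ * c t - ‖w₁ t‖ ^ 2 * c₁ t) / c t ^ 2) + G₁ t) (Icc 0 T) t :=
    fun t ht => ((((hw t ht).norm_sq.div (hc t ht) (hcp t ht).ne').const_mul ε).add
      (hG t ht)).add_const _
  intro t ht
  have hδ' : 0 ≤ ε * (1 + 1 / c₀) * δ := by positivity
  refine le_trans ?_ (le_mul_exp_of_deriv_le hd (fun s hs => ?_) t ht)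
  · simpa using hδ'
  replace hs := Ioo_subset_Icc_self hs
  have hc0 := hcp s hs
  have e1 : ε * ⟪w₁ s, w₂ s⟫ = ⟪w₁ s, r s⟫ - b s * ‖w₁ s‖ ^ 2 - c s * ⟪g s, w₁ s⟫ := by
    rw [← heq s hs]
    simp only [inner_add_right, real_inner_smul_right, real_inner_self_eq_norm_sq,
      real_inner_comm (w₁ s) (g s)]
    ring
  set q := ‖w₁ s‖ ^ 2 / c s with hq
  have hq0 : 0 ≤ q := by positivity
  have hqc : ‖w₁ s‖ ^ 2 = q * c s := by rw [hq]; field_simp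
  -- Dividing the kinetic term by c produces exactly -2⟪g, w₁⟫, which cancels the leading part of
  -- G'.
  have e2 : ε * ((2 * ⟪w₁ s, w₂ s⟫ * c s - ‖w₁ s‖ ^ 2 * c₁ s) / c s ^ 2)
      = 2 * ⟪w₁ s, r s⟫ / c s - 2 * b s * q - 2 * ⟪g s, w₁ s⟫ - ε * q * (c₁ s / c s) := by
    have : ε * ((2 * ⟪w₁ s, w₂ s⟫ * c s - ‖w₁ s‖ ^ 2 * c₁ s) / c s ^ 2)
      = 2 * (ε * ⟪w₁ s, w₂ s⟫) / c s - ε * ‖w₁ s‖ ^ 2 * c₁ s / c s ^ 2 := by field_simp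
    rw [this, e1, hqc]
    field_simp
  have i1 : 2 * ⟪w₁ s, r s⟫ / c s ≤ q + (C * G s + δ) / c₀ := by
    have h1 : 2 * ⟪w₁ s, r s⟫ ≤ ‖w₁ s‖ ^ 2 + ‖r s‖ ^ 2 := by
      nlinarith [real_inner_le_norm (w₁ s) (r s), sq_nonneg (‖w₁ s‖ - ‖r s‖)]
    have h2 : ‖r s‖ ^ 2 / c s ≤ (C * G s + δ) / c₀ :=
      div_le_div₀ (by have := hG0 s hs; positivity) (hr s hs) hc₀ (hcc s hs)
    calc 2 * ⟪w₁ s, r s⟫ / c s ≤ (‖w₁ s‖ ^ 2 + ‖r s‖ ^ 2) / c s :=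
          div_le_div_of_nonneg_right h1 hc0.le
      _ = q + ‖r s‖ ^ 2 / c s := by rw [add_div]
      _ ≤ _ := by linarith
  have i2 : -(c₁ s / c s) ≤ M / c₀ := by
    rw [← neg_div]
    exact div_le_div₀ hM ((neg_le_abs _).trans (hc₁ s hs)) hc₀ (hcc s hs)
  have i3 := hGd s hs
  have i4 := mul_nonneg (hb s hs) hq0
  have i5 : -(ε * q * (c₁ s / c s)) ≤ ε * q * (M / c₀) := by
    have := mul_le_mul_of_nonneg_left i2 (by positivity : 0 ≤ ε * q)
    linarith
  have e3 : (1 / ε + M / c₀ + C / c₀) * (ε * q + G s + ε * (1 + 1 / c₀) * δ)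
      = q + δ + δ / c₀ + ε * q * (M / c₀) + C * G s / c₀ + (G s / ε + M / c₀ * (G s + ε * (1 + 1 / c₀) * δ)
        + C / c₀ * (ε * q + ε * (1 + 1 / c₀) * δ)) := by
    field_simp
    ring
  have i6 : 0 ≤ G s / ε + M / c₀ * (G s + ε * (1 + 1 / c₀) * δ)
        + C / c₀ * (ε * q + ε * (1 + 1 / c₀) * δ) := by
    have := hG0 s hs
    positivity
  rw [e2, e3]
  rw [add_div] at i1
  linarith

/-- The energy estimate for a coefficient `c` that is only Lipschitz continuous. -/
theorem energy_le {T ε c₀ M C δ K : ℝ} (hT : 0 ≤ T) (hε : 0 < ε) (hc₀ : 0 < c₀)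
    (hC : 0 ≤ C) (hδ : 0 ≤ δ) {w₁ w₂ g r : ℝ → H} {G G₁ c b : ℝ → ℝ}
    (hw : ∀ t ∈ Icc 0 T, HasDerivWithinAt w₁ (w₂ t) (Icc 0 T) t)
    (hG : ∀ t ∈ Icc 0 T, HasDerivWithinAt G (G₁ t) (Icc 0 T) t)
    (hc : ∀ s ∈ Icc 0 T, ∀ t ∈ Icc 0 T, |c s - c t| ≤ M * |s - t|)
    (heq : ∀ t ∈ Icc 0 T, ε • w₂ t + b t • w₁ t + c t • g t = r t)
    (hb : ∀ t ∈ Icc 0 T, 0 ≤ b t) (hcc : ∀ t ∈ Icc 0 T, c₀ ≤ c t)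
    (hM : 0 ≤ M) (hG0 : ∀ t ∈ Icc 0 T, 0 ≤ G t)
    (hGd : ∀ t ∈ Icc 0 T, G₁ t ≤ 2 * ⟪g t, w₁ t⟫ + δ)
    (hr : ∀ t ∈ Icc 0 T, ‖r t‖ ^ 2 ≤ C * G t + δ) (hg : ∀ t ∈ Icc 0 T, ‖g t‖ ≤ K) :
    ∀ t ∈ Icc 0 T, ε * (‖w₁ t‖ ^ 2 / c t) + G t ≤
      (ε * (‖w₁ 0‖ ^ 2 / c 0) + G 0 + ε * (1 + 1 / c₀) * (2 * δ)) *
        Real.exp ((1 / ε + M / c₀ + 2 * C / c₀) * t) := by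
  have hlip : ∀ x y, |clampExtend T c x - clampExtend T c y| ≤ M * |x - y| := fun x y =>
    (hc _ (clamp_mem hT x) _ (clamp_mem hT y)).trans
      (mul_le_mul_of_nonneg_left (abs_clamp_sub_le T x y) hM)
  have hcont := continuous_of_abs_sub_le hlip
  -- The C¹ estimate is applied with c averaged over a window h. The error (c_h - c) g, of size at
  -- most M h K, is moved into r; squaring the sum doubles C and δ and adds 2(M h K)². As h → 0 that
  -- term vanishes, so K does not enter the conclusion.
  have key : ∀ h : ℝ, 0 < h → ∀ t ∈ Icc 0 T,
      ε * (‖w₁ t‖ ^ 2 / forwardAverage (clampExtend T c) h t) + G t ≤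
      (ε * (‖w₁ 0‖ ^ 2 / forwardAverage (clampExtend T c) h 0) + G 0 +
        ε * (1 + 1 / c₀) * (2 * δ + 2 * (M * h * K) ^ 2)) *
        Real.exp ((1 / ε + M / c₀ + 2 * C / c₀) * t) := by
    intro h hh
    refine energy_le_of_hasDerivWithinAt (r := fun t => r t +
      (forwardAverage (clampExtend T c) h t - c t) • g t) (b := b) hε hc₀ hM
      (by positivity) (by positivity) hw hG
      (fun t _ => (hasDerivAt_forwardAverage hcont h t).hasDerivWithinAt) (fun t ht => ?_) hb
      (fun t _ => le_forwardAverage hcont hh fun s _ => hcc _ (clamp_mem hT s))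
      (fun t _ => abs_deriv_forwardAverage_le hlip hh t) hG0
      (fun t ht => (hGd t ht).trans (by nlinarith [sq_nonneg (M * h * K)])) fun t ht => ?_
    · rw [← heq t ht, sub_smul]
      abel
    · have h1 : ‖(forwardAverage (clampExtend T c) h t - c t) • g t‖ ≤ M * h * K := by
        rw [norm_smul, Real.norm_eq_abs]
        have := abs_forwardAverage_sub_le hlip hcont hh t
        rw [clampExtend_eq ht] at this
        exact mul_le_mul this (hg t ht) (norm_nonneg _) (by positivity)
      have h2 := norm_add_le (r t) ((forwardAverage (clampExtend T c) h t - c t) • g t)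
      have h3 := hr t ht
      set a := ‖r t‖
      set d := ‖(forwardAverage (clampExtend T c) h t - c t) • g t‖
      have ha : 0 ≤ a := norm_nonneg _
      have hd : 0 ≤ d := norm_nonneg _
      calc _ ≤ (a + d) ^ 2 := pow_le_pow_left₀ (norm_nonneg _) h2 2
        _ ≤ 2 * a ^ 2 + 2 * d ^ 2 := by nlinarith [sq_nonneg (a - d)]
        _ ≤ _ := by
          have : d ^ 2 ≤ (M * h * K) ^ 2 := pow_le_pow_left₀ hd h1 2
          linarith
  intro t ht
  have hlim : ∀ s ∈ Icc 0 T, Tendsto (fun h => forwardAverage (clampExtend T c) h s) (𝓝[>] 0)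
      (𝓝 (c s)) := by
    intro s hs
    rw [tendsto_iff_norm_sub_tendsto_zero]
    have h0 : Tendsto (fun h : ℝ => M * h) (𝓝[>] 0) (𝓝 0) := by
      have : Tendsto (fun h : ℝ => M * h) (𝓝 0) (𝓝 (M * 0)) := (continuous_const_mul M).tendsto 0
      rw [mul_zero] at this
      exact this.mono_left nhdsWithin_le_nhds
    refine squeeze_zero' (Eventually.of_forall fun _ => norm_nonneg _) ?_ h0
    filter_upwards [self_mem_nhdsWithin] with h hh
    have := abs_forwardAverage_sub_le hlip hcont hh s
    rwa [clampExtend_eq hs] at this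
  have h0 : (0 : ℝ) ∈ Icc 0 T := left_mem_Icc.2 hT
  have hcp : ∀ t ∈ Icc 0 T, c t ≠ 0 := fun t ht => (hc₀.trans_le (hcc t ht)).ne'
  have hquad : Tendsto (fun h : ℝ => 2 * δ + 2 * (M * h * K) ^ 2) (𝓝[>] 0) (𝓝 (2 * δ)) := by
    have : Tendsto (fun h : ℝ => 2 * δ + 2 * (M * h * K) ^ 2) (𝓝 0)
        (𝓝 (2 * δ + 2 * (M * 0 * K) ^ 2)) :=
      (by fun_prop : Continuous fun h : ℝ => 2 * δ + 2 * (M * h * K) ^ 2).tendsto 0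
    simp only [mul_zero, zero_mul, ne_eq, OfNat.ofNat_ne_zero, not_false_eq_true, zero_pow,
      add_zero] at this
    exact this.mono_left nhdsWithin_le_nhds
  refine le_of_tendsto_of_tendsto
    (((tendsto_const_nhds.div (hlim t ht) (hcp t ht)).const_mul ε).add_const (G t))
    (((((tendsto_const_nhds.div (hlim 0 h0) (hcp 0 h0)).const_mul ε).add_const (G 0)).add
      (hquad.const_mul _)).mul_const _) ?_
  filter_upwards [self_mem_nhdsWithin] with h hh
  exact key h hh t ht

end Energy

/-! ### Yosida approximations -/

section Yosida

variable {H : Type*} [NormedAddCommGroup H] [InnerProductSpace ℝ H]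

/-- `J = (1 + l A)⁻¹`, `W = B J` and `Y = A J` (the Yosida approximation of `A`), where `B` is the
square root of `A`. -/
structure IsYosida (A B : H →ₗ.[ℝ] H) (l : ℝ) (J W Y : H →L[ℝ] H) : Prop where
  pos : 0 < l
  symm : ∀ x y, ⟪J x, y⟫ = ⟪x, J y⟫
  norm_le : ∀ x, ‖J x‖ ≤ ‖x‖
  eq_add : ∀ x, x = J x + l • Y x
  mem_left : ∀ x, (J x, W x) ∈ B.graph
  mem_right : ∀ x, (W x, Y x) ∈ B.graph
  apply_add : ∀ x z, (x, z) ∈ A.graph → J (x + l • z) = x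

theorem graph_unique {B : H →ₗ.[ℝ] H} {x y y' : H} (h : (x, y) ∈ B.graph) (h' : (x, y') ∈ B.graph) :
    y = y' := LinearPMap.mem_graph_snd_inj B h h' rfl

theorem graph_sub {B : H →ₗ.[ℝ] H} {x y x' y' : H} (h : (x, y) ∈ B.graph)
    (h' : (x', y') ∈ B.graph) : (x - x', y - y') ∈ B.graph := B.graph.sub_mem h h'

variable {A B : H →ₗ.[ℝ] H}

namespace IsYosida

variable {l : ℝ} {J W Y : H →L[ℝ] H}

/-- A commutes with its resolvent: compare J x + l J z = x with x = J x + l Y x. Hence Y is bounded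
by A on D(A), uniformly in l. -/
theorem yosida_eq (h : IsYosida A B l J W Y) {x z : H} (hx : (x, z) ∈ A.graph) : Y x = J z := by
  have h1 := h.apply_add x z hx
  rw [map_add, map_smul] at h1
  have h2 := h.eq_add x
  have h3 : l • Y x = l • J z := by
    rw [← h1] at h2
    have : J x + l • J z = J x + l • Y x := by
      conv_lhs => rw [h1]
      exact h.eq_add x
    exact (add_left_cancel this).symm
  exact smul_right_injective H h.pos.ne' h3

theorem yosida_symm (h : IsYosida A B l J W Y) (x y : H) : ⟪Y x, y⟫ = ⟪x, Y y⟫ := by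
  have h1 : ⟪l • Y x, y⟫ = ⟪x, l • Y y⟫ := by
    rw [← sub_eq_of_eq_add' (h.eq_add x), ← sub_eq_of_eq_add' (h.eq_add y), inner_sub_left,
      inner_sub_right, h.symm]
  rw [real_inner_smul_left, real_inner_smul_right] at h1
  exact mul_left_cancel₀ h.pos.ne' h1

end IsYosida

variable [CompleteSpace H]

theorem isNonnegSelfAdjoint_smul (hA : IsNonnegSelfAdjoint A) {l : ℝ} (hl : 0 < l) :
    IsNonnegSelfAdjoint (l • A) := by
  refine ⟨isSelfAdjoint_of_forall hA.1.dense_domain (fun x y => ?_) fun z w h => ?_, fun x => ?_⟩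
  · rw [LinearPMap.smul_apply, LinearPMap.smul_apply, real_inner_smul_left, real_inner_smul_right]
    congr 1
    exact inner_symm_of_isSelfAdjoint hA.1 (A.mem_graph x) (A.mem_graph y)
  · have h1 : (z, l⁻¹ • w) ∈ A.graph := mem_graph_of_forall_inner hA.1 fun x y hxy => by
      obtain ⟨a, rfl, rfl⟩ := (LinearPMap.mem_graph_iff A).1 hxy
      have h2 := h a
      rw [LinearPMap.smul_apply, real_inner_smul_right] at h2
      rw [real_inner_smul_left, h2, inv_mul_cancel_left₀ hl.ne']
    obtain ⟨a, ha, -⟩ := (LinearPMap.mem_graph_iff A).1 h1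
    have ha' : (a : H) = z := ha
    rw [← ha']
    exact a.2
  · rw [LinearPMap.smul_apply, real_inner_smul_left]
    exact mul_nonneg hl.le (hA.2 x)

/-- J is the resolvent at -1 of lA, and Y = l⁻¹(1 - J). W x is the intermediate point in the
factorization of A through B at J x; it is linear because graphs are single-valued, and bounded
because ‖W x‖² = ⟪J x, Y x⟫. -/
theorem exists_isYosida (hA : IsNonnegSelfAdjoint A) (hB : IsSqrt A B) {l : ℝ} (hl : 0 < l) :
    ∃ J W Y : H →L[ℝ] H, IsYosida A B l J W Y := by
  obtain ⟨J, hJs, hJ1, -, hgr⟩ := exists_resolvent (isNonnegSelfAdjoint_smul hA hl)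
  have hgraph : ∀ x z, (x, z) ∈ A.graph ↔ (x, l • z) ∈ (l • A).graph := by
    intro x z
    simp only [LinearPMap.mem_graph_iff, LinearPMap.smul_apply]
    refine exists_congr fun a => and_congr Iff.rfl ?_
    exact (smul_right_injective H hl.ne').eq_iff.symm
  have hJn : ∀ x, ‖J x‖ ≤ ‖x‖ := fun x =>
    (J.le_opNorm x).trans (mul_le_of_le_one_left (norm_nonneg _) hJ1)
  set Y : H →L[ℝ] H := l⁻¹ • (1 - J) with hY
  have hYx : ∀ x, x = J x + l • Y x := fun x => by
    change x = J x + l • l⁻¹ • (x - J x)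
    rw [smul_inv_smul₀ hl.ne']; abel
  have hmem : ∀ x, (J x, Y x) ∈ A.graph := fun x =>
    (hgraph _ _).2 ((hgr _ _).2 ⟨x, rfl, eq_sub_of_add_eq' (hYx x).symm⟩)
  choose f hf1 hf2 using fun x => (hB.2 _ _).1 (hmem x)
  let W : H →L[ℝ] H := LinearMap.mkContinuous
    { toFun := f
      map_add' := fun x y => graph_unique (hf1 (x + y))
        (by rw [map_add]; exact B.graph.add_mem (hf1 x) (hf1 y))
      map_smul' := fun c x => graph_unique (hf1 (c • x))
        (by rw [map_smul]; exact B.graph.smul_mem c (hf1 x)) } (1 + ‖Y‖) fun x => by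
      change ‖f x‖ ≤ (1 + ‖Y‖) * ‖x‖
      have h1 : ‖f x‖ ^ 2 ≤ ‖x‖ * (‖Y‖ * ‖x‖) := by
        rw [← real_inner_self_eq_norm_sq, inner_symm_of_isSelfAdjoint hB.1.1 (hf1 x) (hf2 x)]
        exact (real_inner_le_norm _ _).trans
          (mul_le_mul (hJn x) (Y.le_opNorm x) (norm_nonneg _) (norm_nonneg _))
      refine le_of_sq_le_sq (h1.trans ?_) (by positivity)
      have := norm_nonneg Y
      nlinarith [mul_nonneg this (sq_nonneg ‖x‖), mul_nonneg (sq_nonneg ‖Y‖) (sq_nonneg ‖x‖),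
        sq_nonneg ‖x‖]
  refine ⟨J, W, Y, hl, hJs.isSymmetric, hJn, hYx, hf1, hf2, fun x z h => ?_⟩
  obtain ⟨y, h1, h2⟩ := (hgr _ _).1 ((hgraph _ _).1 h)
  rw [h2, ← h1, add_sub_cancel, ← h1]

namespace IsYosida

variable {l : ℝ} {J W Y : H →L[ℝ] H}

theorem mem_graph (hB : IsSqrt A B) (h : IsYosida A B l J W Y) (x : H) : (J x, Y x) ∈ A.graph :=
  (hB.2 _ _).2 ⟨W x, h.mem_left x, h.mem_right x⟩

/-- The square root commutes with the resolvent. Applying B to x - J x = l Y x shows that W x ∈ D(A)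
and (1 + lA) W x = z. -/
theorem sqrt_eq (hB : IsSqrt A B) (h : IsYosida A B l J W Y) {x z : H} (hx : (x, z) ∈ B.graph) :
    W x = J z := by
  have h1 : (l • Y x, z - W x) ∈ B.graph := by
    have := graph_sub hx (h.mem_left x)
    rwa [sub_eq_of_eq_add' (h.eq_add x)] at this
  have h2 : (Y x, l⁻¹ • (z - W x)) ∈ B.graph := by
    have := B.graph.smul_mem l⁻¹ h1
    rwa [Prod.smul_mk, inv_smul_smul₀ h.pos.ne'] at this
  have h3 := h.apply_add _ _ ((hB.2 _ _).2 ⟨_, h.mem_right x, h2⟩)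
  rw [smul_inv_smul₀ h.pos.ne', add_sub_cancel] at h3
  exact h3.symm

/-- Split x = J x + l Y x and move one factor B across in ⟪B W x, J x⟫. Once Y x is bounded, the
approximate argument of m differs from ‖W x‖² only by O(l). -/
theorem inner_yosida (hB : IsSqrt A B) (h : IsYosida A B l J W Y) (x : H) :
    ⟪Y x, x⟫ = ‖W x‖ ^ 2 + l * ‖Y x‖ ^ 2 := by
  have h1 : ⟪Y x, x⟫ = ⟪Y x, J x + l • Y x⟫ := by rw [← h.eq_add x]
  rw [h1, inner_add_right, real_inner_smul_right, real_inner_self_eq_norm_sq,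
    ← real_inner_self_eq_norm_sq (W x),
    inner_symm_of_isSelfAdjoint hB.1.1 (h.mem_right x) (h.mem_left x)]

theorem inner_yosida_nonneg (hB : IsSqrt A B) (h : IsYosida A B l J W Y) (x : H) :
    0 ≤ ⟪Y x, x⟫ := by
  have := h.pos
  rw [h.inner_yosida hB]
  positivity

theorem inner_yosida_eq (hB : IsSqrt A B) (h : IsYosida A B l J W Y) {x z : H}
    (hx : (x, z) ∈ B.graph) : ⟪Y x, x⟫ = ⟪J z, z⟫ := by
  rw [inner_symm_of_isSelfAdjoint hB.1.1 (h.mem_right x) hx, h.sqrt_eq hB hx]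

/-- Writes ⟪Y x, x⟫ as ‖S x‖², the form in which the nonlinearity is seen to be globally Lipschitz.
The root comes from lY = 1 - J with J a self-adjoint contraction. -/
theorem exists_sqrt (h : IsYosida A B l J W Y) :
    ∃ S : H →L[ℝ] H, (∀ x y, ⟪S x, y⟫ = ⟪x, S y⟫) ∧ ∀ x, S (S x) = Y x := by
  have hJs : IsSelfAdjoint J := (ContinuousLinearMap.isSelfAdjoint_iff_isSymmetric).2 h.symm
  have hJ1 : ‖J‖ ≤ 1 := J.opNorm_le_bound zero_le_one fun x => by
    rw [one_mul]; exact h.norm_le x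
  obtain ⟨Q, hQs, hQQ, -, -⟩ := exists_sqrt_one_sub J hJs hJ1
  have hQ : ∀ x, Q (Q x) = l • Y x := fun x => by
    rw [← sub_eq_of_eq_add' (h.eq_add x)]
    exact DFunLike.congr_fun hQQ x
  refine ⟨(√l)⁻¹ • Q, fun x y => ?_, fun x => ?_⟩
  · simp only [smul_apply, real_inner_smul_left, real_inner_smul_right]
    congr 1
    exact hQs.isSymmetric x y
  · simp only [smul_apply, map_smul, hQ, smul_smul]
    rw [← mul_assoc, ← mul_inv, Real.mul_self_sqrt h.pos.le, inv_mul_cancel₀ h.pos.ne',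
      one_smul]

/-- Comparison with the resolvent `R` at `-1`. -/
theorem resolvent_apply_add (hB : IsSqrt A B) (h : IsYosida A B l J W Y) {R V Z : H →L[ℝ] H}
    (hR : IsYosida A B 1 R V Z) (x : H) : R (J x + Y x) = J x := by
  have := hR.apply_add _ _ (h.mem_graph hB x)
  rwa [one_smul] at this

/-- J + Y = (1 + A)J is bounded and undoes R up to J, because Y R x = J A R x = J(x - R x). -/
theorem add_apply_resolvent (hB : IsSqrt A B) (h : IsYosida A B l J W Y) {R V Z : H →L[ℝ] H}
    (hR : IsYosida A B 1 R V Z) (x : H) : J (R x) + Y (R x) = J x := by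
  rw [h.yosida_eq (hR.mem_graph hB x), ← map_add]
  have := hR.eq_add x
  rw [one_smul] at this
  rw [← this]

end IsYosida

/-- On D(A) one has ‖y - J y‖ = l ‖Y y‖ ≤ l ‖A y‖; density of the domain and contractivity of J
extend the convergence to all of H. -/
theorem tendsto_resolvent (hA : IsNonnegSelfAdjoint A) {l : ℕ → ℝ}
    {J W Y : ℕ → H →L[ℝ] H} (h : ∀ n, IsYosida A B (l n) (J n) (W n) (Y n))
    (hl : Tendsto l atTop (𝓝 0)) (x : H) : Tendsto (fun n => J n x) atTop (𝓝 x) := by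
  rw [Metric.tendsto_atTop]
  intro δ hδ
  obtain ⟨y, hy, hxy⟩ := Metric.dense_iff.1 hA.1.dense_domain x (δ / 4) (by positivity)
  have hyA := A.mem_graph ⟨y, hxy⟩
  have h0 : Tendsto (fun n => l n * ‖A ⟨y, hxy⟩‖) atTop (𝓝 0) := by
    simpa using hl.mul_const ‖A ⟨y, hxy⟩‖
  obtain ⟨N, hN⟩ := eventually_atTop.1 (h0.eventually (gt_mem_nhds (half_pos hδ)))
  refine ⟨N, fun n hn => ?_⟩
  have h1 : J n x - x = J n (x - y) - (x - y) - l n • Y n y := by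
    rw [← sub_eq_of_eq_add' ((h n).eq_add y), map_sub]
    abel
  have h2 : ‖Y n y‖ ≤ ‖A ⟨y, hxy⟩‖ := by
    rw [(h n).yosida_eq hyA]
    exact (h n).norm_le _
  have h3 : ‖x - y‖ < δ / 4 := by
    rw [norm_sub_rev, ← dist_eq_norm]
    exact hy
  rw [dist_eq_norm, h1]
  have h4 := norm_sub_le (J n (x - y) - (x - y)) (l n • Y n y)
  have h5 := norm_sub_le (J n (x - y)) (x - y)
  have h6 := (h n).norm_le (x - y)
  have h7 : ‖l n • Y n y‖ ≤ l n * ‖A ⟨y, hxy⟩‖ := by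
    rw [norm_smul, Real.norm_of_nonneg (h n).pos.le]
    exact mul_le_mul_of_nonneg_left h2 (h n).pos.le
  linarith [hN n hn]

theorem tendsto_resolvent_of_tendsto (hA : IsNonnegSelfAdjoint A) {l : ℕ → ℝ}
    {J W Y : ℕ → H →L[ℝ] H} (h : ∀ n, IsYosida A B (l n) (J n) (W n) (Y n))
    (hl : Tendsto l atTop (𝓝 0)) {x : ℕ → H} {y : H} (hx : Tendsto x atTop (𝓝 y)) :
    Tendsto (fun n => J n (x n)) atTop (𝓝 y) := by
  have h1 : Tendsto (fun n => J n (x n - y)) atTop (𝓝 0) := by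
    refine squeeze_zero_norm (fun n => (h n).norm_le _) ?_
    exact tendsto_iff_norm_sub_tendsto_zero.1 hx
  have h2 := h1.add (tendsto_resolvent hA h hl y)
  rw [zero_add] at h2
  refine h2.congr fun n => ?_
  rw [map_sub, sub_add_cancel]

end Yosida

/-! ### A priori bounds for the regularized equation -/

section APriori

variable {H : Type*} [NormedAddCommGroup H] [InnerProductSpace ℝ H]

/-- `u` solves `ε u'' + b u' + m(⟪Y u, u⟫) Y u = 0` on `[0, T]` for a bounded operator `Y`, with
`u' = u₁` and `u'' = u₂`. -/
structure IsBoundedSolution (Y : H →L[ℝ] H) (m b : ℝ → ℝ) (ε T : ℝ) (u u₁ u₂ : ℝ → H) : Prop where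
  deriv : ∀ t ∈ Icc 0 T, HasDerivWithinAt u (u₁ t) (Icc 0 T) t
  deriv₂ : ∀ t ∈ Icc 0 T, HasDerivWithinAt u₁ (u₂ t) (Icc 0 T) t
  equation : ∀ t ∈ Icc 0 T, ε • u₂ t + b t • u₁ t + m ⟪Y (u t), u t⟫ • Y (u t) = 0

theorem HasDerivWithinAt.inner_clm {Y : H →L[ℝ] H} (hY : ∀ x y, ⟪Y x, y⟫ = ⟪x, Y y⟫) {u : ℝ → H}
    {v : H} {s : Set ℝ} {t : ℝ} (h : HasDerivWithinAt u v s t) :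
    HasDerivWithinAt (fun t => ⟪Y (u t), u t⟫) (2 * ⟪Y (u t), v⟫) s t := by
  have h1 := (Y.hasFDerivAt.comp_hasDerivWithinAt t h).inner ℝ h
  have e : 2 * ⟪Y (u t), v⟫ = ⟪(Y ∘ u) t, v⟫ + ⟪Y v, u t⟫ := by
    rw [hY v, real_inner_comm (Y (u t)) v, two_mul]
    rfl
  rw [e]
  exact h1

variable {Y : H →L[ℝ] H} {m m' b : ℝ → ℝ} {ε T β K K₁ L : ℝ} {u u₁ u₂ : ℝ → H}

namespace IsBoundedSolution

theorem hasDerivWithinAt_coeff (h : IsBoundedSolution Y m b ε T u u₁ u₂)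
    (hY : ∀ x y, ⟪Y x, y⟫ = ⟪x, Y y⟫) (hm : ∀ x, HasDerivAt m (m' x) x) {t : ℝ}
    (ht : t ∈ Icc 0 T) :
    HasDerivWithinAt (fun t => m ⟪Y (u t), u t⟫)
      (m' ⟪Y (u t), u t⟫ * (2 * ⟪Y (u t), u₁ t⟫)) (Icc 0 T) t :=
  (hm _).comp_hasDerivWithinAt t (HasDerivWithinAt.inner_clm hY (h.deriv t ht))

/-- This is the mechanism against degeneration: since u' is controlled by c itself, c' is bounded by
a multiple of c, so c cannot vanish in finite time. -/
theorem abs_deriv_coeff_le (hL : ∀ x, |m' x| ≤ L) {t : ℝ}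
    (h1 : ‖u₁ t‖ ≤ K * m ⟪Y (u t), u t⟫) (h2 : ‖Y (u t)‖ ≤ K₁) :
    |m' ⟪Y (u t), u t⟫ * (2 * ⟪Y (u t), u₁ t⟫)| ≤ 2 * L * K * K₁ * m ⟪Y (u t), u t⟫ := by
  have hK₁ : 0 ≤ K₁ := (norm_nonneg _).trans h2
  have h3 : |⟪Y (u t), u₁ t⟫| ≤ K₁ * (K * m ⟪Y (u t), u t⟫) :=
    (abs_real_inner_le_norm _ _).trans (mul_le_mul h2 h1 (norm_nonneg _) hK₁)
  have hL0 : 0 ≤ L := (abs_nonneg _).trans (hL 0)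
  rw [abs_mul, abs_mul, abs_two]
  calc _ ≤ L * (2 * (K₁ * (K * m ⟪Y (u t), u t⟫))) :=
        mul_le_mul (hL _) (by linarith) (by positivity) hL0
    _ = _ := by ring

/-- Decay of the energies on `[0, τ]` as long as `‖u'‖ ≤ K c` and `‖Y u‖ ≤ K₁` before `τ`, where
`c = m(⟪Y u, u⟫)`. -/
theorem energies_le (h : IsBoundedSolution Y m b ε T u u₁ u₂) (hε : 0 < ε)
    (hY : ∀ x y, ⟪Y x, y⟫ = ⟪x, Y y⟫) (hY0 : ∀ x, 0 ≤ ⟪Y x, x⟫)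
    (hm : ∀ x, HasDerivAt m (m' x) x) (hL : ∀ x, |m' x| ≤ L)
    (hβ : 0 < β) (hb : ∀ t ∈ Icc 0 T, β ≤ b t)
    (hεK : ε * (2 * L * K * K₁) ≤ β / 2) (hc0 : 0 < m ⟪Y (u 0), u 0⟫) {τ q : ℝ}
    (hq : 4 * K₁ ^ 2 ≤ β ^ 2 * q) (hq0 : ‖u₁ 0‖ ^ 2 / m ⟪Y (u 0), u 0⟫ ^ 2 ≤ q)
    (hτ : τ ∈ Icc 0 T)
    (hP : ∀ s ∈ Ioo 0 τ, ‖u₁ s‖ ≤ K * m ⟪Y (u s), u s⟫ ∧ ‖Y (u s)‖ ≤ K₁) :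
    m ⟪Y (u 0), u 0⟫ * Real.exp (-(2 * L * K * K₁) * τ) ≤ m ⟪Y (u τ), u τ⟫ ∧
    ε * (⟪Y (u₁ τ), u₁ τ⟫ / m ⟪Y (u τ), u τ⟫) + ‖Y (u τ)‖ ^ 2 ≤
      ε * (⟪Y (u₁ 0), u₁ 0⟫ / m ⟪Y (u 0), u 0⟫) + ‖Y (u 0)‖ ^ 2 ∧
    ‖u₁ τ‖ ^ 2 / m ⟪Y (u τ), u τ⟫ ^ 2 ≤ q ∧
    ε * (‖u₁ τ‖ ^ 2 / m ⟪Y (u τ), u τ⟫) + ⟪Y (u τ), u τ⟫ ≤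
      ε * (‖u₁ 0‖ ^ 2 / m ⟪Y (u 0), u 0⟫) + ⟪Y (u 0), u 0⟫ := by
  have hsub : Icc 0 τ ⊆ Icc 0 T := Icc_subset_Icc_right hτ.2
  have hmem : τ ∈ Icc 0 τ := right_mem_Icc.2 hτ.1
  set κ := 2 * L * K * K₁ with hκ
  set c : ℝ → ℝ := fun t => m ⟪Y (u t), u t⟫ with hc
  set c' : ℝ → ℝ := fun t => m' ⟪Y (u t), u t⟫ * (2 * ⟪Y (u t), u₁ t⟫) with hc'
  have hu : ∀ t ∈ Icc 0 τ, HasDerivWithinAt u (u₁ t) (Icc 0 τ) t := fun t ht =>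
    (h.deriv t (hsub ht)).mono hsub
  have hu₁ : ∀ t ∈ Icc 0 τ, HasDerivWithinAt u₁ (u₂ t) (Icc 0 τ) t := fun t ht =>
    (h.deriv₂ t (hsub ht)).mono hsub
  have hcd : ∀ t ∈ Icc 0 τ, HasDerivWithinAt c (c' t) (Icc 0 τ) t := fun t ht =>
    (h.hasDerivWithinAt_coeff hY hm (hsub ht)).mono hsub
  have hcb : ∀ t ∈ Ioo 0 τ, |c' t| ≤ κ * c t := fun t ht =>
    abs_deriv_coeff_le hL (hP t ht).1 (hP t ht).2
  have hcl : ∀ t ∈ Icc 0 τ, c 0 * Real.exp (-κ * t) ≤ c t := by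
    intro t ht
    have := le_mul_exp_of_deriv_le (k := -κ) (fun s hs => (hcd s hs).neg)
      (fun s hs => by
        simp only [Pi.neg_apply]
        linarith [neg_le_abs (c' s), hcb s hs]) t ht
    simp only [Pi.neg_apply] at this
    linarith
  have hcp : ∀ t ∈ Icc 0 τ, 0 < c t := fun t ht => (by positivity : 0 < c 0 * _).trans_le (hcl t ht)
  have hYu : ∀ t ∈ Icc 0 τ, HasDerivWithinAt (fun t => Y (u t)) (Y (u₁ t)) (Icc 0 τ) t :=
    fun t ht => Y.hasFDerivAt.comp_hasDerivWithinAt t (hu t ht)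
  have hεc : ∀ t ∈ Ioo 0 τ, |ε * (c' t / c t)| ≤ β / 2 := by
    intro t ht
    have h0 := hcp t (Ioo_subset_Icc_self ht)
    rw [abs_mul, abs_div, abs_of_pos hε, abs_of_pos h0]
    refine le_trans (mul_le_mul_of_nonneg_left ?_ hε.le) hεK
    rw [div_le_iff₀ h0]
    exact hcb t ht
  have heq : ∀ t ∈ Icc 0 τ, ∀ x, ε * ⟪x, u₂ t⟫ = -(b t * ⟪x, u₁ t⟫) - c t * ⟪x, Y (u t)⟫ := by
    intro t ht x
    have h1 := congrArg (fun y => ⟪x, y⟫) (h.equation t (hsub ht))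
    simp only [inner_add_right, real_inner_smul_right, inner_zero_right] at h1
    linarith
  refine ⟨hcl τ hmem, ?_, ?_, ?_⟩
  · have hd : ∀ t ∈ Icc 0 τ, HasDerivWithinAt
        (fun t => ε * (⟪Y (u₁ t), u₁ t⟫ / c t) + ‖Y (u t)‖ ^ 2)
        (ε * ((2 * ⟪Y (u₁ t), u₂ t⟫ * c t - ⟪Y (u₁ t), u₁ t⟫ * c' t) / c t ^ 2)
          + 2 * ⟪Y (u t), Y (u₁ t)⟫) (Icc 0 τ) t := fun t ht =>
      (((HasDerivWithinAt.inner_clm hY (hu₁ t ht)).div (hcd t ht) (hcp t ht).ne').const_mul ε).add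
        (hYu t ht).norm_sq
    have := le_mul_exp_of_deriv_le (k := 0) hd (fun t ht => ?_) τ hmem
    · simpa using this
    have h0 := hcp t (Ioo_subset_Icc_self ht)
    -- The cross terms ⟪Y u, Y u'⟫ cancel thanks to the division by c. What remains is dissipative,
    -- since 2b + ε c'/c ≥ 2β - β/2.
    have e1 : ε * ((2 * ⟪Y (u₁ t), u₂ t⟫ * c t - ⟪Y (u₁ t), u₁ t⟫ * c' t) / c t ^ 2)
          + 2 * ⟪Y (u t), Y (u₁ t)⟫ =
        -(⟪Y (u₁ t), u₁ t⟫ / c t) * (2 * b t + ε * (c' t / c t)) := by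
      have : ε * ((2 * ⟪Y (u₁ t), u₂ t⟫ * c t - ⟪Y (u₁ t), u₁ t⟫ * c' t) / c t ^ 2) =
          2 * (ε * ⟪Y (u₁ t), u₂ t⟫) / c t - ε * ⟪Y (u₁ t), u₁ t⟫ * c' t / c t ^ 2 := by
        field_simp
      rw [this, heq t (Ioo_subset_Icc_self ht), real_inner_comm (Y (u₁ t)) (Y (u t))]
      field_simp
      ring
    rw [e1, zero_mul]
    have h2 : 0 ≤ ⟪Y (u₁ t), u₁ t⟫ / c t := div_nonneg (hY0 _) h0.le
    have h3 := (abs_le.1 (hεc t ht)).1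
    have h4 := hb t (hsub (Ioo_subset_Icc_self ht))
    nlinarith
  · have hd : ∀ t ∈ Icc 0 τ, HasDerivWithinAt (fun t => ‖u₁ t‖ ^ 2 / c t ^ 2 - q)
        ((2 * ⟪u₁ t, u₂ t⟫ * c t ^ 2 - ‖u₁ t‖ ^ 2 * (2 * c t * c' t)) / (c t ^ 2) ^ 2)
        (Icc 0 τ) t := fun t ht => by
      have h1 := ((hu₁ t ht).norm_sq.div ((hcd t ht).pow 2)
        (pow_ne_zero 2 (hcp t ht).ne')).sub_const q
      have e : (2 * ⟪u₁ t, u₂ t⟫ * c t ^ 2 - ‖u₁ t‖ ^ 2 * (2 * c t * c' t)) / (c t ^ 2) ^ 2 =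
          (2 * ⟪u₁ t, u₂ t⟫ * c t ^ 2 - ‖u₁ t‖ ^ 2 * ((2 : ℕ) * c t ^ (2 - 1) * c' t)) /
            (c t ^ 2) ^ 2 := by norm_num
      rw [e]
      exact h1
    -- With p = ‖u'‖/c, the equation gives ε(p²)' ≤ -β p² + 2 K₁ p. By Young's inequality and 4K₁² ≤
    -- β² q this is at most -(β/2)(p² - q), so p² cannot rise above q.
    have := le_mul_exp_of_deriv_le (k := -(β / (2 * ε))) hd (fun t ht => ?_) τ hmem
    · have h1 : (‖u₁ 0‖ ^ 2 / c 0 ^ 2 - q) * Real.exp (-(β / (2 * ε)) * τ) ≤ 0 :=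
        mul_nonpos_of_nonpos_of_nonneg (by linarith) (Real.exp_pos _).le
      linarith
    have h0 := hcp t (Ioo_subset_Icc_self ht)
    set p := ‖u₁ t‖ / c t with hp
    have hp0 : 0 ≤ p := by positivity
    have hpc : ‖u₁ t‖ = p * c t := by rw [hp]; field_simp
    have e0 : ‖u₁ t‖ ^ 2 / c t ^ 2 = p ^ 2 := by rw [hp, div_pow]
    have e1 : ε * ((2 * ⟪u₁ t, u₂ t⟫ * c t ^ 2 - ‖u₁ t‖ ^ 2 * (2 * c t * c' t)) / (c t ^ 2) ^ 2) =
        -2 * b t * p ^ 2 - 2 * (⟪u₁ t, Y (u t)⟫ / c t) - 2 * p ^ 2 * (ε * (c' t / c t)) := by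
      have : ε * ((2 * ⟪u₁ t, u₂ t⟫ * c t ^ 2 - ‖u₁ t‖ ^ 2 * (2 * c t * c' t)) / (c t ^ 2) ^ 2) =
          2 * (ε * ⟪u₁ t, u₂ t⟫) / c t ^ 2 - 2 * ε * ‖u₁ t‖ ^ 2 * c' t / c t ^ 3 := by
        field_simp
      rw [this, heq t (Ioo_subset_Icc_self ht), real_inner_self_eq_norm_sq, hpc]
      field_simp
    have h2 : -(⟪u₁ t, Y (u t)⟫ / c t) ≤ p * K₁ := by
      rw [← neg_div, div_le_iff₀ h0]
      have h3 := (neg_le_abs _).trans (abs_real_inner_le_norm (u₁ t) (Y (u t)))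
      have h4 := mul_le_mul_of_nonneg_left (hP t ht).2 (norm_nonneg (u₁ t))
      rw [hpc] at h3 h4
      linarith
    have h3 := (abs_le.1 (hεc t ht)).1
    have h4 := hb t (hsub (Ioo_subset_Icc_self ht))
    rw [e0, ← mul_le_mul_iff_right₀ hε, e1]
    have e2 : ε * (-(β / (2 * ε)) * (p ^ 2 - q)) = -(β / 2) * (p ^ 2 - q) := by field_simp
    rw [e2]
    have h5 : 2 * (p * K₁) ≤ β / 2 * p ^ 2 + β / 2 * q := by
      have h6 : 4 * K₁ ^ 2 / β ≤ β * q := by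
        rw [div_le_iff₀ hβ]; nlinarith
      have h7 : 2 * (p * K₁) ≤ β / 2 * p ^ 2 + (4 * K₁ ^ 2 / β) / 2 := by
        have h8 : β / 2 * p ^ 2 + (4 * K₁ ^ 2 / β) / 2 - 2 * (p * K₁)
          = (β * p - 2 * K₁) ^ 2 / (2 * β) := by field_simp; ring
        have : 0 ≤ (β * p - 2 * K₁) ^ 2 / (2 * β) := by positivity
        linarith
      linarith
    have h9 : β * p ^ 2 ≤ b t * p ^ 2 := mul_le_mul_of_nonneg_right h4 (sq_nonneg p)
    have h10 : -(β / 2) * p ^ 2 ≤ ε * (c' t / c t) * p ^ 2 :=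
      mul_le_mul_of_nonneg_right (by linarith) (sq_nonneg p)
    nlinarith
  -- The same cancellation one level lower; this energy controls ⟪Y u, u⟫, the argument of m.
  · have hd : ∀ t ∈ Icc 0 τ, HasDerivWithinAt
        (fun t => ε * (‖u₁ t‖ ^ 2 / c t) + ⟪Y (u t), u t⟫)
        (ε * ((2 * ⟪u₁ t, u₂ t⟫ * c t - ‖u₁ t‖ ^ 2 * c' t) / c t ^ 2)
          + 2 * ⟪Y (u t), u₁ t⟫) (Icc 0 τ) t := fun t ht =>
      (((hu₁ t ht).norm_sq.div (hcd t ht) (hcp t ht).ne').const_mul ε).add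
        (HasDerivWithinAt.inner_clm hY (hu t ht))
    have := le_mul_exp_of_deriv_le (k := 0) hd (fun t ht => ?_) τ hmem
    · simpa using this
    have h0 := hcp t (Ioo_subset_Icc_self ht)
    have e1 : ε * ((2 * ⟪u₁ t, u₂ t⟫ * c t - ‖u₁ t‖ ^ 2 * c' t) / c t ^ 2)
          + 2 * ⟪Y (u t), u₁ t⟫ =
        -(‖u₁ t‖ ^ 2 / c t) * (2 * b t + ε * (c' t / c t)) := by
      have : ε * ((2 * ⟪u₁ t, u₂ t⟫ * c t - ‖u₁ t‖ ^ 2 * c' t) / c t ^ 2) =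
          2 * (ε * ⟪u₁ t, u₂ t⟫) / c t - ε * ‖u₁ t‖ ^ 2 * c' t / c t ^ 2 := by
        field_simp
      rw [this, heq t (Ioo_subset_Icc_self ht), real_inner_self_eq_norm_sq,
        real_inner_comm (u₁ t) (Y (u t))]
      field_simp
      ring
    rw [e1, zero_mul]
    have h2 : 0 ≤ ‖u₁ t‖ ^ 2 / c t := by positivity
    have h3 := (abs_le.1 (hεc t ht)).1
    have h4 := hb t (hsub (Ioo_subset_Icc_self ht))
    nlinarith

theorem continuousOn_coeff (h : IsBoundedSolution Y m b ε T u u₁ u₂)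
    (hY : ∀ x y, ⟪Y x, y⟫ = ⟪x, Y y⟫) (hm : ∀ x, HasDerivAt m (m' x) x) :
    ContinuousOn (fun t => m ⟪Y (u t), u t⟫) (Icc 0 T) := fun _ ht =>
  (h.hasDerivWithinAt_coeff hY hm ht).continuousWithinAt

/-- For small `ε` the coefficient `c = m(⟪Y u, u⟫)` stays positive, because `‖u'‖ ≤ K c`. -/
theorem norm_deriv_lt (h : IsBoundedSolution Y m b ε T u u₁ u₂) (hε : 0 < ε)
    (hY : ∀ x y, ⟪Y x, y⟫ = ⟪x, Y y⟫) (hY0 : ∀ x, 0 ≤ ⟪Y x, x⟫)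
    (hm : ∀ x, HasDerivAt m (m' x) x) (hL : ∀ x, |m' x| ≤ L)
    (hβ : 0 < β) (hb : ∀ t ∈ Icc 0 T, β ≤ b t) (hK : 0 < K) (hK₁ : 0 ≤ K₁)
    (hεK : ε * (2 * L * K * K₁) ≤ β / 2)
    (hKβ : 2 * K₁ < K * β) (hc0 : ‖u₁ 0‖ < K * m ⟪Y (u 0), u 0⟫)
    (hF : ε * (⟪Y (u₁ 0), u₁ 0⟫ / m ⟪Y (u 0), u 0⟫) + ‖Y (u 0)‖ ^ 2 < K₁ ^ 2) :
    ∀ t ∈ Icc 0 T, ‖u₁ t‖ < K * m ⟪Y (u t), u t⟫ ∧ ‖Y (u t)‖ < K₁ := by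
  have hcont := h.continuousOn_coeff hY hm
  have hu : ContinuousOn u (Icc 0 T) := fun t ht => (h.deriv t ht).continuousWithinAt
  have hu₁ : ContinuousOn u₁ (Icc 0 T) := fun t ht => (h.deriv₂ t ht).continuousWithinAt
  have hcpos : 0 < m ⟪Y (u 0), u 0⟫ := pos_of_mul_pos_right ((norm_nonneg _).trans_lt hc0) hK.le
  -- The least level allowed by `energies_le`. Both entries are strictly below K², by `hc0` and
  -- `hKβ`; this is the room needed for the bootstrap.
  set q := max (‖u₁ 0‖ ^ 2 / m ⟪Y (u 0), u 0⟫ ^ 2) (4 * K₁ ^ 2 / β ^ 2) with hq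
  have hq1 : 4 * K₁ ^ 2 ≤ β ^ 2 * q := by
    rw [← div_le_iff₀' (by positivity)]
    exact le_max_right _ _
  have hqK : q < K ^ 2 := by
    refine max_lt ?_ ?_
    · rw [div_lt_iff₀ (by positivity), ← mul_pow]
      exact pow_lt_pow_left₀ hc0 (norm_nonneg _) two_ne_zero
    · rw [div_lt_iff₀ (by positivity), ← mul_pow]
      calc 4 * K₁ ^ 2 = (2 * K₁) ^ 2 := by ring
        _ < _ := pow_lt_pow_left₀ hKβ (by positivity) two_ne_zero
  -- Failure of the strict bounds is a closed condition by continuity. Bounds valid before τ become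
  -- strict at τ, because q < K² and the initial higher energy is below K₁².
  refine forall_mem_Icc_of_isOpen ?_ fun τ hτ hP => ?_
  · have h1 : {t | t ∈ Icc 0 T ∧ ¬ (‖u₁ t‖ < K * m ⟪Y (u t), u t⟫ ∧ ‖Y (u t)‖ < K₁)} =
        {t | t ∈ Icc 0 T ∧ K * m ⟪Y (u t), u t⟫ ≤ ‖u₁ t‖} ∪ {t | t ∈ Icc 0 T ∧ K₁ ≤ ‖Y (u t)‖} := by
      ext t
      simp only [mem_ofPred_eq, mem_union, not_and_or, not_lt]
      tauto
    rw [h1]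
    exact (isClosed_Icc.isClosed_le (hcont.const_smul K) hu₁.norm).union
      (isClosed_Icc.isClosed_le continuousOn_const (Y.continuous.comp_continuousOn hu).norm)
  · obtain ⟨h1, h2, h3, -⟩ := h.energies_le hε hY hY0 hm hL hβ hb hεK hcpos hq1
      (le_max_left _ _) hτ fun s hs => (hP s (Ioo_subset_Ico_self hs)).imp le_of_lt le_of_lt
    have hc : 0 < m ⟪Y (u τ), u τ⟫ := (by positivity : 0 < m ⟪Y (u 0), u 0⟫ * _).trans_le h1
    constructor
    · have h4 := h3.trans_lt hqK
      rw [div_lt_iff₀ (by positivity), ← mul_pow] at h4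
      exact lt_of_pow_lt_pow_left₀ 2 (by positivity) h4
    · refine lt_of_pow_lt_pow_left₀ 2 hK₁ (lt_of_le_of_lt ?_ hF)
      have : 0 ≤ ε * (⟪Y (u₁ τ), u₁ τ⟫ / m ⟪Y (u τ), u τ⟫) :=
        mul_nonneg hε.le (div_nonneg (hY0 _) hc.le)
      linarith

end IsBoundedSolution

end APriori

/-! ### Approximate solutions and their differences -/

section Approximation

variable {H : Type*} [NormedAddCommGroup H] [InnerProductSpace ℝ H]

/-- The increment of the coefficient is made to multiply the shorter vector y. If ‖y‖ ≥ R, that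
increment is zero; otherwise ‖x‖ may be replaced by min ‖x‖ R, so that squares are compared only
inside the ball of radius R. -/
theorem norm_smul_normSq_sub_le {m : ℝ → ℝ} {L R C : ℝ} (hR : 0 ≤ R)
    (hL : ∀ x y, |m x - m y| ≤ L * |x - y|) (hconst : ∀ x, R ^ 2 ≤ x → m x = m (R ^ 2))
    (hC : ∀ x, |m x| ≤ C) (x y : H) :
    ‖m (‖x‖ ^ 2) • x - m (‖y‖ ^ 2) • y‖ ≤ (C + 2 * L * R ^ 2) * ‖x - y‖ := by
  wlog hxy : ‖y‖ ≤ ‖x‖ generalizing x y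
  · rw [norm_sub_rev, norm_sub_rev x y]
    exact this y x (le_of_not_ge hxy)
  have hL0 : 0 ≤ L := by have := (abs_nonneg _).trans (hL 1 0); simpa using this
  have h1 : m (‖x‖ ^ 2) • x - m (‖y‖ ^ 2) • y
      = m (‖x‖ ^ 2) • (x - y) + (m (‖x‖ ^ 2) - m (‖y‖ ^ 2)) • y := by
    rw [smul_sub, sub_smul]; abel
  have h2 : ‖(m (‖x‖ ^ 2) - m (‖y‖ ^ 2)) • y‖ ≤ 2 * L * R ^ 2 * ‖x - y‖ := by
    rcases le_total R ‖y‖ with hy | hy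
    · rw [hconst _ (pow_le_pow_left₀ hR (hy.trans hxy) 2), hconst _ (pow_le_pow_left₀ hR hy 2),
        sub_self, zero_smul, norm_zero]
      positivity
    · have h3 : m (‖x‖ ^ 2) = m (min ‖x‖ R ^ 2) := by
        rcases le_total ‖x‖ R with h | h
        · rw [min_eq_left h]
        · rw [min_eq_right h, hconst _ (pow_le_pow_left₀ hR h 2)]
      have h4 : ‖y‖ ≤ min ‖x‖ R := le_min hxy hy
      have h5 : min ‖x‖ R - ‖y‖ ≤ ‖x - y‖ :=
        (sub_le_sub_right (min_le_left _ _) _).trans (norm_sub_norm_le x y)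
      have h6 : |m (‖x‖ ^ 2) - m (‖y‖ ^ 2)| ≤ L * (‖x - y‖ * (2 * R)) := by
        rw [h3]
        refine (hL _ _).trans (mul_le_mul_of_nonneg_left ?_ hL0)
        have h7 : min ‖x‖ R ^ 2 - ‖y‖ ^ 2 = (min ‖x‖ R - ‖y‖) * (min ‖x‖ R + ‖y‖) := by ring
        rw [h7, abs_of_nonneg (mul_nonneg (by linarith) (by positivity))]
        exact mul_le_mul h5 (by linarith [min_le_right ‖x‖ R]) (by positivity) (norm_nonneg _)
      rw [norm_smul, Real.norm_eq_abs]
      calc _ ≤ L * (‖x - y‖ * (2 * R)) * R := mul_le_mul h6 hy (norm_nonneg _) (by positivity)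
        _ = _ := by ring
  rw [h1, add_mul]
  refine (norm_add_le _ _).trans (add_le_add ?_ h2)
  rw [norm_smul]
  exact mul_le_mul_of_nonneg_right (hC _) (norm_nonneg _)

/-- The first-order system for (u, u') is globally Lipschitz once the nonlinear term is written
Q(m(‖Q u‖²) Q u). -/
theorem exists_isBoundedSolution [CompleteSpace H] {Y Q : H →L[ℝ] H} {m b : ℝ → ℝ}
    {ε T L R C : ℝ} (hQ : ∀ x y, ⟪Q x, y⟫ = ⟪x, Q y⟫) (hQQ : ∀ x, Q (Q x) = Y x) (hT : 0 ≤ T)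
    (hε : 0 < ε) (hR : 0 ≤ R) (hL : ∀ x y, |m x - m y| ≤ L * |x - y|)
    (hconst : ∀ x, R ^ 2 ≤ x → m x = m (R ^ 2)) (hC : ∀ x, |m x| ≤ C)
    (hb : ContinuousOn b (Icc 0 T)) (x₀ y₀ : H) :
    ∃ u u₁ u₂ : ℝ → H, IsBoundedSolution Y m b ε T u u₁ u₂ ∧ u 0 = x₀ ∧ u₁ 0 = y₀ := by
  have hm := continuous_of_abs_sub_le hL
  have hbc := continuous_clampExtend hT hb
  obtain ⟨Cb, hCb⟩ := isCompact_Icc.exists_bound_of_continuousOn hb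
  have hCb' : ∀ t, ‖clampExtend T b t‖ ≤ Cb := fun t => hCb _ (clamp_mem hT t)
  have hCb0 : 0 ≤ Cb := (norm_nonneg _).trans (hCb' 0)
  have hL0 : 0 ≤ L := by have := (abs_nonneg _).trans (hL 1 0); simpa using this
  have hC0 : 0 ≤ C := (abs_nonneg _).trans (hC 0)
  let f : ℝ → H × H → H × H := fun t p =>
    (p.2, -(ε⁻¹ • (clampExtend T b t • p.2 + Q (m (‖Q p.1‖ ^ 2) • Q p.1))))
  have hf : Continuous (Function.uncurry f) := by
    change Continuous fun q : ℝ × H × H => (q.2.2,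
      -(ε⁻¹ • (clampExtend T b q.1 • q.2.2 + Q (m (‖Q q.2.1‖ ^ 2) • Q q.2.1))))
    fun_prop
  set K := 1 + ε⁻¹ * (Cb + ‖Q‖ * ((C + 2 * L * R ^ 2) * ‖Q‖)) with hKdef
  have hK1 : 1 ≤ K := by rw [hKdef, le_add_iff_nonneg_right]; positivity
  have hfK : ∀ t p q, ‖f t p - f t q‖ ≤ K * ‖p - q‖ := by
    intro t p q
    have h1 : ‖p.2 - q.2‖ ≤ ‖p - q‖ := norm_snd_le (p - q)
    have h2 : ‖p.1 - q.1‖ ≤ ‖p - q‖ := norm_fst_le (p - q)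
    refine max_le ?_ ?_
    · change ‖p.2 - q.2‖ ≤ _
      exact h1.trans (le_mul_of_one_le_left (norm_nonneg _) hK1)
    · change ‖-(ε⁻¹ • (clampExtend T b t • p.2 + Q (m (‖Q p.1‖ ^ 2) • Q p.1))) -
        -(ε⁻¹ • (clampExtend T b t • q.2 + Q (m (‖Q q.1‖ ^ 2) • Q q.1)))‖ ≤ _
      have e : -(ε⁻¹ • (clampExtend T b t • p.2 + Q (m (‖Q p.1‖ ^ 2) • Q p.1))) -
        -(ε⁻¹ • (clampExtend T b t • q.2 + Q (m (‖Q q.1‖ ^ 2) • Q q.1))) =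
        -(ε⁻¹ • (clampExtend T b t • (p.2 - q.2) +
          Q (m (‖Q p.1‖ ^ 2) • Q p.1 - m (‖Q q.1‖ ^ 2) • Q q.1))) := by
        simp only [smul_add, smul_sub, map_sub]
        abel
      have h3 : ‖clampExtend T b t • (p.2 - q.2)‖ ≤ Cb * ‖p - q‖ := by
        rw [norm_smul]
        exact mul_le_mul (hCb' t) h1 (norm_nonneg _) hCb0
      have h4 : ‖Q (m (‖Q p.1‖ ^ 2) • Q p.1 - m (‖Q q.1‖ ^ 2) • Q q.1)‖ ≤
          ‖Q‖ * ((C + 2 * L * R ^ 2) * ‖Q‖) * ‖p - q‖ := by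
        refine (Q.le_opNorm _).trans ?_
        rw [mul_assoc]
        refine mul_le_mul_of_nonneg_left ?_ (norm_nonneg _)
        refine (norm_smul_normSq_sub_le hR hL hconst hC _ _).trans ?_
        rw [mul_assoc (C + 2 * L * R ^ 2), ← map_sub]
        exact mul_le_mul_of_nonneg_left ((Q.le_opNorm _).trans
          (mul_le_mul_of_nonneg_left h2 (norm_nonneg _))) (by positivity)
      rw [e, norm_neg, norm_smul, Real.norm_of_nonneg (inv_pos.2 hε).le]
      calc _ ≤ ε⁻¹ * (Cb * ‖p - q‖ + ‖Q‖ * ((C + 2 * L * R ^ 2) * ‖Q‖) * ‖p - q‖) :=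
            mul_le_mul_of_nonneg_left ((norm_add_le _ _).trans (add_le_add h3 h4))
              (inv_pos.2 hε).le
        _ ≤ K * ‖p - q‖ := by
            rw [hKdef]
            nlinarith [norm_nonneg (p - q)]
  obtain ⟨x, hx0, hx⟩ := exists_forall_hasDerivWithinAt_of_lipschitz (f := f) (K := K) (T := T)
    (by positivity) hT hf hfK (x₀, y₀)
  refine ⟨fun t => (x t).1, fun t => (x t).2, fun t => (f t (x t)).2,
    ⟨fun t ht => ?_, fun t ht => ?_, fun t ht => ?_⟩, by simp [hx0], by simp [hx0]⟩
  · exact (hasFDerivAt_fst (𝕜 := ℝ) (p := x t)).comp_hasDerivWithinAt t (hx t ht)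
  · exact (hasFDerivAt_snd (𝕜 := ℝ) (p := x t)).comp_hasDerivWithinAt t (hx t ht)
  · have h1 : ⟪Y (x t).1, (x t).1⟫ = ‖Q (x t).1‖ ^ 2 := by
      rw [← hQQ, hQ, real_inner_self_eq_norm_sq]
    simp only [f]
    rw [clampExtend_eq ht, smul_neg, smul_inv_smul₀ hε.ne', h1, map_smul, hQQ]
    abel

/-- From l‖Y x‖² ≤ ⟪Y x, x⟫. Applied to u', this is the source of the rate √l in the Cauchy
estimate. -/
theorem IsYosida.norm_smul_le [CompleteSpace H] {A B : H →ₗ.[ℝ] H} {l k : ℝ} {J W Y : H →L[ℝ] H}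
    (hB : IsSqrt A B) (h : IsYosida A B l J W Y) (hk : 0 ≤ k) {x : H} (hx : ⟪Y x, x⟫ ≤ k ^ 2) :
    ‖l • Y x‖ ≤ √l * k := by
  have hl := h.pos
  rw [h.inner_yosida hB] at hx
  refine le_of_sq_le_sq ?_ (by positivity)
  rw [norm_smul, Real.norm_of_nonneg hl.le, mul_pow, mul_pow, Real.sq_sqrt hl.le, sq l, mul_assoc]
  exact mul_le_mul_of_nonneg_left (by nlinarith [sq_nonneg ‖W x‖]) hl.le

theorem le_sqrt_of_le_one {l : ℝ} (hl : 0 ≤ l) (hl1 : l ≤ 1) : l ≤ √l := by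
  nlinarith [Real.sq_sqrt hl, Real.sqrt_nonneg l, Real.sqrt_le_one.2 hl1]

/-- Difference of two approximate solutions with the same initial data. -/
theorem IsBoundedSolution.difference_le [CompleteSpace H] {A B : H →ₗ.[ℝ] H} (hB : IsSqrt A B)
    {l l' : ℝ} {J W Y J' W' Y' : H →L[ℝ] H} (hy : IsYosida A B l J W Y)
    (hy' : IsYosida A B l' J' W' Y') (hl : l ≤ 1) (hl' : l' ≤ 1) {m m' b : ℝ → ℝ}
    {ε T L M c₀ k K₁ K₃ : ℝ} (hT : 0 ≤ T) (hε : 0 < ε) (hc₀ : 0 < c₀) (hM : 0 ≤ M) (hL : 0 ≤ L)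
    (hk : 0 ≤ k) (hK₁ : 0 ≤ K₁) (hK₃ : 0 ≤ K₃)
    {u u₁ u₂ v v₁ v₂ : ℝ → H} (hu : IsBoundedSolution Y m b ε T u u₁ u₂)
    (hv : IsBoundedSolution Y' m' b ε T v v₁ v₂) (h0 : u 0 = v 0) (h1 : u₁ 0 = v₁ 0)
    (hmm : ∀ x y, |m x - m' y| ≤ L * (|x - y| + (l + l')))
    (hb : ∀ t ∈ Icc 0 T, 0 ≤ b t)
    (hc : ∀ s ∈ Icc 0 T, ∀ t ∈ Icc 0 T,
      |m ⟪Y (u s), u s⟫ - m ⟪Y (u t), u t⟫| ≤ M * |s - t|)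
    (hcc : ∀ t ∈ Icc 0 T, c₀ ≤ m ⟪Y (u t), u t⟫)
    (hYu : ∀ t ∈ Icc 0 T, ‖Y (u t)‖ ≤ K₁) (hYv : ∀ t ∈ Icc 0 T, ‖Y' (v t)‖ ≤ K₁)
    (hYu₁ : ∀ t ∈ Icc 0 T, ⟪Y (u₁ t), u₁ t⟫ ≤ k ^ 2)
    (hYv₁ : ∀ t ∈ Icc 0 T, ⟪Y' (v₁ t), v₁ t⟫ ≤ k ^ 2)
    (hWu : ∀ t ∈ Icc 0 T, ‖W (u t)‖ ≤ K₃) (hWv : ∀ t ∈ Icc 0 T, ‖W' (v t)‖ ≤ K₃) :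
    ∀ t ∈ Icc 0 T, ε * (‖u₁ t - v₁ t‖ ^ 2 / m ⟪Y (u t), u t⟫) + ‖W (u t) - W' (v t)‖ ^ 2 ≤
      (‖W (u 0) - W' (u 0)‖ ^ 2 + ε * (1 + 1 / c₀) * (2 *
        ((4 * K₁ * k + 4 * L ^ 2 * K₁ ^ 2 * (1 + K₁ ^ 2) ^ 2) * (√l + √l')))) *
        Real.exp ((1 / ε + M / c₀ + 2 * (8 * L ^ 2 * K₁ ^ 2 * K₃ ^ 2) / c₀) * t) := by
  set θ := √l + √l' with hθ
  have hlp := hy.pos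
  have hlp' := hy'.pos
  have hθl : l + l' ≤ θ := add_le_add (le_sqrt_of_le_one hlp.le hl) (le_sqrt_of_le_one hlp'.le hl')
  have hθ0 : 0 ≤ θ := by positivity
  have hθ2 : θ ≤ 2 := by
    have := Real.sqrt_le_one.2 hl
    have := Real.sqrt_le_one.2 hl'
    linarith
  have hD1 : 0 ≤ 4 * K₁ * k * θ := by positivity
  have hD2 : 0 ≤ 4 * L ^ 2 * K₁ ^ 2 * (1 + K₁ ^ 2) ^ 2 * θ := by positivity
  have hd : ∀ t ∈ Icc 0 T, HasDerivWithinAt (fun t => W (u t) - W' (v t))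
      (W (u₁ t) - W' (v₁ t)) (Icc 0 T) t := fun t ht =>
    (W.hasFDerivAt.comp_hasDerivWithinAt t (hu.deriv t ht)).sub
      (W'.hasFDerivAt.comp_hasDerivWithinAt t (hv.deriv t ht))
  have key := energy_le (w₁ := fun t => u₁ t - v₁ t) (w₂ := fun t => u₂ t - v₂ t)
    (g := fun t => Y (u t) - Y' (v t))
    (r := fun t => -((m ⟪Y (u t), u t⟫ - m' ⟪Y' (v t), v t⟫) • Y' (v t)))
    (G := fun t => ‖W (u t) - W' (v t)‖ ^ 2)
    (G₁ := fun t => 2 * ⟪W (u t) - W' (v t), W (u₁ t) - W' (v₁ t)⟫)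
    (c := fun t => m ⟪Y (u t), u t⟫) (b := b) (K := 2 * K₁)
    (C := 8 * L ^ 2 * K₁ ^ 2 * K₃ ^ 2)
    (δ := (4 * K₁ * k + 4 * L ^ 2 * K₁ ^ 2 * (1 + K₁ ^ 2) ^ 2) * θ)
    hT hε hc₀ (by positivity) (by positivity)
    (fun t ht => (hu.deriv₂ t ht).sub (hv.deriv₂ t ht)) (fun t ht => (hd t ht).norm_sq) hc
    (fun t ht => ?_) hb hcc hM (fun t _ => sq_nonneg _) (fun t ht => ?_) (fun t ht => ?_)
    (fun t ht => (norm_sub_le _ _).trans (by linarith [hYu t ht, hYv t ht]))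
  · intro t ht
    have := key t ht
    simp only [h0, h1, sub_self, norm_zero, ne_eq, OfNat.ofNat_ne_zero, not_false_eq_true,
      zero_pow, zero_div, mul_zero, zero_add] at this
    rw [h0]
    exact this
  · have e1 := hu.equation t ht
    have e2 := hv.equation t ht
    rw [← sub_eq_zero]
    calc _ = (ε • u₂ t + b t • u₁ t + m ⟪Y (u t), u t⟫ • Y (u t)) -
          (ε • v₂ t + b t • v₁ t + m' ⟪Y' (v t), v t⟫ • Y' (v t)) := by
          simp only [smul_sub, sub_smul]; abel
      _ = 0 := by rw [e1, e2, sub_zero]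
  -- Moving B across produces J u' - J' v' instead of u' - v'. The discrepancy l Y u' - l' Y' v' has
  -- size at most k θ and costs the part 4 K₁ k θ of δ.
  · have e1 : ⟪W (u t) - W' (v t), W (u₁ t) - W' (v₁ t)⟫ =
        ⟪Y (u t) - Y' (v t), J (u₁ t) - J' (v₁ t)⟫ :=
      (inner_symm_of_isSelfAdjoint hB.1.1 (graph_sub (hy.mem_right _) (hy'.mem_right _))
        (graph_sub (hy.mem_left _) (hy'.mem_left _))).symm
    have e2 : J (u₁ t) - J' (v₁ t) = (u₁ t - v₁ t) - (l • Y (u₁ t) - l' • Y' (v₁ t)) := by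
      rw [← sub_eq_of_eq_add (hy.eq_add (u₁ t)), ← sub_eq_of_eq_add (hy'.eq_add (v₁ t))]
      abel
    have h2 : -⟪Y (u t) - Y' (v t), l • Y (u₁ t) - l' • Y' (v₁ t)⟫ ≤ 2 * K₁ * (k * θ) := by
      refine ((neg_le_abs _).trans (abs_real_inner_le_norm _ _)).trans ?_
      refine mul_le_mul ((norm_sub_le _ _).trans (by linarith [hYu t ht, hYv t ht])) ?_
        (norm_nonneg _) (by positivity)
      refine (norm_sub_le _ _).trans ?_
      have := hy.norm_smul_le hB hk (hYu₁ t ht)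
      have := hy'.norm_smul_le hB hk (hYv₁ t ht)
      rw [hθ]
      linarith
    rw [e1, e2, inner_sub_right]
    nlinarith
  · have h2 : |⟪Y (u t), u t⟫ - ⟪Y' (v t), v t⟫| ≤
        2 * K₃ * ‖W (u t) - W' (v t)‖ + K₁ ^ 2 * (l + l') := by
      rw [hy.inner_yosida hB, hy'.inner_yosida hB]
      have i1 := abs_norm_sub_norm_le (W (u t)) (W' (v t))
      have i2 : |‖W (u t)‖ ^ 2 - ‖W' (v t)‖ ^ 2| ≤ 2 * K₃ * ‖W (u t) - W' (v t)‖ := by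
        rw [sq_sub_sq, abs_mul, abs_of_nonneg (by positivity : 0 ≤ ‖W (u t)‖ + ‖W' (v t)‖)]
        exact mul_le_mul (by linarith [hWu t ht, hWv t ht]) i1 (abs_nonneg _) (by positivity)
      have i3 : l * ‖Y (u t)‖ ^ 2 ≤ l * K₁ ^ 2 :=
        mul_le_mul_of_nonneg_left (pow_le_pow_left₀ (norm_nonneg _) (hYu t ht) 2) hlp.le
      have i4 : l' * ‖Y' (v t)‖ ^ 2 ≤ l' * K₁ ^ 2 :=
        mul_le_mul_of_nonneg_left (pow_le_pow_left₀ (norm_nonneg _) (hYv t ht) 2) hlp'.le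
      have i5 : 0 ≤ l * ‖Y (u t)‖ ^ 2 := by positivity
      have i6 : 0 ≤ l' * ‖Y' (v t)‖ ^ 2 := by positivity
      rw [abs_le] at i2 ⊢
      constructor <;> nlinarith [i2.1, i2.2]
    have h3 : |m ⟪Y (u t), u t⟫ - m' ⟪Y' (v t), v t⟫| ≤
        L * (2 * K₃ * ‖W (u t) - W' (v t)‖ + (1 + K₁ ^ 2) * θ) := by
      refine (hmm _ _).trans (mul_le_mul_of_nonneg_left ?_ hL)
      nlinarith [sq_nonneg K₁]
    rw [norm_neg, norm_smul, Real.norm_eq_abs, mul_pow]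
    set p := ‖W (u t) - W' (v t)‖
    have h4 : |m ⟪Y (u t), u t⟫ - m' ⟪Y' (v t), v t⟫| ^ 2 ≤
        8 * L ^ 2 * K₃ ^ 2 * p ^ 2 + 4 * L ^ 2 * (1 + K₁ ^ 2) ^ 2 * θ := by
      refine (pow_le_pow_left₀ (abs_nonneg _) h3 2).trans ?_
      -- The bound θ ≤ 2, which comes from l, l' ≤ 1, makes the whole error linear in θ.
      have i1 : θ ^ 2 ≤ 2 * θ := by nlinarith
      have i2 : (2 * K₃ * p + (1 + K₁ ^ 2) * θ) ^ 2 ≤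
          8 * K₃ ^ 2 * p ^ 2 + 2 * ((1 + K₁ ^ 2) ^ 2 * θ ^ 2) := by
        nlinarith [sq_nonneg (2 * K₃ * p - (1 + K₁ ^ 2) * θ)]
      have i3 : (1 + K₁ ^ 2) ^ 2 * θ ^ 2 ≤ (1 + K₁ ^ 2) ^ 2 * (2 * θ) :=
        mul_le_mul_of_nonneg_left i1 (by positivity)
      rw [mul_pow]
      have i4 := mul_le_mul_of_nonneg_left (i2.trans (by linarith :
        _ ≤ 8 * K₃ ^ 2 * p ^ 2 + 2 * ((1 + K₁ ^ 2) ^ 2 * (2 * θ)))) (sq_nonneg L)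
      refine i4.trans (le_of_eq ?_)
      ring
    calc _ ≤ (8 * L ^ 2 * K₃ ^ 2 * p ^ 2 + 4 * L ^ 2 * (1 + K₁ ^ 2) ^ 2 * θ) * K₁ ^ 2 :=
          mul_le_mul h4 (pow_le_pow_left₀ (norm_nonneg _) (hYv t ht) 2) (by positivity)
            (by positivity)
      _ ≤ _ := by nlinarith

end Approximation

/-! ### Passage to the limit -/

section Limit

variable {H : Type*} [NormedAddCommGroup H] [InnerProductSpace ℝ H]

theorem IsBoundedSolution.second_eq {Y : H →L[ℝ] H} {m b : ℝ → ℝ} {ε T : ℝ} {u u₁ u₂ : ℝ → H}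
    (h : IsBoundedSolution Y m b ε T u u₁ u₂) (hε : 0 < ε) {t : ℝ} (ht : t ∈ Icc 0 T) :
    u₂ t = -(ε⁻¹ • (b t • u₁ t + m ⟪Y (u t), u t⟫ • Y (u t))) := by
  have h1 := h.equation t ht
  rw [add_assoc] at h1
  rw [← smul_neg, ← eq_neg_of_add_eq_zero_left h1, inv_smul_smul₀ hε.ne']

variable [CompleteSpace H]

/-- `u` has one time derivative in `H`, takes values in `D(B)` with `B u = ξ` continuous, and solves
`ε u'' + b u' + c A u = 0`, `c = m(‖B u‖²)`, after application of the resolvent `(1 + A)⁻¹`. -/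
structure IsWeakSolution (A B : H →ₗ.[ℝ] H) (m b : ℝ → ℝ) (ε T c₀ M : ℝ) (u u₁ ξ : ℝ → H) :
    Prop where
  deriv : ∀ t ∈ Icc 0 T, HasDerivWithinAt u (u₁ t) (Icc 0 T) t
  continuousOn_deriv : ContinuousOn u₁ (Icc 0 T)
  mem_graph : ∀ t ∈ Icc 0 T, (u t, ξ t) ∈ B.graph
  continuousOn_sqrt : ContinuousOn ξ (Icc 0 T)
  le_coeff : ∀ t ∈ Icc 0 T, c₀ ≤ m (‖ξ t‖ ^ 2)
  lipschitz_coeff : ∀ s ∈ Icc 0 T, ∀ t ∈ Icc 0 T,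
    |m (‖ξ s‖ ^ 2) - m (‖ξ t‖ ^ 2)| ≤ M * |s - t|
  equation : ∀ R V Z : H →L[ℝ] H, IsYosida A B 1 R V Z → ∀ t ∈ Icc 0 T,
    HasDerivWithinAt (fun t => R (u₁ t))
      (-(ε⁻¹ • (b t • R (u₁ t) + m (‖ξ t‖ ^ 2) • (u t - R (u t))))) (Icc 0 T) t

theorem mem_graph_of_tendsto {B : H →ₗ.[ℝ] H} (hB : IsSelfAdjoint B) {x z : ℕ → H} {x' z' : H}
    (h : ∀ n, (x n, z n) ∈ B.graph) (hx : Tendsto x atTop (𝓝 x')) (hz : Tendsto z atTop (𝓝 z')) :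
    (x', z') ∈ B.graph :=
  (show IsClosed (B.graph : Set (H × H)) from hB.isClosed).mem_of_tendsto (hx.prodMk_nhds hz)
    (Eventually.of_forall h)

variable {A B : H →ₗ.[ℝ] H}

/-- Passage to the limit in the Yosida approximations. -/
theorem exists_isWeakSolution_of_bounds (hA : IsNonnegSelfAdjoint A) (hB : IsSqrt A B) {l : ℕ → ℝ}
    {J W Y : ℕ → H →L[ℝ] H} (hy : ∀ n, IsYosida A B (l n) (J n) (W n) (Y n))
    (hl : Tendsto l atTop (𝓝 0)) (hl1 : ∀ n, l n ≤ 1) {μ : ℕ → ℝ → ℝ} {m b : ℝ → ℝ}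
    {ε T L M c₀ C k K₁ K₂ K₃ : ℝ} (hT : 0 ≤ T) (hε : 0 < ε) (hc₀ : 0 < c₀) (hM : 0 ≤ M)
    (hL : 0 ≤ L) (hk : 0 ≤ k) (hK₁ : 0 ≤ K₁) (hK₃ : 0 ≤ K₃) (hC : 0 ≤ C)
    (hbc : ContinuousOn b (Icc 0 T)) (hb : ∀ t ∈ Icc 0 T, 0 ≤ b t)
    (hm : ∀ x y, |m x - m y| ≤ L * |x - y|) (hμc : ∀ n, Continuous (μ n))
    (hμ : ∀ n x, |μ n x - m x| ≤ L * l n)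
    {u u₁ u₂ : ℕ → ℝ → H} (hu : ∀ n, IsBoundedSolution (Y n) (μ n) b ε T (u n) (u₁ n) (u₂ n))
    {x₀ y₀ ξ₀ : H} (hx : ∀ n, u n 0 = x₀) (hx₁ : ∀ n, u₁ n 0 = y₀) (hξ : (x₀, ξ₀) ∈ B.graph)
    (hc : ∀ n, ∀ s ∈ Icc 0 T, ∀ t ∈ Icc 0 T,
      |μ n ⟪Y n (u n s), u n s⟫ - μ n ⟪Y n (u n t), u n t⟫| ≤ M * |s - t|)
    (hcc : ∀ n, ∀ t ∈ Icc 0 T, c₀ ≤ μ n ⟪Y n (u n t), u n t⟫)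
    (hcC : ∀ n, ∀ t ∈ Icc 0 T, μ n ⟪Y n (u n t), u n t⟫ ≤ C)
    (hYu : ∀ n, ∀ t ∈ Icc 0 T, ‖Y n (u n t)‖ ≤ K₁)
    (hu₁ : ∀ n, ∀ t ∈ Icc 0 T, ‖u₁ n t‖ ≤ K₂)
    (hYu₁ : ∀ n, ∀ t ∈ Icc 0 T, ⟪Y n (u₁ n t), u₁ n t⟫ ≤ k ^ 2)
    (hσ : ∀ n, ∀ t ∈ Icc 0 T, ⟪Y n (u n t), u n t⟫ ≤ K₃ ^ 2) :
    ∃ v v₁ ξ : ℝ → H, IsWeakSolution A B m b ε T c₀ M v v₁ ξ ∧ v 0 = x₀ ∧ v₁ 0 = y₀ ∧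
      ∀ t ∈ Icc 0 T, ‖ξ t‖ ^ 2 ≤ K₃ ^ 2 := by
  have h0 : (0 : ℝ) ∈ Icc 0 T := left_mem_Icc.2 hT
  have hunc : ∀ n, ContinuousOn (u n) (Icc 0 T) := fun n t ht =>
    ((hu n).deriv t ht).continuousWithinAt
  have hu₁c : ∀ n, ContinuousOn (u₁ n) (Icc 0 T) := fun n t ht =>
    ((hu n).deriv₂ t ht).continuousWithinAt
  have hWu : ∀ n, ∀ t ∈ Icc 0 T, ‖W n (u n t)‖ ≤ K₃ := fun n t ht => by
    have h1 := hσ n t ht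
    rw [(hy n).inner_yosida hB] at h1
    have := (hy n).pos
    have : 0 ≤ l n * ‖Y n (u n t)‖ ^ 2 := by positivity
    exact le_of_sq_le_sq (by linarith) hK₃
  have hW0 : Tendsto (fun n => W n x₀) atTop (𝓝 ξ₀) := by
    have := tendsto_resolvent hA hy hl ξ₀
    exact this.congr fun n => ((hy n).sqrt_eq hB hξ).symm
  -- the Cauchy estimate
  set D := ε * (1 + 1 / c₀) * (2 * (4 * K₁ * k + 4 * L ^ 2 * K₁ ^ 2 * (1 + K₁ ^ 2) ^ 2)) with hD
  set κ := 1 / ε + M / c₀ + 2 * (8 * L ^ 2 * K₁ ^ 2 * K₃ ^ 2) / c₀ with hκ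
  have hκ0 : 0 ≤ κ := by positivity
  have hD0 : 0 ≤ D := by positivity
  set φ : ℕ × ℕ → ℝ := fun p =>
    (‖W p.1 x₀ - W p.2 x₀‖ ^ 2 + D * (√(l p.1) + √(l p.2))) * Real.exp (κ * T) with hφ
  have hφ0 : Tendsto φ atTop (𝓝 0) := by
    rw [← prod_atTop_atTop_eq]
    have hs : Tendsto (fun n => √(l n)) atTop (𝓝 0) := by
      have := hl.sqrt
      rwa [Real.sqrt_zero] at this
    have h1 : Tendsto (fun p : ℕ × ℕ => W p.1 x₀ - W p.2 x₀) (atTop ×ˢ atTop) (𝓝 (ξ₀ - ξ₀)) :=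
      (hW0.comp tendsto_fst).sub (hW0.comp tendsto_snd)
    have h2 : Tendsto (fun p : ℕ × ℕ => √(l p.1) + √(l p.2)) (atTop ×ˢ atTop) (𝓝 (0 + 0)) :=
      (hs.comp tendsto_fst).add (hs.comp tendsto_snd)
    have h3 := ((h1.norm.pow 2).add (h2.const_mul D)).mul_const (Real.exp (κ * T))
    simpa using h3
  have hdiff : ∀ n j, ∀ t ∈ Icc 0 T, ε * (‖u₁ n t - u₁ j t‖ ^ 2 / μ n ⟪Y n (u n t), u n t⟫)
      + ‖W n (u n t) - W j (u j t)‖ ^ 2 ≤ φ (n, j) := by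
    intro n j t ht
    refine ((hu n).difference_le hB (hy n) (hy j) (hl1 n) (hl1 j) hT hε hc₀ hM hL hk hK₁ hK₃ (hu j)
      (by rw [hx, hx]) (by rw [hx₁, hx₁]) (fun x y => ?_) hb (hc n) (hcc n) (hYu n) (hYu j)
      (hYu₁ n) (hYu₁ j) (hWu n) (hWu j) t ht).trans ?_
    · have e : μ n x - μ j y = (μ n x - m x) + (m x - m y) - (μ j y - m y) := by ring
      rw [e]
      refine (abs_sub _ _).trans ((add_le_add_left (abs_add_le _ _) _).trans ?_)
      linarith [hμ n x, hμ j y, hm x y]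
    · rw [hx, ← hκ]
      have e : ε * (1 + 1 / c₀) * (2 * ((4 * K₁ * k + 4 * L ^ 2 * K₁ ^ 2 * (1 + K₁ ^ 2) ^ 2) *
        (√(l n) + √(l j)))) = D * (√(l n) + √(l j)) := by rw [hD]; ring
      rw [e]
      exact mul_le_mul_of_nonneg_left (Real.exp_le_exp.2 (mul_le_mul_of_nonneg_left ht.2 hκ0))
        (by positivity)
  have hdiff₁ : ∀ n j, ∀ t ∈ Icc 0 T, ‖u₁ n t - u₁ j t‖ ^ 2 ≤ C / ε * φ (n, j) := by
    intro n j t ht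
    have h1 := hdiff n j t ht
    have h2 := hc₀.trans_le (hcc n t ht)
    have h3 : ‖u₁ n t - u₁ j t‖ ^ 2 / μ n ⟪Y n (u n t), u n t⟫ ≤ φ (n, j) / ε := by
      rw [le_div_iff₀' hε]
      linarith [sq_nonneg ‖W n (u n t) - W j (u j t)‖]
    rw [div_le_iff₀ h2] at h3
    refine h3.trans ?_
    have h4 : 0 ≤ φ (n, j) := by positivity
    calc _ ≤ φ (n, j) / ε * C := mul_le_mul_of_nonneg_left (hcC n t ht) (by positivity)
      _ = _ := by ring
  have hdiffW : ∀ n j, ∀ t ∈ Icc 0 T, ‖W n (u n t) - W j (u j t)‖ ^ 2 ≤ φ (n, j) := by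
    intro n j t ht
    have h2 := hc₀.trans_le (hcc n t ht)
    have h3 : 0 ≤ ε * (‖u₁ n t - u₁ j t‖ ^ 2 / μ n ⟪Y n (u n t), u n t⟫) := by positivity
    linarith [hdiff n j t ht]
  obtain ⟨v₁, hv₁c, hv₁, -⟩ := exists_limit_of_uniformCauchy hu₁c
    (by simpa using hφ0.const_mul (C / ε)) hdiff₁
  obtain ⟨ξ, hξc, hξl, -⟩ := exists_limit_of_uniformCauchy
    (fun n => (W n).continuous.comp_continuousOn (hunc n)) hφ0 hdiffW
  obtain ⟨v, hv0, hvc, hv⟩ := exists_antiderivative hT hv₁c x₀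
  have hvl : ∀ t ∈ Icc 0 T, Tendsto (fun n => u n t) atTop (𝓝 (v t)) :=
    tendsto_of_deriv_tendsto (fun n => (hu n).deriv) hu₁c hv hv₁c
      (by simp_rw [hx]; exact tendsto_const_nhds) hv0 hv₁ (Eventually.of_forall hu₁)
  have hJv : ∀ t ∈ Icc 0 T, Tendsto (fun n => J n (u n t)) atTop (𝓝 (v t)) := fun t ht =>
    tendsto_resolvent_of_tendsto hA hy hl (hvl t ht)
  have hgraph : ∀ t ∈ Icc 0 T, (v t, ξ t) ∈ B.graph := fun t ht =>
    mem_graph_of_tendsto hB.1.1 (fun n => (hy n).mem_left (u n t)) (hJv t ht) (hξl t ht)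
  have hσl : ∀ t ∈ Icc 0 T, Tendsto (fun n => ⟪Y n (u n t), u n t⟫) atTop (𝓝 (‖ξ t‖ ^ 2)) := by
    intro t ht
    have h1 : Tendsto (fun n => l n * ‖Y n (u n t)‖ ^ 2) atTop (𝓝 0) := by
      refine squeeze_zero (fun n => by have := (hy n).pos; positivity)
        (fun n => mul_le_mul_of_nonneg_left
          (pow_le_pow_left₀ (norm_nonneg _) (hYu n t ht) 2) (hy n).pos.le) ?_
      simpa using hl.mul_const (K₁ ^ 2)
    have h2 := ((hξl t ht).norm.pow 2).add h1
    rw [add_zero] at h2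
    exact h2.congr fun n => ((hy n).inner_yosida hB _).symm
  have hcl : ∀ t ∈ Icc 0 T, Tendsto (fun n => μ n ⟪Y n (u n t), u n t⟫) atTop
      (𝓝 (m (‖ξ t‖ ^ 2))) := by
    intro t ht
    have h1 : Tendsto (fun n => m ⟪Y n (u n t), u n t⟫) atTop (𝓝 (m (‖ξ t‖ ^ 2))) :=
      ((continuous_of_abs_sub_le hm).tendsto _).comp (hσl t ht)
    have h2 : Tendsto (fun n => μ n ⟪Y n (u n t), u n t⟫ - m ⟪Y n (u n t), u n t⟫) atTop (𝓝 0) :=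
      squeeze_zero_norm (fun n => hμ n _) (by simpa using hl.const_mul L)
    have h3 := h1.add h2
    rw [add_zero] at h3
    exact h3.congr fun n => by ring
  obtain ⟨Cb, hCb⟩ := isCompact_Icc.exists_bound_of_continuousOn hbc
  refine ⟨v, v₁, ξ, ⟨hv, hv₁c, hgraph, hξc, fun t ht => ?_, fun s hs t ht => ?_,
    fun R V Z hR => ?_⟩, hv0, ?_, fun t ht => ?_⟩
  · exact ge_of_tendsto (hcl t ht) (Eventually.of_forall fun n => hcc n t ht)
  · exact le_of_tendsto ((hcl s hs).sub (hcl t ht)).abs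
      (Eventually.of_forall fun n => hc n s hs t ht)
  · have hcv : ContinuousOn (fun t => m (‖ξ t‖ ^ 2)) (Icc 0 T) :=
      (continuous_of_abs_sub_le hm).comp_continuousOn (hξc.norm.pow 2)
    have hcn : ∀ n, ContinuousOn (fun t => μ n ⟪Y n (u n t), u n t⟫) (Icc 0 T) := fun n =>
      (hμc n).comp_continuousOn
        (((Y n).continuous.comp_continuousOn (hunc n)).inner (𝕜 := ℝ) (hunc n))
    have hRv₁ := R.continuous.comp_continuousOn hv₁c
    have hRv := R.continuous.comp_continuousOn hvc.continuousOn (s := Icc 0 T)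
    have hu₂c : ∀ n, ContinuousOn (u₂ n) (Icc 0 T) := fun n => by
      have h1 : ContinuousOn (fun t => -(ε⁻¹ • (b t • u₁ n t + μ n ⟪Y n (u n t), u n t⟫ •
          Y n (u n t)))) (Icc 0 T) :=
        (((hbc.smul (hu₁c n)).add ((hcn n).smul
          ((Y n).continuous.comp_continuousOn (hunc n)))).const_smul _).neg
      exact h1.congr fun t ht => (hu n).second_eq hε ht
    refine hasDerivWithinAt_of_tendsto hT (f := fun n t => R (u₁ n t)) (g := fun n t => R (u₂ n t))
      (C := ε⁻¹ * (Cb * K₂ + C * K₁))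
      (fun n t ht => R.hasFDerivAt.comp_hasDerivWithinAt t ((hu n).deriv₂ t ht))
      (fun n => R.continuous.comp_continuousOn (hu₂c n)) ?_
      (fun t ht => (R.continuous.tendsto _).comp (hv₁ t ht)) (fun t ht => ?_)
      (Eventually.of_forall fun n t ht => ?_)
    · exact (((hbc.smul hRv₁).add (hcv.smul (hvc.continuousOn.sub hRv))).const_smul _).neg
    -- Y n (u n) is only known to be bounded, but R Y = J - R J, so under R the term converges
    -- strongly. This dictates the form of `IsWeakSolution.equation`.
    · have h1 : ∀ n, R (u₂ n t) = -(ε⁻¹ • (b t • R (u₁ n t) + μ n ⟪Y n (u n t), u n t⟫ •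
          (J n (u n t) - R (J n (u n t))))) := fun n => by
        have h2 := (hy n).resolvent_apply_add hB hR (u n t)
        rw [map_add] at h2
        rw [(hu n).second_eq hε ht, ← eq_sub_of_add_eq' h2]
        simp only [map_neg, map_smul, map_add]
      simp_rw [h1]
      exact (((((R.continuous.tendsto _).comp (hv₁ t ht)).const_smul _).add
        ((hcl t ht).smul ((hJv t ht).sub ((R.continuous.tendsto _).comp (hJv t ht))))).const_smul
          _).neg
    · refine (hR.norm_le _).trans ?_
      rw [(hu n).second_eq hε ht, norm_neg, norm_smul, Real.norm_of_nonneg (inv_pos.2 hε).le]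
      refine mul_le_mul_of_nonneg_left ((norm_add_le _ _).trans (add_le_add ?_ ?_))
        (inv_pos.2 hε).le
      · rw [norm_smul]
        exact mul_le_mul (hCb t ht) (hu₁ n t ht) (norm_nonneg _)
          ((norm_nonneg _).trans (hCb t ht))
      · rw [norm_smul, Real.norm_of_nonneg (hc₀.le.trans (hcc n t ht))]
        exact mul_le_mul (hcC n t ht) (hYu n t ht) (norm_nonneg _) hC
  · exact tendsto_nhds_unique (hv₁ 0 h0) (by simp_rw [hx₁]; exact tendsto_const_nhds)
  · exact le_of_tendsto (hσl t ht) (Eventually.of_forall fun n => hσ n t ht)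

end Limit

/-! ### Choice of the constants and existence of a weak solution -/

section WeakExistence

theorem abs_forwardAverage_sub_forwardAverage_le {f : ℝ → ℝ} {L : ℝ}
    (hL : ∀ x y, |f x - f y| ≤ L * |x - y|) {h : ℝ} (hh : 0 < h) (x y : ℝ) :
    |forwardAverage f h x - forwardAverage f h y| ≤ L * |x - y| :=
  convex_univ.norm_image_sub_le_of_norm_hasDerivWithin_le
    (fun z _ => (hasDerivAt_forwardAverage (continuous_of_abs_sub_le hL) h z).hasDerivWithinAt)
    (fun z _ => abs_deriv_forwardAverage_le hL hh z) (mem_univ y) (mem_univ x)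

theorem forwardAverage_eq {f : ℝ → ℝ} (hf : Continuous f) {h x a : ℝ} (hh : 0 < h)
    (ha : ∀ s ∈ Icc x (x + h), f s = a) : forwardAverage f h x = a :=
  le_antisymm (forwardAverage_le hf hh fun s hs => (ha s hs).le)
    (le_forwardAverage hf hh fun s hs => (ha s hs).ge)

variable {H : Type*} [NormedAddCommGroup H] [InnerProductSpace ℝ H] [CompleteSpace H]
  {A B : H →ₗ.[ℝ] H}

set_option maxHeartbeats 800000 in
-- All constants that restrict ε are fixed from the data, T, b and m alone, before any approximation
-- is introduced; the threshold is thus independent of l.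
theorem exists_isWeakSolution (hA : IsNonnegSelfAdjoint A) (hB : IsSqrt A B) {m b : ℝ → ℝ}
    (hm : LocallyLipschitzOn (Ici 0) m) (hm0 : ∀ x, 0 ≤ x → 0 ≤ m x)
    {T : ℝ} (hT : 0 ≤ T) (hbc : ContinuousOn b (Icc 0 T)) (hb : ∀ t ∈ Icc 0 T, 0 < b t)
    {x₀ y₀ z₀ ξ₀ η₀ : H} (hz₀ : (x₀, z₀) ∈ A.graph) (hξ₀ : (x₀, ξ₀) ∈ B.graph)
    (hη₀ : (y₀, η₀) ∈ B.graph) (hpos : 0 < m (‖ξ₀‖ ^ 2)) :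
    ∃ ε₀ : ℝ, 0 < ε₀ ∧ ∀ ε : ℝ, 0 < ε → ε < ε₀ → ∃ c₀ M : ℝ, 0 < c₀ ∧ 0 ≤ M ∧
      ∃ v v₁ ξ : ℝ → H, IsWeakSolution A B m b ε T c₀ M v v₁ ξ ∧ v 0 = x₀ ∧ v₁ 0 = y₀ := by
  set m₀ := m (‖ξ₀‖ ^ 2) / 2 with hm₀
  have hm₀p : 0 < m₀ := by positivity
  -- For ε ≤ 1, S bounds the initial lower energy, hence ⟪Y u, u⟫ for all times. Replacing m by its
  -- clamp at S makes it globally Lipschitz without affecting the limit.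
  set S := ‖y₀‖ ^ 2 / m₀ + ‖ξ₀‖ ^ 2 with hS
  have hS0 : 0 ≤ S := by positivity
  have hSsub : Icc 0 S ⊆ Ici 0 := fun x hx => hx.1
  obtain ⟨L, hLip⟩ := (hm.mono hSsub).exists_lipschitzOnWith_of_compact isCompact_Icc
  have hL0 : (0 : ℝ) ≤ L := L.2
  obtain ⟨C, hC⟩ := isCompact_Icc.exists_bound_of_continuousOn hLip.continuousOn
  set f := clampExtend S m with hf
  have hfL : ∀ x y, |f x - f y| ≤ L * |x - y| := fun x y =>
    (hLip.dist_le_mul _ (clamp_mem hS0 x) _ (clamp_mem hS0 y)).trans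
      (mul_le_mul_of_nonneg_left (abs_clamp_sub_le S x y) hL0)
  have hfc := continuous_of_abs_sub_le hfL
  have hfC : ∀ x, f x ≤ C := fun x => (le_abs_self _).trans (hC _ (clamp_mem hS0 x))
  have hf0 : ∀ x, 0 ≤ f x := fun x => hm0 _ (clamp_mem hS0 x).1
  have hfm : ∀ x ∈ Icc 0 S, f x = m x := fun x hx => clampExtend_eq hx
  have hC0 : 0 ≤ C := (hf0 0).trans (hfC 0)
  have hfconst : ∀ x, S ≤ x → f x = m S := fun x hx => by
    rw [hf, clampExtend, min_eq_right hx, max_eq_right hS0]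
  have hξS : ‖ξ₀‖ ^ 2 ∈ Icc 0 S :=
    ⟨by positivity, by rw [hS, le_add_iff_nonneg_left]; positivity⟩
  obtain ⟨β, hβ, hbβ⟩ : ∃ β, 0 < β ∧ ∀ t ∈ Icc 0 T, β ≤ b t := by
    obtain ⟨t₀, ht₀, h⟩ := isCompact_Icc.exists_isMinOn ⟨0, left_mem_Icc.2 hT⟩ hbc
    exact ⟨b t₀, hb t₀ ht₀, fun t ht => h ht⟩
  -- The summand 1 makes K₁ exceed the initial higher energy and ensures K₁ ≤ K₁², so K₁² exceeds it
  -- as well.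
  set K₁ := ‖η₀‖ ^ 2 / m₀ + ‖z₀‖ ^ 2 + 1 with hK₁
  have hK₁1 : 1 ≤ K₁ := by rw [hK₁, le_add_iff_nonneg_left]; positivity
  -- The first two summands match the initial condition ‖u'‖ < K c and the requirement 2K₁ < Kβ; the
  -- last makes both strict.
  set K := ‖y₀‖ / m₀ + 2 * K₁ / β + 1 with hK
  have hKp : 0 < K := by positivity
  set κ := 2 * (L : ℝ) * K * K₁ with hκ
  have hκ0 : 0 ≤ κ := by positivity
  -- The second entry yields ε κ ≤ β/2; κ + 1 avoids division by zero.
  refine ⟨min 1 (β / (2 * (κ + 1))), by positivity, fun ε hε hε₀ => ?_⟩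
  have hε1 : ε ≤ 1 := hε₀.le.trans (min_le_left _ _)
  have hεκ : ε * κ ≤ β / 2 := by
    have h1 : ε ≤ β / (2 * (κ + 1)) := hε₀.le.trans (min_le_right _ _)
    rw [le_div_iff₀ (by positivity)] at h1
    nlinarith
  -- the approximations
  have hlp : ∀ n : ℕ, (0 : ℝ) < 1 / ((n : ℝ) + 1) := fun n : ℕ => by positivity
  choose J W Y hy using fun n : ℕ => exists_isYosida hA hB (hlp n)
  have hl := tendsto_one_div_add_atTop_nhds_zero_nat (𝕜 := ℝ)
  have hinit : Tendsto (fun n : ℕ => forwardAverage f (1 / ((n : ℝ) + 1)) ⟪Y n x₀, x₀⟫) atTop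
      (𝓝 (2 * m₀)) := by
    have h1 : Tendsto (fun n : ℕ => f ⟪Y n x₀, x₀⟫) atTop (𝓝 (2 * m₀)) := by
      have h2 := ((tendsto_resolvent hA hy hl ξ₀).inner (𝕜 := ℝ) (tendsto_const_nhds (x := ξ₀)))
      rw [real_inner_self_eq_norm_sq] at h2
      have h3 := (hfc.tendsto _).comp h2
      rw [hfm _ hξS, show m (‖ξ₀‖ ^ 2) = 2 * m₀ by rw [hm₀]; ring] at h3
      exact h3.congr fun n : ℕ => by simp only [Function.comp]; rw [(hy n).inner_yosida_eq hB hξ₀]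
    have h2 : Tendsto (fun n : ℕ => forwardAverage f (1 / ((n : ℝ) + 1)) ⟪Y n x₀, x₀⟫ -
        f ⟪Y n x₀, x₀⟫) atTop (𝓝 0) :=
      squeeze_zero_norm (fun n : ℕ => abs_forwardAverage_sub_le hfL hfc (hlp n) _)
        (by simpa using hl.const_mul (L : ℝ))
    have h3 := h1.add h2
    rw [add_zero] at h3
    exact h3.congr fun n : ℕ => by ring
  -- The approximate coefficients at time 0 tend to 2 m₀. Dropping the first N approximations makes
  -- all of them at least m₀.
  obtain ⟨N, hN⟩ := eventually_atTop.1
    (hinit.eventually (le_mem_nhds (show m₀ < 2 * m₀ by linarith)))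
  set l : ℕ → ℝ := fun n : ℕ => 1 / (((n + N : ℕ) : ℝ) + 1) with hldef
  have hl' : Tendsto l atTop (𝓝 0) := hl.comp (tendsto_add_atTop_nat N)
  have hlp' : ∀ n : ℕ, 0 < l n := fun n : ℕ => hlp (n + N)
  have hl1 : ∀ n : ℕ, l n ≤ 1 := fun n : ℕ => by
    rw [hldef, div_le_one (by positivity), le_add_iff_nonneg_left]
    positivity
  set μ : ℕ → ℝ → ℝ := fun n : ℕ => forwardAverage f (l n) with hμ
  have hy' : ∀ n : ℕ, IsYosida A B (l n) (J (n + N)) (W (n + N)) (Y (n + N)) :=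
    fun n : ℕ => hy (n + N)
  have hc0 : ∀ n : ℕ, m₀ ≤ μ n ⟪Y (n + N) x₀, x₀⟫ := fun n : ℕ => hN (n + N) (Nat.le_add_left N n)
  have hμC : ∀ (n : ℕ) x, μ n x ≤ C := fun (n : ℕ) x =>
    forwardAverage_le hfc (hlp' n) fun s _ => hfC s
  have hμ0 : ∀ (n : ℕ) x, 0 ≤ μ n x := fun (n : ℕ) x =>
    le_forwardAverage hfc (hlp' n) fun s _ => hf0 s
  have hμd : ∀ (n : ℕ) x, HasDerivAt (μ n) ((l n)⁻¹ * (f (x + l n) - f x)) x := fun (n : ℕ) x =>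
    hasDerivAt_forwardAverage hfc (l n) x
  have hμd' : ∀ (n : ℕ) x, |(l n)⁻¹ * (f (x + l n) - f x)| ≤ L := fun (n : ℕ) x =>
    abs_deriv_forwardAverage_le hfL (hlp' n) x
  have hμconst : ∀ (n : ℕ) x, S ≤ x → μ n x = m S := fun (n : ℕ) x hx =>
    forwardAverage_eq hfc (hlp' n) fun s hs => hfconst s (hx.trans hs.1)
  have hex : ∀ n : ℕ, ∃ u u₁ u₂ : ℝ → H,
      IsBoundedSolution (Y (n + N)) (μ n) b ε T u u₁ u₂ ∧ u 0 = x₀ ∧ u₁ 0 = y₀ := by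
    intro n
    obtain ⟨Q, hQ, hQQ⟩ := (hy' n).exists_sqrt
    refine exists_isBoundedSolution (R := √S) (C := C) hQ hQQ hT hε (Real.sqrt_nonneg S)
      (fun x y => abs_forwardAverage_sub_forwardAverage_le hfL (hlp' n) x y) (fun x hx => ?_)
      (fun x => ?_) hbc x₀ y₀
    · rw [Real.sq_sqrt hS0] at hx ⊢
      exact (hμconst n x hx).trans (hμconst n S le_rfl).symm
    · change |μ n x| ≤ C
      rw [abs_of_nonneg (hμ0 n x)]
      exact hμC n x
  choose u u₁ u₂ hu hux hux₁ using hex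
  have hYx : ∀ n : ℕ, ‖Y (n + N) x₀‖ ≤ ‖z₀‖ := fun n : ℕ => by
    rw [(hy' n).yosida_eq hz₀]; exact (hy' n).norm_le _
  have hJle : ∀ (n : ℕ) x, ⟪J (n + N) x, x⟫ ≤ ‖x‖ ^ 2 := fun (n : ℕ) x => by
    rw [sq]
    exact (real_inner_le_norm _ _).trans
      (mul_le_mul_of_nonneg_right ((hy' n).norm_le x) (norm_nonneg _))
  have hYy : ∀ n : ℕ, ⟪Y (n + N) y₀, y₀⟫ ≤ ‖η₀‖ ^ 2 := fun n : ℕ => by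
    rw [(hy' n).inner_yosida_eq hB hη₀]; exact hJle n η₀
  have hYx' : ∀ n : ℕ, ⟪Y (n + N) x₀, x₀⟫ ≤ ‖ξ₀‖ ^ 2 := fun n : ℕ => by
    rw [(hy' n).inner_yosida_eq hB hξ₀]; exact hJle n ξ₀
  have hF : ∀ n : ℕ, ε * (⟪Y (n + N) (u₁ n 0), u₁ n 0⟫ / μ n ⟪Y (n + N) (u n 0), u n 0⟫) +
      ‖Y (n + N) (u n 0)‖ ^ 2 < K₁ ^ 2 := by
    intro n
    rw [hux, hux₁]
    have h1 : ⟪Y (n + N) y₀, y₀⟫ / μ n ⟪Y (n + N) x₀, x₀⟫ ≤ ‖η₀‖ ^ 2 / m₀ :=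
      div_le_div₀ (by positivity) (hYy n) hm₀p (hc0 n)
    have h2 : 0 ≤ ⟪Y (n + N) y₀, y₀⟫ / μ n ⟪Y (n + N) x₀, x₀⟫ :=
      div_nonneg ((hy' n).inner_yosida_nonneg hB _) (hμ0 n _)
    have h3 : ‖Y (n + N) x₀‖ ^ 2 ≤ ‖z₀‖ ^ 2 := pow_le_pow_left₀ (norm_nonneg _) (hYx n) 2
    have h4 := mul_le_of_le_one_left h2 hε1
    have h5 : K₁ ≤ K₁ ^ 2 := le_self_pow₀ hK₁1 two_ne_zero
    linarith
  have hP : ∀ n : ℕ, ∀ t ∈ Icc 0 T, ‖u₁ n t‖ < K * μ n ⟪Y (n + N) (u n t), u n t⟫ ∧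
      ‖Y (n + N) (u n t)‖ < K₁ := by
    intro n
    refine (hu n).norm_deriv_lt hε (hy' n).yosida_symm ((hy' n).inner_yosida_nonneg hB) (hμd n)
      (hμd' n) hβ hbβ hKp (by positivity) hεκ ?_ ?_ (hF n)
    · rw [hK, add_mul, add_mul, div_mul_cancel₀ _ hβ.ne', add_right_comm]
      have : 0 < ‖y₀‖ / m₀ * β + 1 * β := by positivity
      linarith
    · rw [hux, hux₁]
      have h1 : ‖y₀‖ = ‖y₀‖ / m₀ * m₀ := (div_mul_cancel₀ _ hm₀p.ne').symm
      have h2 : 0 < (2 * K₁ / β + 1) * m₀ := by positivity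
      have h3 : K * m₀ ≤ K * μ n ⟪Y (n + N) x₀, x₀⟫ := mul_le_mul_of_nonneg_left (hc0 n) hKp.le
      have h4 : K * m₀ = ‖y₀‖ / m₀ * m₀ + (2 * K₁ / β + 1) * m₀ := by rw [hK]; ring
      linarith
  -- With the bootstrap closed on all of [0,T], the energy bounds hold at every time, uniformly in
  -- n.
  have hE := fun (n : ℕ) t ht => (hu n).energies_le hε (hy' n).yosida_symm
    ((hy' n).inner_yosida_nonneg hB) (hμd n) (hμd' n) hβ hbβ hεκ
    (by rw [hux]; exact hm₀p.trans_le (hc0 n))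
    (q := max (‖u₁ n 0‖ ^ 2 / μ n ⟪Y (n + N) (u n 0), u n 0⟫ ^ 2) (4 * K₁ ^ 2 / β ^ 2))
    (by rw [← div_le_iff₀' (by positivity)]; exact le_max_right _ _) (le_max_left _ _)
    (τ := t) ht fun s hs => (hP n s ⟨hs.1.le, hs.2.le.trans ht.2⟩).imp le_of_lt le_of_lt
  set c₀ := m₀ * Real.exp (-κ * T) with hc₀
  have hc₀p : 0 < c₀ := by positivity
  have hcc : ∀ n : ℕ, ∀ t ∈ Icc 0 T, c₀ ≤ μ n ⟪Y (n + N) (u n t), u n t⟫ := by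
    intro n t ht
    refine le_trans ?_ (hE n t ht).1
    rw [hux]
    exact mul_le_mul (hc0 n) (Real.exp_le_exp.2 (by nlinarith [ht.2])) (Real.exp_pos _).le
      (hμ0 n _)
  have hlip : ∀ n : ℕ, ∀ s ∈ Icc 0 T, ∀ t ∈ Icc 0 T,
      |μ n ⟪Y (n + N) (u n s), u n s⟫ - μ n ⟪Y (n + N) (u n t), u n t⟫| ≤ κ * C * |s - t| := by
    intro n s hs t ht
    refine (convex_Icc 0 T).norm_image_sub_le_of_norm_hasDerivWithin_le
      (fun z hz => (hu n).hasDerivWithinAt_coeff (hy' n).yosida_symm (hμd n) hz)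
      (fun z hz => ?_) ht hs
    refine (IsBoundedSolution.abs_deriv_coeff_le (hμd' n) (hP n z hz).1.le (hP n z hz).2.le).trans ?_
    exact mul_le_mul_of_nonneg_left (hμC n _) hκ0
  have hYu₁ : ∀ n : ℕ, ∀ t ∈ Icc 0 T, ⟪Y (n + N) (u₁ n t), u₁ n t⟫ ≤ (√(C / ε) * K₁) ^ 2 := by
    intro n t ht
    have h1 := (hE n t ht).2.1.trans (hF n).le
    have h2 := hc₀p.trans_le (hcc n t ht)
    have h3 : ⟪Y (n + N) (u₁ n t), u₁ n t⟫ / μ n ⟪Y (n + N) (u n t), u n t⟫ ≤ K₁ ^ 2 / ε := by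
      rw [le_div_iff₀' hε]
      linarith [sq_nonneg ‖Y (n + N) (u n t)‖]
    rw [div_le_iff₀ h2] at h3
    rw [mul_pow, Real.sq_sqrt (by positivity)]
    refine h3.trans ((mul_le_mul_of_nonneg_left (hμC n _) (by positivity)).trans (le_of_eq ?_))
    ring
  have hσ : ∀ n : ℕ, ∀ t ∈ Icc 0 T, ⟪Y (n + N) (u n t), u n t⟫ ≤ √S ^ 2 := by
    intro n t ht
    have h1 := (hE n t ht).2.2.2
    have h2 := hc₀p.trans_le (hcc n t ht)
    have h3 : 0 ≤ ε * (‖u₁ n t‖ ^ 2 / μ n ⟪Y (n + N) (u n t), u n t⟫) := by positivity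
    have h4 : ε * (‖y₀‖ ^ 2 / μ n ⟪Y (n + N) x₀, x₀⟫) ≤ ‖y₀‖ ^ 2 / m₀ := by
      have h5 : ‖y₀‖ ^ 2 / μ n ⟪Y (n + N) x₀, x₀⟫ ≤ ‖y₀‖ ^ 2 / m₀ :=
        div_le_div_of_nonneg_left (by positivity) hm₀p (hc0 n)
      have h6 : 0 ≤ ‖y₀‖ ^ 2 / μ n ⟪Y (n + N) x₀, x₀⟫ := div_nonneg (by positivity) (hμ0 n _)
      exact (mul_le_of_le_one_left h6 hε1).trans h5
    rw [Real.sq_sqrt hS0, hS]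
    rw [hux, hux₁] at h1
    linarith [hYx' n]
  obtain ⟨v, v₁, ξ, hv, hv0, hv₁0, hξ⟩ := exists_isWeakSolution_of_bounds (L := L) (M := κ * C)
    (c₀ := c₀) (C := C) (k := √(C / ε) * K₁) (K₁ := K₁) (K₂ := K * C) (K₃ := √S) (m := f) (b := b)
    (ε := ε) hA hB hy' hl' hl1 hT hε
    hc₀p (by positivity) hL0 (by positivity) (by positivity) (Real.sqrt_nonneg S) hC0 hbc
    (fun t ht => (hb t ht).le) hfL (fun n : ℕ => continuous_forwardAverage hfc (l n))
    (fun (n : ℕ) x => abs_forwardAverage_sub_le hfL hfc (hlp' n) x) hu hux hux₁ hξ₀ hlip hcc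
    (fun (n : ℕ) t _ => hμC n _) (fun (n : ℕ) t ht => (hP n t ht).2.le)
    (fun (n : ℕ) t ht => (hP n t ht).1.le.trans (mul_le_mul_of_nonneg_left (hμC n _) hKp.le))
    hYu₁ hσ
  rw [Real.sq_sqrt hS0] at hξ
  -- The limit stays in the range where the truncation is inactive.
  have hfξ : ∀ t ∈ Icc 0 T, f (‖ξ t‖ ^ 2) = m (‖ξ t‖ ^ 2) := fun t ht =>
    hfm _ ⟨by positivity, hξ t ht⟩
  refine ⟨c₀, κ * C, hc₀p, by positivity, v, v₁, ξ, ⟨hv.deriv, hv.continuousOn_deriv,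
    hv.mem_graph, hv.continuousOn_sqrt, fun t ht => ?_, fun s hs t ht => ?_,
    fun R V Z hR t ht => ?_⟩, hv0, hv₁0⟩
  · rw [← hfξ t ht]; exact hv.le_coeff t ht
  · rw [← hfξ t ht, ← hfξ s hs]; exact hv.lipschitz_coeff s hs t ht
  · rw [← hfξ t ht]; exact hv.equation R V Z hR t ht

end WeakExistence

/-! ### Regularity of the weak solution and uniqueness -/

section Regularity

variable {H : Type*} [NormedAddCommGroup H] [InnerProductSpace ℝ H]

/-- A solution of `ε u'' + b u' + m(‖B u‖²) A u = 0` on `[0, T]`, with `u' = u₁`, `u'' = u₂`,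
`B u = ξ`, `B u' = ζ` and `A u = η`. -/
structure IsStrongSolution (A B : H →ₗ.[ℝ] H) (m b : ℝ → ℝ) (ε T : ℝ) (u u₁ u₂ ξ ζ η : ℝ → H) :
    Prop where
  deriv : ∀ t ∈ Icc 0 T, HasDerivWithinAt u (u₁ t) (Icc 0 T) t
  deriv₂ : ∀ t ∈ Icc 0 T, HasDerivWithinAt u₁ (u₂ t) (Icc 0 T) t
  continuousOn_deriv₂ : ContinuousOn u₂ (Icc 0 T)
  mem_sqrt : ∀ t ∈ Icc 0 T, (u t, ξ t) ∈ B.graph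
  mem_sqrt_deriv : ∀ t ∈ Icc 0 T, (u₁ t, ζ t) ∈ B.graph
  deriv_sqrt : ∀ t ∈ Icc 0 T, HasDerivWithinAt ξ (ζ t) (Icc 0 T) t
  continuousOn_deriv_sqrt : ContinuousOn ζ (Icc 0 T)
  mem_graph : ∀ t ∈ Icc 0 T, (u t, η t) ∈ A.graph
  continuousOn : ContinuousOn η (Icc 0 T)
  equation : ∀ t ∈ Icc 0 T, ε • u₂ t + b t • u₁ t + m (‖ξ t‖ ^ 2) • η t = 0

theorem IsWeakSolution.continuousOn_coeff {A B : H →ₗ.[ℝ] H} {m b : ℝ → ℝ}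
    {ε T c₀ M : ℝ} {u u₁ ξ : ℝ → H}
    (h : IsWeakSolution A B m b ε T c₀ M u u₁ ξ) :
    ContinuousOn (fun t => m (‖ξ t‖ ^ 2)) (Icc 0 T) :=
  (LipschitzOnWith.of_dist_le' (K := M) h.lipschitz_coeff).continuousOn

variable [CompleteSpace H] {A B : H →ₗ.[ℝ] H}

theorem IsYosida.sqrt_comm (hB : IsSqrt A B) {l : ℝ} {J W Y : H →L[ℝ] H}
    (h : IsYosida A B l J W Y) (x : H) : W (J x) = J (W x) :=
  h.sqrt_eq hB (h.mem_left x)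

theorem IsYosida.yosida_comm (hB : IsSqrt A B) {l : ℝ} {J W Y : H →L[ℝ] H}
    (h : IsYosida A B l J W Y) (x : H) : Y (J x) = J (Y x) :=
  h.yosida_eq (h.mem_graph hB x)

namespace IsWeakSolution

variable {m b : ℝ → ℝ} {ε T c₀ M : ℝ} {u u₁ ξ : ℝ → H}

/-- Applying the bounded operator J + Y to the equation tested with R passes from the resolvent at
-1 to any other, because (J + Y)R = J. -/
theorem hasDerivWithinAt_resolvent (hA : IsNonnegSelfAdjoint A) (hB : IsSqrt A B)
    (h : IsWeakSolution A B m b ε T c₀ M u u₁ ξ) {l : ℝ} {J W Y : H →L[ℝ] H}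
    (hy : IsYosida A B l J W Y) {t : ℝ} (ht : t ∈ Icc 0 T) :
    HasDerivWithinAt (fun t => J (u₁ t))
      (-(ε⁻¹ • (b t • J (u₁ t) + m (‖ξ t‖ ^ 2) • Y (u t)))) (Icc 0 T) t := by
  obtain ⟨R, V, Z, hR⟩ := exists_isYosida hA hB one_pos
  have h1 := (J + Y).hasFDerivAt.comp_hasDerivWithinAt t (h.equation R V Z hR t ht)
  have hf : ∀ x, (J + Y) (R x) = J x := hy.add_apply_resolvent hB hR
  have h2 : (fun t => J (u₁ t)) = (J + Y) ∘ fun t => R (u₁ t) := funext fun s => (hf _).symm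
  have h3 : -(ε⁻¹ • (b t • J (u₁ t) + m (‖ξ t‖ ^ 2) • Y (u t))) =
      (J + Y) (-(ε⁻¹ • (b t • R (u₁ t) + m (‖ξ t‖ ^ 2) • (u t - R (u t))))) := by
    simp only [map_neg, map_smul, map_add, map_sub, hf]
    rw [add_apply, add_sub_cancel_left]
  rw [h2, h3]
  exact h1

/-- Difference of two regularizations of a weak solution. -/
theorem regularization_difference_le (hA : IsNonnegSelfAdjoint A) (hB : IsSqrt A B)
    (h : IsWeakSolution A B m b ε T c₀ M u u₁ ξ) (hT : 0 ≤ T) (hε : 0 < ε) (hc₀ : 0 < c₀)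
    (hM : 0 ≤ M) (hb : ∀ t ∈ Icc 0 T, 0 ≤ b t) {l l' : ℝ} {J W Y J' W' Y' : H →L[ℝ] H}
    (hy : IsYosida A B l J W Y) (hy' : IsYosida A B l' J' W' Y') :
    ∀ t ∈ Icc 0 T, ε * (‖W (J (u₁ t)) - W' (J' (u₁ t))‖ ^ 2 / m (‖ξ t‖ ^ 2)) +
        ‖J (Y (u t)) - J' (Y' (u t))‖ ^ 2 ≤
      (ε * (‖W (J (u₁ 0)) - W' (J' (u₁ 0))‖ ^ 2 / m (‖ξ 0‖ ^ 2)) +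
        ‖J (Y (u 0)) - J' (Y' (u 0))‖ ^ 2) * Real.exp ((1 / ε + M / c₀) * t) := by
  have huc : ContinuousOn u (Icc 0 T) := fun t ht => (h.deriv t ht).continuousWithinAt
  have hgc : ContinuousOn (fun t => W (Y (u t)) - W' (Y' (u t))) (Icc 0 T) :=
    ((W ∘L Y).continuous.comp_continuousOn huc).sub ((W' ∘L Y').continuous.comp_continuousOn huc)
  -- K may blow up as l, l' → 0; this is harmless, since the conclusion of `energy_le` does not
  -- involve it.
  obtain ⟨K, hK⟩ := isCompact_Icc.exists_bound_of_continuousOn hgc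
  have hGd : ∀ t ∈ Icc 0 T, HasDerivWithinAt (fun t => J (Y (u t)) - J' (Y' (u t)))
      (J (Y (u₁ t)) - J' (Y' (u₁ t))) (Icc 0 T) t := fun t ht =>
    ((J ∘L Y).hasFDerivAt.comp_hasDerivWithinAt t (h.deriv t ht)).sub
      ((J' ∘L Y').hasFDerivAt.comp_hasDerivWithinAt t (h.deriv t ht))
  have hwd : ∀ t ∈ Icc 0 T, HasDerivWithinAt (fun t => W (J (u₁ t)) - W' (J' (u₁ t)))
      (W (-(ε⁻¹ • (b t • J (u₁ t) + m (‖ξ t‖ ^ 2) • Y (u t)))) -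
        W' (-(ε⁻¹ • (b t • J' (u₁ t) + m (‖ξ t‖ ^ 2) • Y' (u t))))) (Icc 0 T) t := fun t ht =>
    (W.hasFDerivAt.comp_hasDerivWithinAt t (h.hasDerivWithinAt_resolvent hA hB hy ht)).sub
      (W'.hasFDerivAt.comp_hasDerivWithinAt t (h.hasDerivWithinAt_resolvent hA hB hy' ht))
  have heq : ∀ t ∈ Icc 0 T, ε • (W (-(ε⁻¹ • (b t • J (u₁ t) + m (‖ξ t‖ ^ 2) • Y (u t)))) -
        W' (-(ε⁻¹ • (b t • J' (u₁ t) + m (‖ξ t‖ ^ 2) • Y' (u t))))) +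
      b t • (W (J (u₁ t)) - W' (J' (u₁ t))) + m (‖ξ t‖ ^ 2) • (W (Y (u t)) - W' (Y' (u t))) =
        0 := by
    intro t _
    simp only [map_neg, map_smul, map_add]
    rw [smul_sub, smul_neg, smul_neg, smul_inv_smul₀ hε.ne', smul_inv_smul₀ hε.ne', smul_sub,
      smul_sub]
    abel
  -- The three quantities are differences of A^{1/2}J²u', AJ²u and A^{3/2}J²u; one factor A^{1/2}
  -- moves from the derivative of the second to the second.
  have hGi : ∀ t ∈ Icc 0 T,
      2 * ⟪J (Y (u t)) - J' (Y' (u t)), J (Y (u₁ t)) - J' (Y' (u₁ t))⟫ ≤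
        2 * ⟪W (Y (u t)) - W' (Y' (u t)), W (J (u₁ t)) - W' (J' (u₁ t))⟫ + 0 := by
    intro t _
    rw [add_zero, ← hy.yosida_comm hB (u₁ t), ← hy'.yosida_comm hB (u₁ t)]
    exact (congrArg (2 * ·) (inner_symm_of_isSelfAdjoint hB.1.1
      (graph_sub (hy.mem_left (Y (u t))) (hy'.mem_left (Y' (u t))))
      (graph_sub (hy.mem_right (J (u₁ t))) (hy'.mem_right (J' (u₁ t)))))).ge
  intro t ht
  have key := energy_le (C := 0) (δ := 0) hT hε hc₀ le_rfl le_rfl hwd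
    (fun t ht => (hGd t ht).norm_sq) h.lipschitz_coeff heq hb h.le_coeff hM
    (fun t _ => sq_nonneg _) hGi (fun t _ => by simp) hK t ht
  simpa using key

theorem exists_isStrongSolution (hA : IsNonnegSelfAdjoint A) (hB : IsSqrt A B)
    (h : IsWeakSolution A B m b ε T c₀ M u u₁ ξ) (hT : 0 ≤ T) (hε : 0 < ε) (hc₀ : 0 < c₀)
    (hM : 0 ≤ M) (hbc : ContinuousOn b (Icc 0 T)) (hb : ∀ t ∈ Icc 0 T, 0 ≤ b t) {z₀ η₀ : H}
    (hz₀ : (u 0, z₀) ∈ A.graph) (hη₀ : (u₁ 0, η₀) ∈ B.graph) :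
    ∃ u₂ ζ η : ℝ → H, IsStrongSolution A B m b ε T u u₁ u₂ ξ ζ η := by
  have h0 : (0 : ℝ) ∈ Icc 0 T := left_mem_Icc.2 hT
  have huc : ContinuousOn u (Icc 0 T) := fun t ht => (h.deriv t ht).continuousWithinAt
  choose J W Y hy using fun n : ℕ => exists_isYosida hA hB (l := 1 / ((n : ℝ) + 1)) (by positivity)
  have hl := tendsto_one_div_add_atTop_nhds_zero_nat (𝕜 := ℝ)
  have hJJ : ∀ x, Tendsto (fun n => J n (J n x)) atTop (𝓝 x) := fun x =>
    tendsto_resolvent_of_tendsto hA hy hl (tendsto_resolvent hA hy hl x)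
  obtain ⟨C, hC⟩ := isCompact_Icc.exists_bound_of_continuousOn h.continuousOn_coeff
  have hcp : ∀ t ∈ Icc 0 T, 0 < m (‖ξ t‖ ^ 2) := fun t ht => hc₀.trans_le (h.le_coeff t ht)
  have hcC : ∀ t ∈ Icc 0 T, m (‖ξ t‖ ^ 2) ≤ C := fun t ht => (le_abs_self _).trans (hC t ht)
  have hW0 : ∀ n, W n (J n (u₁ 0)) = J n (J n η₀) := fun n => by
    rw [(hy n).sqrt_comm hB, (hy n).sqrt_eq hB hη₀]
  have hY0 : ∀ n, J n (Y n (u 0)) = J n (J n z₀) := fun n => by rw [(hy n).yosida_eq hz₀]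
  -- The initial energy of the differences tends to 0 precisely because u(0) ∈ D(A) and u'(0) ∈
  -- D(A^{1/2}): the regularized data are J²η₀ and J²z₀.
  set φ : ℕ × ℕ → ℝ := fun p =>
    (ε * (‖W p.1 (J p.1 (u₁ 0)) - W p.2 (J p.2 (u₁ 0))‖ ^ 2 / m (‖ξ 0‖ ^ 2)) +
        ‖J p.1 (Y p.1 (u 0)) - J p.2 (Y p.2 (u 0))‖ ^ 2) * Real.exp ((1 / ε + M / c₀) * T) with hφ
  have hφ0 : Tendsto φ atTop (𝓝 0) := by
    rw [← prod_atTop_atTop_eq, hφ]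
    simp_rw [hW0, hY0]
    have h1 := ((hJJ η₀).comp tendsto_fst).sub
      ((hJJ η₀).comp (tendsto_snd (f := (atTop : Filter ℕ)) (g := (atTop : Filter ℕ))))
    have h2 := ((hJJ z₀).comp tendsto_fst).sub
      ((hJJ z₀).comp (tendsto_snd (f := (atTop : Filter ℕ)) (g := (atTop : Filter ℕ))))
    have h3 := ((((h1.norm.pow 2).div_const (m (‖ξ 0‖ ^ 2))).const_mul ε).add
      (h2.norm.pow 2)).mul_const (Real.exp ((1 / ε + M / c₀) * T))
    simpa using h3
  have hdiff : ∀ n j, ∀ t ∈ Icc 0 T,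
      ε * (‖W n (J n (u₁ t)) - W j (J j (u₁ t))‖ ^ 2 / m (‖ξ t‖ ^ 2)) +
        ‖J n (Y n (u t)) - J j (Y j (u t))‖ ^ 2 ≤ φ (n, j) := by
    intro n j t ht
    refine (h.regularization_difference_le hA hB hT hε hc₀ hM hb (hy n) (hy j) t ht).trans ?_
    have := hcp 0 h0
    exact mul_le_mul_of_nonneg_left (Real.exp_le_exp.2
      (mul_le_mul_of_nonneg_left ht.2 (by positivity))) (by positivity)
  have hdiffW : ∀ n j, ∀ t ∈ Icc 0 T,
      ‖W n (J n (u₁ t)) - W j (J j (u₁ t))‖ ^ 2 ≤ C / ε * φ (n, j) := by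
    intro n j t ht
    have h2 := hcp t ht
    have h3 : ‖W n (J n (u₁ t)) - W j (J j (u₁ t))‖ ^ 2 / m (‖ξ t‖ ^ 2) ≤ φ (n, j) / ε := by
      rw [le_div_iff₀' hε]
      linarith [hdiff n j t ht, sq_nonneg ‖J n (Y n (u t)) - J j (Y j (u t))‖]
    have h4 : 0 ≤ φ (n, j) / ε := le_trans (by positivity) h3
    rw [div_le_iff₀ h2] at h3
    refine (h3.trans (mul_le_mul_of_nonneg_left (hcC t ht) h4)).trans (le_of_eq ?_)
    ring
  have hdiffY : ∀ n j, ∀ t ∈ Icc 0 T, ‖J n (Y n (u t)) - J j (Y j (u t))‖ ^ 2 ≤ φ (n, j) := by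
    intro n j t ht
    have h2 := hcp t ht
    have h3 : 0 ≤ ε * (‖W n (J n (u₁ t)) - W j (J j (u₁ t))‖ ^ 2 / m (‖ξ t‖ ^ 2)) := by positivity
    linarith [hdiff n j t ht]
  have hWc : ∀ n, ContinuousOn (fun t => W n (J n (u₁ t))) (Icc 0 T) := fun n =>
    (W n ∘L J n).continuous.comp_continuousOn h.continuousOn_deriv
  have hYc : ∀ n, ContinuousOn (fun t => J n (Y n (u t))) (Icc 0 T) := fun n =>
    (J n ∘L Y n).continuous.comp_continuousOn huc
  have hJc : ∀ n, ContinuousOn (fun t => J n (J n (u₁ t))) (Icc 0 T) := fun n =>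
    (J n ∘L J n).continuous.comp_continuousOn h.continuousOn_deriv
  obtain ⟨ζ, hζc, hζ, Cζ, hCζ, -⟩ := exists_limit_of_uniformCauchy hWc
    (by simpa using hφ0.const_mul (C / ε)) hdiffW
  obtain ⟨η, hηc, hη, Cη, hCη, -⟩ := exists_limit_of_uniformCauchy hYc hφ0 hdiffY
  have hu₂c : ContinuousOn (fun t => -(ε⁻¹ • (b t • u₁ t + m (‖ξ t‖ ^ 2) • η t))) (Icc 0 T) :=
    (((hbc.smul h.continuousOn_deriv).add (h.continuousOn_coeff.smul hηc)).const_smul _).neg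
  refine ⟨fun t => -(ε⁻¹ • (b t • u₁ t + m (‖ξ t‖ ^ 2) • η t)), ζ, η, h.deriv, ?_, hu₂c,
    h.mem_graph, fun t ht => ?_, ?_, hζc, fun t ht => ?_, hηc, fun t _ => ?_⟩
  · obtain ⟨Cb, hCb⟩ := isCompact_Icc.exists_bound_of_continuousOn hbc
    obtain ⟨C₁, hC₁⟩ := isCompact_Icc.exists_bound_of_continuousOn h.continuousOn_deriv
    -- A second J is applied so that the derivative contains J Y u, which is known to converge to η.
    have hd : ∀ n, ∀ t ∈ Icc 0 T, HasDerivWithinAt (fun t => J n (J n (u₁ t)))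
        (-(ε⁻¹ • (b t • J n (J n (u₁ t)) + m (‖ξ t‖ ^ 2) • J n (Y n (u t))))) (Icc 0 T) t := by
      intro n t ht
      have := (J n).hasFDerivAt.comp_hasDerivWithinAt t
        (h.hasDerivWithinAt_resolvent hA hB (hy n) ht)
      simp only [map_neg, map_smul, map_add] at this
      exact this
    have hbd : ∀ᶠ n in atTop, ∀ t ∈ Icc 0 T,
        ‖-(ε⁻¹ • (b t • J n (J n (u₁ t)) + m (‖ξ t‖ ^ 2) • J n (Y n (u t))))‖ ≤
          ε⁻¹ * (Cb * C₁ + C * Cη) := by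
      filter_upwards [hCη] with n hn t ht
      rw [norm_neg, norm_smul, Real.norm_of_nonneg (inv_pos.2 hε).le]
      refine mul_le_mul_of_nonneg_left ((norm_add_le _ _).trans (add_le_add ?_ ?_))
        (inv_pos.2 hε).le
      · rw [norm_smul]
        exact mul_le_mul (hCb t ht) (((hy n).norm_le _).trans (((hy n).norm_le _).trans (hC₁ t ht)))
          (norm_nonneg _) ((norm_nonneg _).trans (hCb t ht))
      · rw [norm_smul]
        exact mul_le_mul (hC t ht) (hn t ht) (norm_nonneg _) ((norm_nonneg _).trans (hC t ht))
    refine hasDerivWithinAt_of_tendsto hT hd (fun n => ?_) hu₂c (fun t _ => hJJ _)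
      (fun t ht => ?_) hbd
    · exact (((hbc.smul (hJc n)).add (h.continuousOn_coeff.smul (hYc n))).const_smul _).neg
    · exact ((((hJJ _).const_smul _).add ((hη t ht).const_smul _)).const_smul _).neg
  · exact mem_graph_of_tendsto hB.1.1 (fun n => (hy n).mem_left (J n (u₁ t))) (hJJ _) (hζ t ht)
  · refine hasDerivWithinAt_of_tendsto hT
      (fun n t ht => (W n ∘L J n).hasFDerivAt.comp_hasDerivWithinAt t (h.deriv t ht)) hWc hζc
      (fun t ht => ?_) hζ hCζ
    refine (hJJ (ξ t)).congr fun n => ?_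
    change _ = W n (J n (u t))
    rw [(hy n).sqrt_comm hB, (hy n).sqrt_eq hB (h.mem_graph t ht)]
  · refine mem_graph_of_tendsto hA.1 (fun n => ?_) (hJJ (u t)) (hη t ht)
    rw [← (hy n).yosida_comm hB]
    exact (hy n).mem_graph hB (J n (u t))
  · rw [smul_neg, smul_inv_smul₀ hε.ne']
    abel

end IsWeakSolution

/-- Uniqueness, if the coefficient `m(‖B u‖²)` of one of the two solutions is positive. -/
theorem IsStrongSolution.eqOn (hB : IsSqrt A B) {m b : ℝ → ℝ} {ε T c₀ M : ℝ}
    {u u₁ u₂ ξ ζ η v v₁ v₂ ξ' ζ' η' : ℝ → H} (hT : 0 ≤ T) (hε : 0 < ε) (hc₀ : 0 < c₀) (hM : 0 ≤ M)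
    (hm : LocallyLipschitzOn (Ici 0) m) (hb : ∀ t ∈ Icc 0 T, 0 ≤ b t)
    (hu : IsStrongSolution A B m b ε T u u₁ u₂ ξ ζ η)
    (hv : IsStrongSolution A B m b ε T v v₁ v₂ ξ' ζ' η')
    (hc : ∀ s ∈ Icc 0 T, ∀ t ∈ Icc 0 T, |m (‖ξ s‖ ^ 2) - m (‖ξ t‖ ^ 2)| ≤ M * |s - t|)
    (hcc : ∀ t ∈ Icc 0 T, c₀ ≤ m (‖ξ t‖ ^ 2)) (h0 : u 0 = v 0) (h1 : u₁ 0 = v₁ 0) :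
    EqOn v u (Icc 0 T) := by
  have hmem0 : (0 : ℝ) ∈ Icc 0 T := left_mem_Icc.2 hT
  have hξ0 : ξ 0 = ξ' 0 :=
    graph_unique (hu.mem_sqrt 0 hmem0) (h0 ▸ hv.mem_sqrt 0 hmem0)
  have hξc : ContinuousOn ξ (Icc 0 T) := fun t ht => (hu.deriv_sqrt t ht).continuousWithinAt
  have hξc' : ContinuousOn ξ' (Icc 0 T) := fun t ht => (hv.deriv_sqrt t ht).continuousWithinAt
  obtain ⟨S₁, hS₁⟩ := isCompact_Icc.exists_bound_of_continuousOn hξc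
  obtain ⟨S₂, hS₂⟩ := isCompact_Icc.exists_bound_of_continuousOn hξc'
  obtain ⟨K₁, hK₁⟩ := isCompact_Icc.exists_bound_of_continuousOn hu.continuousOn
  obtain ⟨K₂, hK₂⟩ := isCompact_Icc.exists_bound_of_continuousOn hv.continuousOn
  set S := max S₁ S₂ with hS
  have hS0 : 0 ≤ S := ((norm_nonneg _).trans (hS₁ 0 hmem0)).trans (le_max_left _ _)
  have hK₂0 : 0 ≤ K₂ := (norm_nonneg _).trans (hK₂ 0 hmem0)
  have hξS : ∀ t ∈ Icc 0 T, ‖ξ t‖ ≤ S := fun t ht => (hS₁ t ht).trans (le_max_left _ _)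
  have hξS' : ∀ t ∈ Icc 0 T, ‖ξ' t‖ ≤ S := fun t ht => (hS₂ t ht).trans (le_max_right _ _)
  have hsub : Icc 0 (S ^ 2) ⊆ Ici 0 := Icc_subset_Ici_self
  obtain ⟨L, hL⟩ := (hm.mono hsub).exists_lipschitzOnWith_of_compact isCompact_Icc
  have hL0 : (0 : ℝ) ≤ L := L.2
  -- Au = B(Bu), needed to move B across in ⟪ξ - ξ', ζ - ζ'⟫.
  have hB' : ∀ {w : ℝ → H} {w₁ w₂ α β γ : ℝ → H}, IsStrongSolution A B m b ε T w w₁ w₂ α β γ →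
      ∀ t ∈ Icc 0 T, (α t, γ t) ∈ B.graph := by
    intro w w₁ w₂ α β γ hw t ht
    obtain ⟨z, hz1, hz2⟩ := (hB.2 _ _).1 (hw.mem_graph t ht)
    rwa [graph_unique (hw.mem_sqrt t ht) hz1]
  have hGd : ∀ t ∈ Icc 0 T, 2 * ⟪ξ t - ξ' t, ζ t - ζ' t⟫ ≤ 2 * ⟪η t - η' t, u₁ t - v₁ t⟫ + 0 := by
    intro t ht
    rw [add_zero]
    exact (congrArg (2 * ·) (inner_symm_of_isSelfAdjoint hB.1.1
      (graph_sub (hB' hu t ht) (hB' hv t ht))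
      (graph_sub (hu.mem_sqrt_deriv t ht) (hv.mem_sqrt_deriv t ht)))).ge
  have heq : ∀ t ∈ Icc 0 T, ε • (u₂ t - v₂ t) + b t • (u₁ t - v₁ t) +
      m (‖ξ t‖ ^ 2) • (η t - η' t) = -((m (‖ξ t‖ ^ 2) - m (‖ξ' t‖ ^ 2)) • η' t) := by
    intro t ht
    rw [← sub_eq_zero]
    calc _ = (ε • u₂ t + b t • u₁ t + m (‖ξ t‖ ^ 2) • η t) -
          (ε • v₂ t + b t • v₁ t + m (‖ξ' t‖ ^ 2) • η' t) := by
          simp only [smul_sub, sub_smul]; abel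
      _ = 0 := by rw [hu.equation t ht, hv.equation t ht, sub_zero]
  have hr : ∀ t ∈ Icc 0 T, ‖-((m (‖ξ t‖ ^ 2) - m (‖ξ' t‖ ^ 2)) • η' t)‖ ^ 2 ≤
      (L * (2 * S) * K₂) ^ 2 * ‖ξ t - ξ' t‖ ^ 2 + 0 := by
    intro t ht
    rw [add_zero, ← mul_pow, norm_neg, norm_smul]
    refine pow_le_pow_left₀ (by positivity) ?_ 2
    have i1 : |m (‖ξ t‖ ^ 2) - m (‖ξ' t‖ ^ 2)| ≤ L * |‖ξ t‖ ^ 2 - ‖ξ' t‖ ^ 2| :=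
      hL.dist_le_mul _ ⟨by positivity, pow_le_pow_left₀ (norm_nonneg _) (hξS t ht) 2⟩ _
        ⟨by positivity, pow_le_pow_left₀ (norm_nonneg _) (hξS' t ht) 2⟩
    have i2 : |‖ξ t‖ ^ 2 - ‖ξ' t‖ ^ 2| ≤ 2 * S * ‖ξ t - ξ' t‖ := by
      rw [sq_sub_sq, abs_mul, abs_of_nonneg (by positivity : 0 ≤ ‖ξ t‖ + ‖ξ' t‖)]
      exact mul_le_mul (by linarith [hξS t ht, hξS' t ht]) (abs_norm_sub_norm_le _ _)
        (abs_nonneg _) (by positivity)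
    calc _ ≤ (L * (2 * S * ‖ξ t - ξ' t‖)) * K₂ :=
          mul_le_mul (i1.trans (mul_le_mul_of_nonneg_left i2 hL0)) (hK₂ t ht) (norm_nonneg _)
            (by positivity)
      _ = _ := by ring
  -- Only the coefficient of u multiplies the difference; that of v enters through r, controlled by
  -- the energy. With δ = 0 and equal data the right-hand side is zero.
  have key := energy_le (K := K₁ + K₂) hT hε hc₀ (sq_nonneg (L * (2 * S) * K₂)) le_rfl
    (fun t ht => (hu.deriv₂ t ht).sub (hv.deriv₂ t ht))
    (fun t ht => ((hu.deriv_sqrt t ht).sub (hv.deriv_sqrt t ht)).norm_sq) hc heq hb hcc hM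
    (fun t _ => sq_nonneg _) hGd hr
    (fun t ht => (norm_sub_le _ _).trans (add_le_add (hK₁ t ht) (hK₂ t ht)))
  have hderiv : ∀ t ∈ Icc 0 T, u₁ t = v₁ t := by
    intro t ht
    have h2 := key t ht
    simp only [Pi.sub_apply, h1, hξ0, sub_self, norm_zero, ne_eq, OfNat.ofNat_ne_zero,
      not_false_eq_true, zero_pow, zero_div, mul_zero, add_zero, zero_mul] at h2
    have h3 := hc₀.trans_le (hcc t ht)
    have h4 : ‖u₁ t - v₁ t‖ ^ 2 / m (‖ξ t‖ ^ 2) ≤ 0 := by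
      have h5 : 0 ≤ ‖ξ t - ξ' t‖ ^ 2 := sq_nonneg _
      exact nonpos_of_mul_nonpos_right (by linarith) hε
    rw [div_le_iff₀ h3, zero_mul] at h4
    have h6 : ‖u₁ t - v₁ t‖ ^ 2 = 0 := le_antisymm h4 (sq_nonneg _)
    simpa [sub_eq_zero] using h6
  intro t ht
  have hcont : ContinuousOn u₁ (Icc 0 T) := fun t ht => (hu.deriv₂ t ht).continuousWithinAt
  have hv' : ∀ t ∈ Icc 0 T, HasDerivWithinAt v (u₁ t) (Icc 0 T) t := fun t ht => by
    rw [hderiv t ht]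
    exact hv.deriv t ht
  rw [eq_add_integral hu.deriv hcont ht, eq_add_integral hv' hcont ht, h0]

end Regularity

/-! ### Translation to the function spaces of the statement -/

section Translation

theorem contDiffOn_one_of_hasDerivWithinAt {F : Type*} [NormedAddCommGroup F] [NormedSpace ℝ F]
    {T : ℝ} (hT : 0 < T) {f f' : ℝ → F}
    (h : ∀ t ∈ Icc 0 T, HasDerivWithinAt f (f' t) (Icc 0 T) t) (hc : ContinuousOn f' (Icc 0 T)) :
    ContDiffOn ℝ 1 f (Icc 0 T) :=
  (contDiffOn_one_iff_derivWithin (uniqueDiffOn_Icc hT)).2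
    ⟨fun t ht => (h t ht).differentiableWithinAt,
      hc.congr fun t ht => (h t ht).derivWithin (uniqueDiffOn_Icc hT t ht)⟩

theorem contDiffOn_two_of_hasDerivWithinAt {F : Type*} [NormedAddCommGroup F] [NormedSpace ℝ F]
    {T : ℝ} (hT : 0 < T) {f f' f'' : ℝ → F}
    (h : ∀ t ∈ Icc 0 T, HasDerivWithinAt f (f' t) (Icc 0 T) t)
    (h' : ∀ t ∈ Icc 0 T, HasDerivWithinAt f' (f'' t) (Icc 0 T) t)
    (hc : ContinuousOn f'' (Icc 0 T)) : ContDiffOn ℝ 2 f (Icc 0 T) := by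
  have h1 : ContDiffOn ℝ (1 + 1) f (Icc 0 T) :=
    (contDiffOn_succ_iff_derivWithin (uniqueDiffOn_Icc hT)).2
      ⟨fun t ht => (h t ht).differentiableWithinAt, by simp,
        (contDiffOn_one_of_hasDerivWithinAt hT h' hc).congr fun t ht =>
          (h t ht).derivWithin (uniqueDiffOn_Icc hT t ht)⟩
  rwa [one_add_one_eq_two] at h1

variable {H : Type*} [NormedAddCommGroup H] [InnerProductSpace ℝ H]

theorem opApply_eq {B : H →ₗ.[ℝ] H} {x z : H} (h : (x, z) ∈ B.graph) : opApply B x = z := by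
  obtain ⟨a, ha, hz⟩ := (LinearPMap.mem_graph_iff B).1 h
  have ha' : (a : H) = x := ha
  subst ha'
  rw [opApply, dif_pos a.2]
  exact hz

theorem mem_graph_opApply {B : H →ₗ.[ℝ] H} {x : H} (h : x ∈ B.domain) :
    (x, opApply B x) ∈ B.graph := by
  rw [opApply, dif_pos h]
  exact B.mem_graph ⟨x, h⟩

variable [CompleteSpace H]

/-- Smoothness into the graph reduces to smoothness into H: y ↦ (R y, y - R y) is a bounded linear
map from H into the graph, and it sends u + Bu to (u, Bu). -/
theorem contDiffOnIntoDomain_of_mem_graph {B : H →ₗ.[ℝ] H} (hB : IsNonnegSelfAdjoint B) {n : ℕ}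
    {u ξ : ℝ → H} {s : Set ℝ} (hu : ContDiffOn ℝ n u s) (hξ : ContDiffOn ℝ n ξ s)
    (h : ∀ t ∈ s, (u t, ξ t) ∈ B.graph) : ContDiffOnIntoDomain B n u s := by
  obtain ⟨R, -, -, -, hgr⟩ := exists_resolvent hB
  let Θ : H →L[ℝ] B.graph := (R.prod (ContinuousLinearMap.id ℝ H - R)).codRestrict B.graph
    fun y => (hgr _ _).2 ⟨y, rfl, rfl⟩
  refine ⟨fun t => Θ (u t + ξ t), Θ.contDiff.comp_contDiffOn (hu.add hξ), fun t ht => ?_⟩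
  obtain ⟨y, h1, h2⟩ := (hgr _ _).1 (h t ht)
  change R (u t + ξ t) = u t
  rw [h2, h1, add_sub_cancel]

variable {A : H →ₗ.[ℝ] H} {m b : ℝ → ℝ} {ε T : ℝ}

theorem IsStrongSolution.isKirchhoffSolution (hA : IsNonnegSelfAdjoint A) (hT : 0 < T)
    {u u₁ u₂ ξ ζ η : ℝ → H}
    (h : IsStrongSolution A (sqrtOp A) m b ε T u u₁ u₂ ξ ζ η) :
    IsKirchhoffSolution A m b ε T (u 0) (u₁ 0) u := by
  have hd : ∀ t ∈ Icc 0 T, derivWithin u (Icc 0 T) t = u₁ t := fun t ht =>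
    (h.deriv t ht).derivWithin (uniqueDiffOn_Icc hT t ht)
  have hd₂ : ∀ t ∈ Icc 0 T, derivWithin (derivWithin u (Icc 0 T)) (Icc 0 T) t = u₂ t :=
    fun t ht => ((h.deriv₂ t ht).congr hd (hd t ht)).derivWithin (uniqueDiffOn_Icc hT t ht)
  have huc : ContinuousOn u₁ (Icc 0 T) := fun t ht => (h.deriv₂ t ht).continuousWithinAt
  have hu1 := contDiffOn_one_of_hasDerivWithinAt hT h.deriv huc
  refine ⟨contDiffOn_two_of_hasDerivWithinAt hT h.deriv h.deriv₂ h.continuousOn_deriv₂, ?_, ?_,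
    fun t ht => ?_, rfl, hd 0 (left_mem_Icc.2 hT.le)⟩
  · refine contDiffOnIntoDomain_of_mem_graph (sqrtOp_spec hA).1 ?_ ?_ h.mem_sqrt
    · exact_mod_cast hu1
    · exact_mod_cast contDiffOn_one_of_hasDerivWithinAt hT h.deriv_sqrt h.continuousOn_deriv_sqrt
  · refine contDiffOnIntoDomain_of_mem_graph hA ?_ ?_ h.mem_graph
    · exact_mod_cast contDiffOn_zero.2 hu1.continuousOn
    · exact_mod_cast contDiffOn_zero.2 h.continuousOn
  · rw [hd₂ t ht, hd t ht, opApply_eq (h.mem_sqrt t ht), opApply_eq (h.mem_graph t ht)]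
    exact h.equation t ht

/-- The derivative of a curve in the graph is again in the graph. Its first component is u', so u' ∈
D(A^{1/2}) and A^{1/2}u' is the derivative of A^{1/2}u. -/
theorem IsKirchhoffSolution.exists_isStrongSolution (hT : 0 < T) {u₀ v₀ : H} {u : ℝ → H}
    (h : IsKirchhoffSolution A m b ε T u₀ v₀ u) :
    ∃ u₁ u₂ ξ ζ η : ℝ → H, IsStrongSolution A (sqrtOp A) m b ε T u u₁ u₂ ξ ζ η ∧
      u 0 = u₀ ∧ u₁ 0 = v₀ := by
  have hI := uniqueDiffOn_Icc hT
  have h2 : ContDiffOn ℝ (1 + 1) u (Icc 0 T) := by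
    rw [one_add_one_eq_two]; exact h.contDiffOn_two
  obtain ⟨hu, -, hu₁⟩ := (contDiffOn_succ_iff_derivWithin hI).1 h2
  obtain ⟨hu₁, hu₂⟩ := (contDiffOn_one_iff_derivWithin hI).1 hu₁
  obtain ⟨p, hp, hpu⟩ := h.contDiffOn_one
  obtain ⟨q, hq, hqu⟩ := h.contDiffOn_zero
  rw [Nat.cast_one] at hp
  rw [Nat.cast_zero, _root_.contDiffOn_zero] at hq
  obtain ⟨hp, hp'⟩ := (contDiffOn_one_iff_derivWithin hI).1 hp
  set p' := derivWithin p (Icc 0 T)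
  have hpu' : ∀ t ∈ Icc 0 T, (u t, (p t : H × H).2) ∈ (sqrtOp A).graph := fun t ht => by
    rw [← hpu t ht]; exact (p t).2
  have hqu' : ∀ t ∈ Icc 0 T, (u t, (q t : H × H).2) ∈ A.graph := fun t ht => by
    rw [← hqu t ht]; exact (q t).2
  have hpd : ∀ t ∈ Icc 0 T, HasDerivWithinAt (fun t => (p t : H × H))
      (p' t : H × H) (Icc 0 T) t := fun t ht =>
    (sqrtOp A).graph.subtypeL.hasFDerivAt.comp_hasDerivWithinAt t (hp t ht).hasDerivWithinAt
  refine ⟨derivWithin u (Icc 0 T), derivWithin (derivWithin u (Icc 0 T)) (Icc 0 T),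
    fun t => (p t : H × H).2, fun t => (p' t : H × H).2,
    fun t => (q t : H × H).2, ⟨fun t ht => (hu t ht).hasDerivWithinAt,
      fun t ht => (hu₁ t ht).hasDerivWithinAt, hu₂, hpu', fun t ht => ?_, fun t ht => ?_, ?_,
      hqu', ?_, fun t ht => ?_⟩, h.initial, h.initial_deriv⟩
  · have h3 : HasDerivWithinAt u (p' t : H × H).1 (Icc 0 T) t :=
      ((hasFDerivAt_fst (𝕜 := ℝ)).comp_hasDerivWithinAt t (hpd t ht)).congr
        (fun s hs => (hpu s hs).symm) (hpu t ht).symm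
    rw [h3.derivWithin (hI t ht)]
    exact (p' t).2
  · exact (hasFDerivAt_snd (𝕜 := ℝ)).comp_hasDerivWithinAt t (hpd t ht)
  · exact (continuous_snd.comp continuous_subtype_val).comp_continuousOn hp'
  · exact (continuous_snd.comp continuous_subtype_val).comp_continuousOn hq
  · have h3 := h.equation t ht
    rwa [opApply_eq (hpu' t ht), opApply_eq (hqu' t ht)] at h3

end Translation
end Kirchhoff

theorem theorem3p1 {H : Type*} [NormedAddCommGroup H] [InnerProductSpace ℝ H] [CompleteSpace H]
    (A : H →ₗ.[ℝ] H) (hA : Kirchhoff.IsNonnegSelfAdjoint A)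
    (m b : ℝ → ℝ)
    (hm : LocallyLipschitzOn (Set.Ici 0) m) (hm_nonneg : ∀ σ : ℝ, 0 ≤ σ → 0 ≤ m σ)
    (hb : LocallyLipschitzOn (Set.Ici 0) b) (hb_pos : ∀ t : ℝ, 0 ≤ t → 0 < b t)
    (u₀ u₁ : H) (hu₀ : u₀ ∈ A.domain) (hu₁ : u₁ ∈ (Kirchhoff.sqrtOp A).domain)
    (hnd : m (‖Kirchhoff.opApply (Kirchhoff.sqrtOp A) u₀‖ ^ 2) ≠ 0)
    (T : ℝ) (hT : 0 < T) :
    ∃ ε₀ : ℝ, 0 < ε₀ ∧ ∀ ε : ℝ, 0 < ε → ε < ε₀ →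
      ∃ u : ℝ → H, Kirchhoff.IsKirchhoffSolution A m b ε T u₀ u₁ u ∧
        ∀ v : ℝ → H, Kirchhoff.IsKirchhoffSolution A m b ε T u₀ u₁ v →
          Set.EqOn v u (Set.Icc 0 T) := by
  have hB := Kirchhoff.sqrtOp_spec hA
  have hz₀ := Kirchhoff.mem_graph_opApply hu₀
  have hη₀ := Kirchhoff.mem_graph_opApply hu₁
  -- The factorization of A puts u₀ in D(A^{1/2}), so `opApply` in `hnd` is the genuine value ξ₀ and
  -- not the default 0.
  obtain ⟨ξ₀, hξ₀, -⟩ := (hB.2 _ _).1 hz₀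
  rw [Kirchhoff.opApply_eq hξ₀] at hnd
  have hbc : ContinuousOn b (Set.Icc 0 T) := hb.continuousOn.mono Set.Icc_subset_Ici_self
  have hb' : ∀ t ∈ Set.Icc 0 T, 0 < b t := fun t ht => hb_pos t ht.1
  obtain ⟨ε₀, hε₀, h⟩ := Kirchhoff.exists_isWeakSolution hA hB hm hm_nonneg hT.le hbc hb' hz₀ hξ₀
    hη₀ (lt_of_le_of_ne (hm_nonneg _ (by positivity)) hnd.symm)
  refine ⟨ε₀, hε₀, fun ε hε hεε₀ => ?_⟩
  obtain ⟨c₀, M, hc₀, hM, u, u', ξ, hu, hu0, hu'0⟩ := h ε hε hεε₀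
  obtain ⟨u'', ζ, η, hs⟩ := hu.exists_isStrongSolution hA hB hT.le hε hc₀ hM hbc
    (fun t ht => (hb' t ht).le) (hu0.symm ▸ hz₀) (hu'0.symm ▸ hη₀)
  refine ⟨u, ?_, fun v hv => ?_⟩
  · have := hs.isKirchhoffSolution hA hT
    rwa [hu0, hu'0] at this
  · obtain ⟨v', v'', ξ', ζ', η', hs', hv0, hv'0⟩ := hv.exists_isStrongSolution hT
    -- The coefficient bounds come from the constructed solution; nothing is assumed about the
    -- coefficient of the competitor v.
    exact hs.eqOn hB hT.le hε hc₀ hM hm (fun t ht => (hb' t ht).le) hs' hu.lipschitz_coeff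
      hu.le_coeff (hu0.trans hv0.symm) (hu'0.trans hv'0.symm)
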